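/- **Setting.** Take $n$ oriented tetrahedra with labelled vertices. Partition their $4n$ faces into $2n$ pairs uniformly at random and, independently for each pair, choose uniformly one of the three identifications of the two faces that reverse the cyclic orders of their vertices induced by the outward orientation. Gluing along these identifications gives a random $\Delta$-complex $T_n$; equivalently, $T_n$ is uniform over all $(4n-1)(4n-3)\cdots 3\cdot 1\cdot 3^{2n}$ possible gluings. The *degree* of an edge of $T_n$ is the number of tetrahedra incident to it, counted with multiplicity, i.e. the number of the $6n$ tetrahedron edges that are glued to form it; an edge is *simple* if at most one edge of each tetrahedron is mapped to it. Let $E$ be the number of edges of $T_n$, $E_k$ the number of edges of degree $k$, $E_k^\circ$ the number of simple edges of degree $k$, and $E_{KL}$ the number of pairs $(e,e')$ of distinct edges, of degree $\le K$ and $\le L$ respectively, that are incident to a common tetrahedron. Below $\kappa, k_1, k_2, K, L$ are integer-valued functions of $n$, and degrees are $\ge 1$. **Theorem 2.3 (Combinatorics of edges).** As $n\to\infty$: (a) $\mathbb E[E]=\tfrac12\log n+O(1)$. (b) For every $\kappa=o(\sqrt n)$, uniformly in $1\le k\le\kappa(n)$, $\ \mathbb E[E_k^\circ]=\frac1{2k}(1+o(1))$.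 (c) For every $\kappa=o(n)$, uniformly in $1\le k\le \kappa(n)$ and in $1\le k_1\le k_2\le\kappa(n)$, $$\mathbb E[E_k]\le\frac1{2k}+O(n^{-1}),\qquad \mathbb E\Big[\sum_{l=k_1}^{k_2}E_l\Big]\le\frac12\log\frac{k_2}{k_1}+O(1).$$ In particular, for every $\kappa=o(\sqrt n)$, uniformly in $1\le k\le \kappa(n)$ and in $1\le k_1\le k_2\le\kappa(n)$, $$\mathbb E[E_k]=\frac1{2k}(1+o(1)),\qquad \mathbb E\Big[\sum_{l=k_1}^{k_2}E_l\Big]=\Big(\frac12\sum_{l=k_1}^{k_2}\frac1l\Big)(1+o(1)),\qquad \mathbb E[E_k-E_k^\circ]=o(1);$$ and if moreover $k_1=k_1(n)$ and $k_2=k_2(n)$ satisfy $k_1\log(k_2/k_1)\to\infty$, then $$\mathbb E\Big[\sum_{l=k_1}^{k_2}E_l\Big]=\frac12\log\frac{k_2}{k_1}\,(1+o(1)).$$ (d) For all $K,L=o(n^{1/3})$, $\ \mathbb E[E_{KL}]=o(1)$. -/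

import Mathlib

open Filter Asymptotics Topology

namespace TetGluing

/-- The faces of `n` labelled oriented tetrahedra. Each tetrahedron `i : Fin n` has vertices
`0, 1, 2, 3` (in positive orientation), and `(i, j)` is its face opposite to the vertex `j`. -/
abbrev Face (n : ℕ) : Type := Fin n × Fin 4

/-- The three vertices of the face opposite to `j`, listed in the cyclic order that is induced by
the outward orientation: the faces of `[0,1,2,3]` are the cycles `(1 2 3)`, `(0 3 2)`, `(0 1 3)`
and `(0 2 1)`. -/
def faceVertex : Fin 4 → Fin 3 → Fin 4 :=
  ![![1, 2, 3], ![0, 3, 2], ![0, 1, 3], ![0, 2, 1]]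

/-- The sample space: a partition of the `4 n` faces into pairs (a fixed-point-free involution
`mate`), and for each pair of faces an identification of their vertices that reverses the cyclic
order. The vertex at position `a` (modulo 3) of the cycle of `F` is glued to the vertex at position
`glue F a` of the cycle of `mate F`. -/
@[ext]
structure Gluing (n : ℕ) where
  mate : Face n → Face n
  mate_mate : ∀ F, mate (mate F) = F
  mate_ne : ∀ F, mate F ≠ F
  glue : Face n → Fin 3 → Fin 3
  glue_reverse : ∀ F a, glue F (a + 1) = glue F a - 1
  glue_glue : ∀ F a, glue (mate F) (glue F a) = a

instance (n : ℕ) : Finite (Gluing n) :=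
  Finite.of_injective (fun ω : Gluing n => (ω.mate, ω.glue)) (by
    intro ω ω' h
    simp only [Prod.mk.injEq] at h
    exact Gluing.ext h.1 h.2)

noncomputable instance (n : ℕ) : Fintype (Gluing n) := Fintype.ofFinite _

/-- The expectation of a random variable for the uniform probability measure on `Gluing n`. -/
noncomputable def expect {n : ℕ} (X : Gluing n → ℝ) : ℝ :=
  (∑ ω, X ω) / (Fintype.card (Gluing n) : ℝ)

/-- The `6 n` edges of the `n` disjoint tetrahedra, an edge being a pair of vertices of one
tetrahedron. -/
abbrev TetEdge (n : ℕ) : Type := Fin n × {s : Finset (Fin 4) // s.card = 2}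

namespace Gluing

variable {n : ℕ} (ω : Gluing n)

/-- The edge `c` lies in some face `F`, and the gluing of `F` to its mate sends `c` to `c'`. -/
def Identified (c c' : TetEdge n) : Prop :=
  ∃ (F : Face n) (a b : Fin 3), a ≠ b ∧
    c.1 = F.1 ∧ c.2.1 = {faceVertex F.2 a, faceVertex F.2 b} ∧
    c'.1 = (ω.mate F).1 ∧
    c'.2.1 = {faceVertex (ω.mate F).2 (ω.glue F a), faceVertex (ω.mate F).2 (ω.glue F b)}

/-- The edges of the glued complex: the quotient of the edges of the tetrahedra by the equivalence
relation generated by the face identifications. -/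
def Edge : Type := Quot ω.Identified

/-- The edge of the complex that an edge of a tetrahedron is mapped to. -/
def toEdge (c : TetEdge n) : ω.Edge := Quot.mk _ c

/-- The number of tetrahedra incident to an edge of the complex, counted with multiplicity. -/
noncomputable def edgeDegree (e : ω.Edge) : ℕ := Nat.card {c : TetEdge n // ω.toEdge c = e}

/-- An edge of the complex is simple if it neighbours each tetrahedron at most once. -/
def IsSimpleEdge (e : ω.Edge) : Prop :=
  ∀ c c' : TetEdge n, ω.toEdge c = e → ω.toEdge c' = e → c.1 = c'.1 → c = c'

/-- Two edges of the complex are incident to a common tetrahedron. -/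
def ShareTet (e e' : ω.Edge) : Prop :=
  ∃ c c' : TetEdge n, ω.toEdge c = e ∧ ω.toEdge c' = e' ∧ c.1 = c'.1

/-- `E`: the total number of edges. -/
noncomputable def numEdges : ℕ := Nat.card ω.Edge

/-- `E_k`: the number of edges of degree `k`. -/
noncomputable def numEdgesOfDegree (k : ℕ) : ℕ := Nat.card {e : ω.Edge // ω.edgeDegree e = k}

/-- `E_k°`: the number of simple edges of degree `k`. -/
noncomputable def numSimpleEdgesOfDegree (k : ℕ) : ℕ :=
  Nat.card {e : ω.Edge // ω.IsSimpleEdge e ∧ ω.edgeDegree e = k}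

/-- `E_{KL}`: the number of (ordered) pairs of distinct edges of degrees at most `K` and at most
`L`, respectively, that are incident to a common tetrahedron. -/
noncomputable def numAdjacentPairs (K L : ℕ) : ℕ :=
  Nat.card {p : ω.Edge × ω.Edge // p.1 ≠ p.2 ∧ ω.edgeDegree p.1 ≤ K ∧ ω.edgeDegree p.2 ≤ L ∧
    ω.ShareTet p.1 p.2}

end Gluing

end TetGluing

open TetGluing

/-! An edge of a tetrahedron, seen from one of the two faces containing it, is a half-edge; there
are `12 n` of them. Crossing a glued face and then passing to the other face at the same tetrahedron
edge is a permutation `turn` of the half-edges, and an edge of degree `d` of the complex is a pair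
of `turn`-cycles of length `d`, exchanged by `opp`. Hence `E_k` is `1 / (2 k)` times the number of
half-edges of degree `k`, and everything reduces to the law of the degree of one half-edge, or of
two: the degree equals `k` with probability close to `1 / (12 n)`.

The gluing is revealed one pair of faces at a time, always gluing the face at one end of the path
built so far around `h`. Given what is revealed, this end is glued to a uniform one of `3 (|V| - 1)`
half-edges, `V` being the set of faces still free (`sum_cylinder_le`, `le_sum_cylinder`, from the
symmetry `card_fiber_le`). Exactly one of these choices glues the two ends of the path to each
other, which produces the term `1 / (12 n)`.

The difficulty is that paths can also close through the other sides of the glued faces, and that a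
step can lengthen the path by more than one. The free faces form a surface in which each triangle is
linked to three triangles. If the face at the end of the path is not defective, the path can close
only by gluing its two ends (`cross_exit_of_closing`), and then no other edge closes at that step
(`same_edge_of_closing`). A step that glues to a face far from the path and from all defects cannot
raise the weight or the danger (`step_weight`, `step_danger`). An unwanted closing therefore needs
two unlikely steps, the second of them soon after the first, and has probability `O(k / n²)` within
`k` steps (`sum_cylinder_le_of_closing`). This gives the upper bound for each degree `k = o(n)` and
the improbability of two distinct edges crossing the same faces. Two edges that do not cross the
same faces are treated by revealing one entirely and then the other (`sum_cylinder_two_edges_le`).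

There are two lower bounds. Always stepping to a new tetrahedron and then closing gives simple edges
of degree `k`, at a cost `k² / n`, which is harmless for `k = o(√n)` (`le_prob_simple`). The total
number of edges needs degrees up to a multiple of `n`; there the probability of degree at most `k`
is bounded below, with relative error `O(k / n)` (`le_prob_deg_le`), and the sum of the inverse
degrees is recovered by summation by parts. -/

namespace TetGluing

/-! ### Half-edges of the tetrahedra. -/

/-- The half-edges of the `n` tetrahedra: `(F, a)` is the edge of the face `F` opposite to the
vertex at position `a`, seen from `F`. -/
abbrev HalfEdge (n : ℕ) : Type := Face n × Fin 3

/-- The position of the vertex `j` in the cycle of the face opposite to `w`. -/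
def vertexPos : Fin 4 → Fin 4 → Fin 3 :=
  ![![0, 0, 1, 2], ![0, 0, 2, 1], ![0, 1, 0, 2], ![0, 2, 1, 0]]

/-- The same edge of the tetrahedron, seen from the other face that contains it. -/
def opp {n : ℕ} (h : HalfEdge n) : HalfEdge n :=
  ((h.1.1, faceVertex h.1.2 h.2), vertexPos (faceVertex h.1.2 h.2) h.1.2)

section opp

variable {n : ℕ}

theorem faceVertex_vertexPos : ∀ (j : Fin 4) (a : Fin 3),
    faceVertex (faceVertex j a) (vertexPos (faceVertex j a) j) = j ∧
    vertexPos j (faceVertex j a) = a ∧ faceVertex j a ≠ j := by decide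

@[simp] theorem opp_opp (h : HalfEdge n) : opp (opp h) = h := by
  obtain ⟨⟨i, j⟩, a⟩ := h
  simp only [opp, (faceVertex_vertexPos j a).1, (faceVertex_vertexPos j a).2.1]

theorem opp_fst_ne (h : HalfEdge n) : (opp h).1 ≠ h.1 := by
  obtain ⟨⟨i, j⟩, a⟩ := h
  simp [opp, (faceVertex_vertexPos j a).2.2]

@[simp] theorem opp_fst_fst (h : HalfEdge n) : (opp h).1.1 = h.1.1 := rfl

theorem opp_ne (h : HalfEdge n) : opp h ≠ h := fun e => opp_fst_ne h (by rw [e])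

theorem opp_injective : Function.Injective (opp (n := n)) :=
  Function.LeftInverse.injective opp_opp

theorem faceVertex_injective : ∀ j : Fin 4, Function.Injective (faceVertex j) := by decide

theorem opp_fst_injective (F : Face n) : Function.Injective fun a => (opp (F, a)).1 := by
  intro a b hab
  simp only [opp, Prod.mk.injEq, true_and] at hab
  exact faceVertex_injective _ hab

end opp

/-! ### The permutation that turns around an edge. -/

namespace Gluing

variable {n : ℕ} (ω : Gluing n)

/-- The half-edge that a half-edge is glued to. -/
def cross (h : HalfEdge n) : HalfEdge n := (ω.mate h.1, ω.glue h.1 h.2)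

/-- The next half-edge when turning around an edge: leave the tetrahedron through the face of `h`,
and cross the next one. -/
def turn (h : HalfEdge n) : HalfEdge n := opp (ω.cross h)

@[simp] theorem cross_fst (h : HalfEdge n) : (ω.cross h).1 = ω.mate h.1 := rfl

@[simp] theorem cross_cross (h : HalfEdge n) : ω.cross (ω.cross h) = h := by
  simp [cross, ω.mate_mate, ω.glue_glue]

theorem cross_ne (h : HalfEdge n) : ω.cross h ≠ h := fun e => ω.mate_ne h.1 (congrArg Prod.fst e)

theorem cross_injective : Function.Injective ω.cross :=
  Function.LeftInverse.injective ω.cross_cross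

theorem turn_injective : Function.Injective ω.turn := opp_injective.comp ω.cross_injective

@[simp] theorem opp_turn (h : HalfEdge n) : opp (ω.turn h) = ω.cross h := opp_opp _

/-- Seen from the other face, the edge is turned around in the opposite direction: `opp` conjugates
`turn` to its inverse. -/
theorem turn_opp_turn (h : HalfEdge n) : ω.turn (opp (ω.turn h)) = opp h := by
  simp [turn]

/-- Order reversal leaves one free parameter modulo 3, so gluing a single half-edge determines the
gluing of its whole face. -/
theorem glue_eq (F : Face n) (a : Fin 3) : ω.glue F a = ω.glue F 0 - a := by
  have h1 := ω.glue_reverse F 0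
  have h2 := ω.glue_reverse F 1
  fin_cases a
  · simp
  · simpa using h1
  · change ω.glue F 2 = ω.glue F 0 - 2
    rw [show (1 : Fin 3) + 1 = 2 from rfl] at h2
    rw [show (0 : Fin 3) + 1 = 1 from rfl] at h1
    rw [h2, h1]
    generalize ω.glue F 0 = c
    revert c; decide

theorem ext_cross {ω ω' : Gluing n} (h : ∀ x, ω.cross x = ω'.cross x) : ω = ω' := by
  ext1
  · funext F
    exact congrArg Prod.fst (h (F, 0))
  · funext F a
    exact congrArg Prod.snd (h (F, a))

theorem iterate_turn_opp (i l : ℕ) (h : HalfEdge n) :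
    ω.turn^[i] (opp (ω.turn^[i + l] h)) = opp (ω.turn^[l] h) := by
  induction i with
  | zero => simp
  | succ i ih =>
    rw [Function.iterate_succ_apply, show i + 1 + l = (i + l) + 1 by ring,
      Function.iterate_succ_apply', turn_opp_turn, ih]

/-- If `opp` mapped a cycle of `turn` to itself it would act there as a reflection, and the midpoint
between `h` and `opp h` would be a fixed point of `opp` (even distance) or of `cross` (odd
distance). This is where orientability enters: the two cycles of an edge are distinct. -/
theorem iterate_turn_ne_opp (i : ℕ) (h : HalfEdge n) : ω.turn^[i] h ≠ opp h := by
  intro e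
  obtain ⟨l, hl | hl⟩ := Nat.even_or_odd' i
  · have h1 := ω.iterate_turn_opp l 0 h
    simp only [add_zero, Function.iterate_zero, id] at h1
    rw [← e, hl, two_mul, Function.iterate_add_apply] at h1
    exact opp_ne _ (ω.turn_injective.iterate l h1)
  · have h1 := ω.iterate_turn_opp l 0 h
    simp only [add_zero, Function.iterate_zero, id] at h1
    rw [← e, hl, show 2 * l + 1 = l + (l + 1) by ring, Function.iterate_add_apply] at h1
    have h2 := ω.turn_injective.iterate l h1
    rw [Function.iterate_succ_apply', turn] at h2
    exact ω.cross_ne _ (opp_injective h2).symm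

/-- Arbitrarily late returns allow backward steps to be written as forward iterates. -/
theorem exists_iterate_turn_eq (h : HalfEdge n) (i : ℕ) : ∃ m, i < m ∧ ω.turn^[m] h = h := by
  have hp : h ∈ Function.periodicPts ω.turn :=
    Function.Injective.mem_periodicPts ω.turn_injective h
  obtain ⟨p, hp, hper⟩ := hp
  refine ⟨(i + 1) * p, ?_, ?_⟩
  · nlinarith
  · exact (hper.const_mul (i + 1))

/-- The degree of an edge, as the number of steps after which turning around it comes back. -/
noncomputable def deg (h : HalfEdge n) : ℕ := Function.minimalPeriod ω.turn h

theorem deg_pos (h : HalfEdge n) : 0 < ω.deg h :=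
  Function.minimalPeriod_pos_of_mem_periodicPts
    (Function.Injective.mem_periodicPts ω.turn_injective h)

theorem iterate_deg (h : HalfEdge n) : ω.turn^[ω.deg h] h = h :=
  Function.iterate_minimalPeriod

/-! ### Paths through the glued faces, when the faces in `V` are still free. -/

variable (V : Finset (Face n))

/-- The path around the edge of `h` that starts with `h` meets a face in `V`. -/
def IsOpen (h : HalfEdge n) : Prop := ∃ i, (ω.turn^[i] h).1 ∈ V

/-- The number of steps from `h` to the first face in `V`. -/
noncomputable def idx (h : HalfEdge n) : ℕ := sInf {i | (ω.turn^[i] h).1 ∈ V}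

/-- The first half-edge on the path from `h` whose face is in `V`. -/
noncomputable def exit (h : HalfEdge n) : HalfEdge n := ω.turn^[ω.idx V h] h

/-- The other end of the path that enters the glued faces at `w`. -/
noncomputable def partner (w : HalfEdge n) : HalfEdge n := ω.exit V (opp w)

/-- The set of faces `V` is a union of pairs of glued faces. -/
def MateClosed : Prop := ∀ F ∈ V, ω.mate F ∈ V

variable {ω V}

theorem MateClosed.mem_iff (hV : ω.MateClosed V) {F : Face n} : ω.mate F ∈ V ↔ F ∈ V :=
  ⟨fun h => by simpa [ω.mate_mate] using hV _ h, hV F⟩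

theorem IsOpen.exit_mem {h : HalfEdge n} (ho : ω.IsOpen V h) : (ω.exit V h).1 ∈ V :=
  Nat.sInf_mem (s := {i | (ω.turn^[i] h).1 ∈ V}) ho

theorem notMem_of_lt_idx {h : HalfEdge n} {i : ℕ} (hi : i < ω.idx V h) :
    (ω.turn^[i] h).1 ∉ V := Nat.notMem_of_lt_sInf hi

theorem idx_le {h : HalfEdge n} {i : ℕ} (hi : (ω.turn^[i] h).1 ∈ V) : ω.idx V h ≤ i :=
  Nat.sInf_le hi

theorem idx_eq {h : HalfEdge n} {i : ℕ} (hi : (ω.turn^[i] h).1 ∈ V)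
    (hlt : ∀ j < i, (ω.turn^[j] h).1 ∉ V) : ω.idx V h = i := by
  refine le_antisymm (idx_le hi) (not_lt.1 fun hl => hlt _ hl ?_)
  exact IsOpen.exit_mem ⟨i, hi⟩

theorem isOpen_of_mem {h : HalfEdge n} (hh : h.1 ∈ V) : ω.IsOpen V h := ⟨0, hh⟩

theorem idx_of_mem {h : HalfEdge n} (hh : h.1 ∈ V) : ω.idx V h = 0 := idx_eq hh (by simp)

theorem exit_of_mem {h : HalfEdge n} (hh : h.1 ∈ V) : ω.exit V h = h := by
  simp [exit, idx_of_mem hh]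

theorem isOpen_shift {h : HalfEdge n} {i : ℕ} (hlt : ∀ j < i, (ω.turn^[j] h).1 ∉ V) :
    ω.IsOpen V h ↔ ω.IsOpen V (ω.turn^[i] h) := by
  constructor
  · rintro ⟨j, hj⟩
    have : i ≤ j := not_lt.1 fun hl => hlt j hl hj
    obtain ⟨l, rfl⟩ := Nat.exists_eq_add_of_le this
    exact ⟨l, by rwa [← Function.iterate_add_apply, add_comm]⟩
  · rintro ⟨j, hj⟩
    exact ⟨j + i, by rwa [Function.iterate_add_apply]⟩

theorem idx_shift {h : HalfEdge n} {i : ℕ} (hlt : ∀ j < i, (ω.turn^[j] h).1 ∉ V)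
    (ho : ω.IsOpen V h) : ω.idx V h = i + ω.idx V (ω.turn^[i] h) := by
  refine idx_eq ?_ ?_
  · have := ((isOpen_shift hlt).1 ho).exit_mem
    rwa [exit, ← Function.iterate_add_apply, add_comm] at this
  · intro j hj
    by_cases hji : j < i
    · exact hlt j hji
    · obtain ⟨l, rfl⟩ := Nat.exists_eq_add_of_le (not_lt.1 hji)
      rw [add_comm, Function.iterate_add_apply]
      exact notMem_of_lt_idx (by omega)

theorem exit_shift {h : HalfEdge n} {i : ℕ} (hlt : ∀ j < i, (ω.turn^[j] h).1 ∉ V)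
    (ho : ω.IsOpen V h) : ω.exit V h = ω.exit V (ω.turn^[i] h) := by
  rw [exit, exit, idx_shift hlt ho, add_comm, Function.iterate_add_apply]

theorem opp_iterate_succ_mem (hV : ω.MateClosed V) {h : HalfEdge n} {i : ℕ} :
    (opp (ω.turn^[i + 1] h)).1 ∈ V ↔ (ω.turn^[i] h).1 ∈ V := by
  rw [Function.iterate_succ_apply', opp_turn, cross_fst, hV.mem_iff]

theorem IsOpen.opp (hV : ω.MateClosed V) {h : HalfEdge n} (ho : ω.IsOpen V h) :
    ω.IsOpen V (opp h) := by
  obtain ⟨i, hi⟩ := ho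
  obtain ⟨m, hm, hmh⟩ := ω.exists_iterate_turn_eq h i
  refine ⟨m - (i + 1), ?_⟩
  have := ω.iterate_turn_opp (m - (i + 1)) (i + 1) h
  rw [Nat.sub_add_cancel hm, hmh] at this
  rw [this]
  exact (opp_iterate_succ_mem hV).2 hi

theorem isOpen_opp_iff (hV : ω.MateClosed V) {h : HalfEdge n} :
    ω.IsOpen V (TetGluing.opp h) ↔ ω.IsOpen V h :=
  ⟨fun ho => by simpa using ho.opp hV, fun ho => ho.opp hV⟩

theorem opp_exit_notMem (hV : ω.MateClosed V) {h : HalfEdge n} :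
    ∀ j < ω.idx V h, (ω.turn^[j] (opp (ω.exit V h))).1 ∉ V := by
  intro j hj
  obtain ⟨l, hl⟩ := Nat.exists_eq_add_of_lt hj
  have := ω.iterate_turn_opp j (l + 1) h
  rw [exit, hl, add_assoc, this, opp_iterate_succ_mem hV]
  exact notMem_of_lt_idx (by omega)

theorem iterate_opp_exit {h : HalfEdge n} :
    ω.turn^[ω.idx V h] (opp (ω.exit V h)) = opp h := by
  simpa [exit] using ω.iterate_turn_opp (ω.idx V h) 0 h

theorem isOpen_opp_exit (hV : ω.MateClosed V) {h : HalfEdge n} (ho : ω.IsOpen V h) :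
    ω.IsOpen V (opp (ω.exit V h)) := IsOpen.opp hV (isOpen_of_mem ho.exit_mem)

/-- Walking back from the exit of `h` passes through `opp h` and meets no free face before it, so it
ends where the path from `opp h` ends. Thus `partner` pairs the two ends of each path. -/
theorem partner_exit (hV : ω.MateClosed V) {h : HalfEdge n} (ho : ω.IsOpen V h) :
    ω.partner V (ω.exit V h) = ω.exit V (opp h) := by
  rw [partner, exit_shift (opp_exit_notMem hV) (isOpen_opp_exit hV ho), iterate_opp_exit]

theorem partner_mem (hV : ω.MateClosed V) {w : HalfEdge n} (hw : w.1 ∈ V) :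
    (ω.partner V w).1 ∈ V := ((isOpen_of_mem hw).opp hV).exit_mem

theorem partner_partner (hV : ω.MateClosed V) {w : HalfEdge n} (hw : w.1 ∈ V) :
    ω.partner V (ω.partner V w) = w := by
  have := partner_exit hV ((isOpen_of_mem hw).opp hV)
  rwa [opp_opp, exit_of_mem hw] at this

theorem partner_ne (w : HalfEdge n) : ω.partner V w ≠ w := fun e =>
  ω.iterate_turn_ne_opp (ω.idx V (opp w)) (opp w) (by rw [opp_opp]; exact e)

section nested

variable {V' : Finset (Face n)}

theorem isOpen_of_exit_mem {h : HalfEdge n} (he : (ω.exit V h).1 ∈ V') :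
    ω.IsOpen V' h := ⟨_, he⟩

theorem idx_of_exit_mem (hs : V' ⊆ V) {h : HalfEdge n} (he : (ω.exit V h).1 ∈ V') :
    ω.idx V' h = ω.idx V h :=
  idx_eq he fun _ hj hm => notMem_of_lt_idx hj (hs hm)

theorem exit_of_exit_mem (hs : V' ⊆ V) {h : HalfEdge n} (he : (ω.exit V h).1 ∈ V') :
    ω.exit V' h = ω.exit V h := by rw [exit, idx_of_exit_mem hs he, exit]

theorem notMem_nested (hs : V' ⊆ V) {h : HalfEdge n} (he : (ω.exit V h).1 ∉ V') :
    ∀ j < ω.idx V h + 1, (ω.turn^[j] h).1 ∉ V' := by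
  intro j hj
  rcases Nat.lt_succ_iff_lt_or_eq.1 hj with hj | rfl
  · exact fun hm => notMem_of_lt_idx hj (hs hm)
  · exact he

theorem iterate_idx_succ {h : HalfEdge n} :
    ω.turn^[ω.idx V h + 1] h = opp (ω.cross (ω.exit V h)) := by
  rw [Function.iterate_succ_apply']; rfl

theorem isOpen_nested (hs : V' ⊆ V) {h : HalfEdge n} (he : (ω.exit V h).1 ∉ V') :
    ω.IsOpen V' h ↔ ω.IsOpen V' (TetGluing.opp (ω.cross (ω.exit V h))) := by
  rw [isOpen_shift (notMem_nested hs he), iterate_idx_succ]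

theorem idx_nested (hs : V' ⊆ V) {h : HalfEdge n} (he : (ω.exit V h).1 ∉ V')
    (ho : ω.IsOpen V' h) :
    ω.idx V' h = ω.idx V h + 1 + ω.idx V' (TetGluing.opp (ω.cross (ω.exit V h))) := by
  rw [idx_shift (notMem_nested hs he) ho, iterate_idx_succ]

/-- When more faces are glued, a path that ended at a newly glued face crosses it and continues with
the path that starts on the other side. -/
theorem exit_nested (hs : V' ⊆ V) {h : HalfEdge n} (he : (ω.exit V h).1 ∉ V')
    (ho : ω.IsOpen V' h) : ω.exit V' h = ω.partner V' (ω.cross (ω.exit V h)) := by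
  rw [exit_shift (notMem_nested hs he) ho, iterate_idx_succ, partner]

theorem idx_mono (hs : V' ⊆ V) {h : HalfEdge n} (ho : ω.IsOpen V' h) :
    ω.idx V h ≤ ω.idx V' h := idx_le (hs ho.exit_mem)

/-- If the path from `h` leaves `V'` but comes back to it after one more crossing, this is where
it ends. -/
theorem exit_of_partner_mem (hs : V' ⊆ V) {h : HalfEdge n} (he : (ω.exit V h).1 ∉ V')
    (hp : (ω.partner V (ω.cross (ω.exit V h))).1 ∈ V') :
    ω.IsOpen V' h ∧ ω.exit V' h = ω.partner V (ω.cross (ω.exit V h)) ∧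
      ω.idx V' h = ω.idx V h + 1 + ω.idx V (TetGluing.opp (ω.cross (ω.exit V h))) := by
  have ho := (isOpen_nested hs he).2 (isOpen_of_exit_mem hp)
  refine ⟨ho, ?_, ?_⟩
  · rw [exit_nested hs he ho, partner, exit_of_exit_mem hs hp, partner]
  · rw [idx_nested hs he ho, idx_of_exit_mem hs hp]

end nested

/-- The length of the path through `h`, as long as it is not closed. -/
noncomputable def pathLength (ω : Gluing n) (V : Finset (Face n)) (h : HalfEdge n) : ℕ :=
  1 + ω.idx V h + ω.idx V (TetGluing.opp h)

/-- On the cycle of `h`, the forward arc up to the first free face and the backward arc, read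
through `opp`, do not overlap. They fill the cycle exactly when the two ends of the path are glued
to each other. -/
theorem pathLength_le_deg (hV : ω.MateClosed V) {h : HalfEdge n} (ho : ω.IsOpen V h) :
    ω.pathLength V h ≤ ω.deg h ∧
      (ω.pathLength V h = ω.deg h ↔ ω.cross (ω.exit V h) = ω.exit V (TetGluing.opp h)) := by
  obtain ⟨d, hd⟩ : ∃ d, ω.deg h = d := ⟨_, rfl⟩
  have hper := ω.iterate_deg h
  have hpos := ω.deg_pos h
  rw [hd] at hper hpos
  have hmod : ∀ i, ω.turn^[i] h = ω.turn^[i % d] h := by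
    intro i
    have := Function.iterate_mod_minimalPeriod_eq (f := ω.turn) (x := h) (n := i)
    rw [← hd]; exact this.symm
  have hi : ω.idx V h < d := by
    by_contra hc
    have h1 := ho.exit_mem
    rw [exit, hmod] at h1
    exact absurd (idx_le h1) (not_le.2 ((Nat.mod_lt _ hpos).trans_le (not_lt.1 hc)))
  -- The path from `opp h` is the cycle of `h` read backwards, seen from across the faces.
  have hback : ∀ j < d, ω.turn^[j] (TetGluing.opp h) = ω.cross (ω.turn^[d - 1 - j] h) := by
    intro j hj
    have h1 := ω.iterate_turn_opp j (d - 1 - j + 1) h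
    rw [show j + (d - 1 - j + 1) = d by omega, hper, Function.iterate_succ_apply', opp_turn] at h1
    exact h1
  have hle : ω.idx V (TetGluing.opp h) ≤ d - 1 - ω.idx V h := by
    refine idx_le ?_
    rw [hback _ (by omega), cross_fst, hV.mem_iff,
      show d - 1 - (d - 1 - ω.idx V h) = ω.idx V h by omega]
    exact ho.exit_mem
  have hcr : ω.exit V (TetGluing.opp h) = ω.cross (ω.turn^[d - 1 - ω.idx V (TetGluing.opp h)] h) :=
    hback _ (by omega)
  unfold pathLength
  rw [hd]
  refine ⟨by omega, ?_, ?_⟩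
  · intro he
    rw [hcr, exit]
    congr 3
    omega
  · intro he
    rw [hcr] at he
    have h2 := ω.cross_injective he
    have h3 : Set.InjOn (fun i => ω.turn^[i] h) (Set.Iio d) := by
      rw [← hd]; exact Function.iterate_injOn_Iio_minimalPeriod
    have := h3 (Set.mem_Iio.2 hi) (Set.mem_Iio.2 (by omega)) h2
    omega

/-- The paths are disjoint, so that their total length is at most the number of half-edges. -/
theorem sum_idx_opp_le (hV : ω.MateClosed V) :
    ∑ z : HalfEdge n with z.1 ∈ V, (ω.idx V (TetGluing.opp z) + 1) ≤ 12 * n := by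
  have hc : Fintype.card (HalfEdge n) = 12 * n := by simp; ring
  rw [← hc, ← Finset.card_univ (α := HalfEdge n)]
  calc _ = ((Finset.univ.filter fun z : HalfEdge n => z.1 ∈ V).sigma
        fun z => Finset.range (ω.idx V (TetGluing.opp z) + 1)).card := by
        rw [Finset.card_sigma]; simp
    _ ≤ _ := by
        refine Finset.card_le_card_of_injOn
          (fun x : (_ : HalfEdge n) × ℕ => ω.turn^[x.2] (TetGluing.opp x.1))
          (fun _ _ => Finset.mem_coe.2 (Finset.mem_univ _)) ?_
        have key : ∀ z z' : HalfEdge n, ∀ j j' : ℕ, z.1 ∈ V →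
            j' ≤ ω.idx V (TetGluing.opp z') → j ≤ j' →
            ω.turn^[j] (TetGluing.opp z) = ω.turn^[j'] (TetGluing.opp z') → z = z' ∧ j = j' := by
          intro z z' j j' hz hj' hjj he
          obtain ⟨d, rfl⟩ := Nat.exists_eq_add_of_le hjj
          rw [Function.iterate_add_apply] at he
          have he := ω.turn_injective.iterate j he
          cases d with
          | zero => exact ⟨opp_injective he, rfl⟩
          -- The predecessor of `opp z` in its cycle is `cross z`, at a free face, so a path that
          -- reached `opp z` would have stopped before.
          | succ d =>
            exfalso
            rw [Function.iterate_succ_apply', turn] at he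
            have h1 := congrArg Prod.fst (opp_injective he)
            rw [cross_fst] at h1
            refine notMem_of_lt_idx (ω := ω) (V := V) (i := d) (h := TetGluing.opp z') (by omega) ?_
            rw [← hV.mem_iff, ← h1]
            exact hz
        rintro ⟨z, j⟩ hz ⟨z', j'⟩ hz' he
        simp only [Finset.coe_sigma, Set.mem_sigma_iff, Finset.mem_coe, Finset.mem_filter,
          Finset.mem_univ, true_and, Finset.mem_range] at hz hz'
        rcases le_total j j' with hjj | hjj
        · obtain ⟨rfl, rfl⟩ := key z z' j j' hz.1 (by omega) hjj he
          rfl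
        · obtain ⟨rfl, rfl⟩ := key z' z j' j hz'.1 (by omega) hjj he.symm
          rfl

end Gluing
end TetGluing

/-! ### Defects of the free surface, and the danger of a state. -/

namespace TetGluing
namespace Gluing

variable {n : ℕ} (ω : Gluing n) (V : Finset (Face n)) (h : HalfEdge n)

/-- The face at the other end of the path that starts at the half-edge `(F, a)`. -/
noncomputable def nb (F : Face n) (a : Fin 3) : Face n := (ω.partner V (F, a)).1

/-- A face is defective if it is linked twice to the same face, possibly to itself. -/
def Defective (F : Face n) : Prop := ¬ Function.Injective (ω.nb V F)

open Classical in
/-- The set of defective faces. -/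
noncomputable def defects : Finset (Face n) := V.filter (ω.Defective V)

/-- The faces that are linked to a face in `E`. -/
noncomputable def nbrs (E : Finset (Face n)) : Finset (Face n) :=
  E ∪ (E ×ˢ Finset.univ).image fun z => (ω.partner V z).1

/-- The defective faces together with those at the ends of the path through `h`. -/
noncomputable def core : Finset (Face n) :=
  insert (ω.exit V h).1 (insert (ω.exit V (opp h)).1 (ω.defects V))

/-- The faces at distance at most three from the core. -/
noncomputable def exceptional : Finset (Face n) :=
  ω.nbrs V (ω.nbrs V (ω.nbrs V (ω.core V h)))

/-- The faces that remain after gluing the face `F` to its mate. -/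
def remove (F : Face n) : Finset (Face n) := V \ {F, ω.mate F}

open Classical in
/-- The level of danger of a state: two if both ends of the path through `h` are at the same face,
one if otherwise the first one is at a defective face. -/
noncomputable def danger : ℕ :=
  if ω.Defective V (ω.exit V h).1 then
    if (ω.exit V h).1 = (ω.exit V (opp h)).1 then 2 else 1
  else 0

variable {ω V h}

theorem mem_defects {F : Face n} : F ∈ ω.defects V ↔ F ∈ V ∧ ω.Defective V F := by
  classical
  simp [defects]

theorem subset_nbrs (E : Finset (Face n)) : E ⊆ ω.nbrs V E := Finset.subset_union_left

theorem card_nbrs_le (E : Finset (Face n)) : (ω.nbrs V E).card ≤ 4 * E.card := by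
  refine (Finset.card_union_le _ _).trans ?_
  have : (E ×ˢ (Finset.univ : Finset (Fin 3))).card = E.card * 3 := by simp
  calc _ ≤ E.card + E.card * 3 := Nat.add_le_add_left (this ▸ Finset.card_image_le) _
    _ = _ := by ring

/-- Each passage to neighbours multiplies the size by at most `4`, and `64 = 4³`; the `2` counts the
faces at the two ends of the path. -/
theorem card_exceptional_le : (ω.exceptional V h).card ≤ 64 * ((ω.defects V).card + 2) := by
  have h1 : (ω.core V h).card ≤ (ω.defects V).card + 2 :=
    (Finset.card_insert_le _ _).trans (Nat.succ_le_succ (Finset.card_insert_le _ _))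
  have h2 := card_nbrs_le (ω := ω) (V := V) (ω.core V h)
  have h3 := card_nbrs_le (ω := ω) (V := V) (ω.nbrs V (ω.core V h))
  have h4 := card_nbrs_le (ω := ω) (V := V) (ω.nbrs V (ω.nbrs V (ω.core V h)))
  unfold exceptional
  omega

theorem mem_nbrs_of_partner (hV : ω.MateClosed V) {E : Finset (Face n)} {w : HalfEdge n}
    (hw : w.1 ∈ V) (hp : (ω.partner V w).1 ∈ E) : w.1 ∈ ω.nbrs V E := by
  refine Finset.mem_union_right _ (Finset.mem_image.2 ⟨ω.partner V w, ?_, ?_⟩)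
  · simpa using hp
  · rw [partner_partner hV hw]

theorem mem_remove {F F' : Face n} : F' ∈ ω.remove V F ↔ F' ∈ V ∧ F' ≠ F ∧ F' ≠ ω.mate F := by
  simp [remove]

theorem remove_subset (F : Face n) : ω.remove V F ⊆ V := Finset.sdiff_subset

theorem MateClosed.remove (hV : ω.MateClosed V) (F : Face n) : ω.MateClosed (ω.remove V F) := by
  intro F' hF'
  rw [mem_remove] at hF' ⊢
  refine ⟨hV _ hF'.1, fun e => hF'.2.2 ?_, fun e => hF'.2.1 ?_⟩
  · rw [← e, ω.mate_mate]
  · rw [← ω.mate_mate F', e, ω.mate_mate]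

theorem card_remove (hV : ω.MateClosed V) {F : Face n} (hF : F ∈ V) :
    (ω.remove V F).card + 2 = V.card := by
  have h1 : ({F, ω.mate F} : Finset (Face n)).card = 2 := Finset.card_pair (ω.mate_ne F).symm
  have h2 : ({F, ω.mate F} : Finset (Face n)) ⊆ V := by
    intro x hx
    rcases Finset.mem_insert.1 hx with rfl | hx
    · exact hF
    · rw [Finset.mem_singleton.1 hx]; exact hV _ hF
  have h3 := Finset.card_le_card h2
  rw [remove, Finset.card_sdiff_of_subset h2]
  omega

theorem exit_fst_notMem_remove : (ω.exit V h).1 ∉ ω.remove V (ω.exit V h).1 := by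
  simp [mem_remove]

theorem partner_remove_of_mem {F : Face n} {w : HalfEdge n}
    (hp : (ω.partner V w).1 ∈ ω.remove V F) : ω.partner (ω.remove V F) w = ω.partner V w :=
  exit_of_exit_mem (remove_subset F) hp

theorem partner_remove_of_cross {F : Face n} {w : HalfEdge n}
    (hw : (ω.partner V w).1 ∉ ω.remove V F)
    (hp : (ω.partner V (ω.cross (ω.partner V w))).1 ∈ ω.remove V F) :
    ω.partner (ω.remove V F) w = ω.partner V (ω.cross (ω.partner V w)) :=
  (exit_of_partner_mem (remove_subset F) hw hp).2.1

theorem nb_mem (hV : ω.MateClosed V) {F : Face n} (hF : F ∈ V) (a : Fin 3) : ω.nb V F a ∈ V :=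
  partner_mem hV (w := (F, a)) hF

/-- A link from `F` to itself uses two different sides of `F`, so injectivity of the links also
excludes self-links. -/
theorem nb_ne_of_not_defective (hV : ω.MateClosed V) {F : Face n} (hF : F ∈ V)
    (hd : ¬ ω.Defective V F) (a : Fin 3) : ω.nb V F a ≠ F := by
  intro e
  have hinj : Function.Injective (ω.nb V F) := not_not.1 hd
  have hp : ω.partner V (F, a) = (F, (ω.partner V (F, a)).2) := Prod.ext e rfl
  have h2 : ω.nb V F (ω.partner V (F, a)).2 = F := by
    rw [nb, ← hp, partner_partner hV hF]
  have h3 := hinj (e.trans h2.symm)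
  rw [← h3] at hp
  exact partner_ne _ hp

theorem nb_eq_comm (hV : ω.MateClosed V) {F : Face n} (hF : F ∈ V) {a : Fin 3} :
    ∃ b, ω.nb V (ω.nb V F a) b = F :=
  ⟨(ω.partner V (F, a)).2, by
    rw [nb, show (ω.nb V F a, (ω.partner V (F, a)).2) = ω.partner V (F, a) from rfl,
      partner_partner hV hF]⟩

/-- Only faces linked to `F` or to its mate get new links, and two triangles have six sides. -/
theorem card_defects_remove_le (hV : ω.MateClosed V) (F : Face n) :
    (ω.defects (ω.remove V F)).card ≤ (ω.defects V).card + 6 := by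
  classical
  have hsub : ω.defects (ω.remove V F) ⊆ ω.defects V ∪
      (({F, ω.mate F} : Finset (Face n)) ×ˢ (Finset.univ : Finset (Fin 3))).image
        fun z => (ω.partner V z).1 := by
    intro F' hF'
    rw [mem_defects] at hF'
    obtain ⟨hF', hd⟩ := hF'
    have hF'V := remove_subset F hF'
    by_cases hc : ∀ a, ω.nb V F' a ∈ ω.remove V F
    · refine Finset.mem_union_left _ (mem_defects.2 ⟨hF'V, fun hi => hd ?_⟩)
      have : ω.nb (ω.remove V F) F' = ω.nb V F' := by
        funext a
        rw [nb, partner_remove_of_mem (hc a), nb]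
      rwa [this]
    · push Not at hc
      obtain ⟨a, ha⟩ := hc
      refine Finset.mem_union_right _ (Finset.mem_image.2 ⟨ω.partner V (F', a), ?_, ?_⟩)
      · rw [mem_remove] at ha
        have h1 := nb_mem hV hF'V a
        unfold nb at ha h1
        simp only [Finset.mem_product, Finset.mem_insert, Finset.mem_singleton, Finset.mem_univ,
          and_true]
        tauto
      · rw [partner_partner hV hF'V]
  refine (Finset.card_le_card hsub).trans ((Finset.card_union_le _ _).trans ?_)
  refine Nat.add_le_add_left (Finset.card_image_le.trans ?_) _
  rw [Finset.card_product]
  have := Finset.card_le_two (a := F) (b := ω.mate F)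
  simp
  omega

/-- Before any gluing, each face is linked to the three other faces of its tetrahedron. -/
theorem defects_univ : ω.defects Finset.univ = ∅ := by
  refine Finset.eq_empty_of_forall_notMem fun F hF => (mem_defects.1 hF).2 ?_
  have : ω.nb Finset.univ F = fun a => (opp (F, a)).1 := by
    funext a
    rw [nb, partner, exit_of_mem (Finset.mem_univ _)]
  rw [this]
  exact opp_fst_injective F

/-- A face whose three neighbours in its tetrahedron are all free still has its initial links; so a
defect is adjacent, inside a tetrahedron, to a glued face. -/
theorem card_defects_le : (ω.defects V).card ≤ 3 * (Finset.univ \ V).card := by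
  classical
  have hsub : ω.defects V ⊆ ((Finset.univ \ V) ×ˢ (Finset.univ : Finset (Fin 3))).image
      fun z => (opp z).1 := by
    intro F hF
    obtain ⟨hF, hd⟩ := mem_defects.1 hF
    by_contra hc
    refine hd ?_
    have : ω.nb V F = fun a => (opp (F, a)).1 := by
      funext a
      rw [nb, partner, exit_of_mem]
      by_contra hm
      refine hc (Finset.mem_image.2 ⟨opp (F, a), ?_, by simp⟩)
      simpa using hm
    rw [this]
    exact opp_fst_injective F
  refine (Finset.card_le_card hsub).trans (Finset.card_image_le.trans ?_)
  rw [Finset.card_product]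
  simp; omega

theorem defective_of_exit_fst_eq (hV : ω.MateClosed V) (ho : ω.IsOpen V h)
    (he : (ω.exit V h).1 = (ω.exit V (opp h)).1) : ω.Defective V (ω.exit V h).1 := by
  intro hi
  refine nb_ne_of_not_defective hV ho.exit_mem (not_not.2 hi) (ω.exit V h).2 ?_
  rw [nb, partner_exit hV ho, he]

theorem danger_le_two : ω.danger V h ≤ 2 := by
  unfold danger; split_ifs <;> omega

theorem danger_eq_zero : ω.danger V h = 0 ↔ ¬ ω.Defective V (ω.exit V h).1 := by
  unfold danger; split_ifs <;> simp_all

theorem danger_eq_two (hV : ω.MateClosed V) (ho : ω.IsOpen V h) :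
    ω.danger V h = 2 ↔ (ω.exit V h).1 = (ω.exit V (opp h)).1 := by
  unfold danger
  split_ifs with h1 h2
  · simp [h2]
  · simp [h2]
  · simp only [false_iff]
    exact fun e => h1 (defective_of_exit_fst_eq hV ho e)

/-! ### The effect of gluing the end of the path to a generic face. -/

section step

variable (hV : ω.MateClosed V) (ho : ω.IsOpen V h)
  (hE : ω.mate (ω.exit V h).1 ∉ ω.exceptional V h)

include hV ho in
theorem mate_exit_mem : ω.mate (ω.exit V h).1 ∈ V := hV _ ho.exit_mem

include hV ho hE in
theorem nb_mate_notMem (a : Fin 3) :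
    ω.nb V (ω.mate (ω.exit V h).1) a ∉ ω.nbrs V (ω.nbrs V (ω.core V h)) := fun hm =>
  hE (mem_nbrs_of_partner (w := (_, a)) hV (mate_exit_mem hV ho) hm)

include hV ho hE in
theorem nb_nb_mate_notMem (a b : Fin 3) :
    ω.nb V (ω.nb V (ω.mate (ω.exit V h).1) a) b ∉ ω.nbrs V (ω.core V h) := fun hm =>
  nb_mate_notMem hV ho hE a
    (mem_nbrs_of_partner (w := (_, b)) hV (nb_mem hV (mate_exit_mem hV ho) _) hm)

include hE in
theorem mate_notMem_core : ω.mate (ω.exit V h).1 ∉ ω.core V h := fun hm =>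
  hE (subset_nbrs _ (subset_nbrs _ (subset_nbrs _ hm)))

include hV ho hE in
theorem not_defective_mate : ¬ ω.Defective V (ω.mate (ω.exit V h).1) := fun hd =>
  mate_notMem_core hE (Finset.mem_insert_of_mem (Finset.mem_insert_of_mem
    (mem_defects.2 ⟨mate_exit_mem hV ho, hd⟩)))

include hV ho hE in
theorem nb_mate_notMem_core (a : Fin 3) : ω.nb V (ω.mate (ω.exit V h).1) a ∉ ω.core V h :=
  fun hm => nb_mate_notMem hV ho hE a (subset_nbrs _ (subset_nbrs _ hm))

include hV ho hE in
theorem nb_mate_mem_remove (a : Fin 3) :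
    ω.nb V (ω.mate (ω.exit V h).1) a ∈ ω.remove V (ω.exit V h).1 := by
  refine mem_remove.2 ⟨nb_mem hV (mate_exit_mem hV ho) _, fun e => ?_, ?_⟩
  · refine nb_mate_notMem_core hV ho hE a ?_
    rw [e]
    exact Finset.mem_insert_self _ _
  · exact nb_ne_of_not_defective hV (mate_exit_mem hV ho) (not_defective_mate hV ho hE) a

include hV ho hE in
theorem partner_cross_mem_remove {z : HalfEdge n} (hz : z.1 = (ω.exit V h).1) :
    (ω.partner V (ω.cross z)).1 ∈ ω.remove V (ω.exit V h).1 := by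
  have := nb_mate_mem_remove hV ho hE (ω.cross z).2
  rwa [nb, show (ω.mate (ω.exit V h).1, (ω.cross z).2) = ω.cross z from
    Prod.ext (by rw [cross_fst, hz]) rfl] at this

include hV ho hE in
/-- Gluing the first end of the path through `h` to a generic face does not close the path. -/
theorem step_exit : ω.IsOpen (ω.remove V (ω.exit V h).1) h ∧
    ω.exit (ω.remove V (ω.exit V h).1) h = ω.partner V (ω.cross (ω.exit V h)) ∧
    ω.idx (ω.remove V (ω.exit V h).1) h =
      ω.idx V h + 1 + ω.idx V (opp (ω.cross (ω.exit V h))) :=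
  exit_of_partner_mem (remove_subset _) exit_fst_notMem_remove
    (partner_cross_mem_remove hV ho hE rfl)

include hV ho hE in
theorem exit_opp_mem_remove (hne : (ω.exit V h).1 ≠ (ω.exit V (opp h)).1) :
    (ω.exit V (opp h)).1 ∈ ω.remove V (ω.exit V h).1 := by
  refine mem_remove.2 ⟨(ho.opp hV).exit_mem, hne.symm, fun e => mate_notMem_core hE ?_⟩
  rw [← e]
  exact Finset.mem_insert_of_mem (Finset.mem_insert_self _ _)

-- The whole path that enters at the new face is appended, so the length may grow by more than one.
include hV ho hE in
theorem step_pathLength (hne : (ω.exit V h).1 ≠ (ω.exit V (opp h)).1) :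
    ω.pathLength (ω.remove V (ω.exit V h).1) h =
      ω.pathLength V h + 1 + ω.idx V (opp (ω.cross (ω.exit V h))) := by
  rw [pathLength, (step_exit hV ho hE).2.2,
    idx_of_exit_mem (remove_subset _) (exit_opp_mem_remove hV ho hE hne), pathLength]
  ring

-- Both ends leave through the mate, along two different sides; the mate is not defective, so they
-- arrive at different faces.
include hV ho hE in
theorem step_ends_ne_of_eq (he : (ω.exit V h).1 = (ω.exit V (opp h)).1) :
    (ω.exit (ω.remove V (ω.exit V h).1) h).1 ≠
      (ω.exit (ω.remove V (ω.exit V h).1) (opp h)).1 := by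
  have h1 : (ω.exit V (opp h)).1 ∉ ω.remove V (ω.exit V h).1 := by
    rw [← he]; exact exit_fst_notMem_remove
  have h2 := (exit_of_partner_mem (remove_subset _) h1
    (partner_cross_mem_remove hV ho hE he.symm)).2.1
  rw [(step_exit hV ho hE).2.1, h2]
  intro e
  have hinj : Function.Injective (ω.nb V (ω.mate (ω.exit V h).1)) :=
    not_not.1 (not_defective_mate hV ho hE)
  have h3 := hinj (a₁ := (ω.cross (ω.exit V h)).2) (a₂ := (ω.cross (ω.exit V (opp h))).2) (by
    have e1 : (ω.mate (ω.exit V h).1, (ω.cross (ω.exit V (opp h))).2) =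
      ω.cross (ω.exit V (opp h)) := Prod.ext (by rw [cross_fst, he]) rfl
    rw [nb, nb, e1]; exact e)
  have h4 : ω.cross (ω.exit V h) = ω.cross (ω.exit V (opp h)) :=
    Prod.ext (by rw [cross_fst, cross_fst, he]) h3
  rw [← partner_exit hV ho] at h4
  exact partner_ne _ (ω.cross_injective h4).symm

-- The new end lies at a face `C` linked to the mate. The only link of `C` that changes now leads to
-- the other end of the path, and `C` is too far from the core to be linked to that end already.
include hV ho hE in
theorem step_not_defective (hne : (ω.exit V h).1 ≠ (ω.exit V (opp h)).1) :
    ¬ ω.Defective (ω.remove V (ω.exit V h).1)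
      (ω.exit (ω.remove V (ω.exit V h).1) h).1 := by
  set V' := ω.remove V (ω.exit V h).1 with hV'
  set y := ω.cross (ω.exit V h) with hy
  obtain ⟨ho', hex, -⟩ := step_exit hV ho hE
  rw [← hV', ← hy] at hex
  have hYV : y.1 ∈ V := mate_exit_mem hV ho
  have hbV' : (ω.exit V (opp h)).1 ∈ V' := exit_opp_mem_remove hV ho hE hne
  have hb : ω.partner V' (ω.partner V y) = ω.exit V (opp h) := by
    rw [← hex, partner_exit (hV.remove _) ho', exit_of_exit_mem (remove_subset _) hbV']
  have hinj : Function.Injective (ω.nb V y.1) := not_not.1 (not_defective_mate hV ho hE)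
  set C := (ω.partner V y).1 with hC
  have hCnb : C = ω.nb V y.1 y.2 := rfl
  have hCV : C ∈ V := partner_mem hV hYV
  have hCc : C ∉ ω.nbrs V (ω.nbrs V (ω.core V h)) := nb_mate_notMem hV ho hE y.2
  have hCinj : Function.Injective (ω.nb V C) := by
    by_contra hd
    exact hCc (subset_nbrs _ (subset_nbrs _ (Finset.mem_insert_of_mem
      (Finset.mem_insert_of_mem (mem_defects.2 ⟨hCV, hd⟩)))))
  -- Since `C` is not defective it is linked to the mate only once, and it is not linked to the face
  -- of the old end; hence its other two links survive.
  have hother : ∀ a, a ≠ (ω.partner V y).2 → ω.nb V' C a = ω.nb V C a := by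
    intro a ha
    rw [nb, partner_remove_of_mem, nb]
    refine mem_remove.2 ⟨nb_mem hV hCV a, fun e => ?_, fun e => ?_⟩
    · exact hCc (subset_nbrs _ (mem_nbrs_of_partner (w := (C, a)) hV hCV
        (by rw [e]; exact Finset.mem_insert_self _ _)))
    · refine ha (hCinj ?_)
      have e1 : ω.nb V C (ω.partner V y).2 = y.1 := by
        rw [nb, show (C, (ω.partner V y).2) = ω.partner V y from rfl, partner_partner hV hYV]
      rw [e1]; exact e
  have hself : ω.nb V' C (ω.partner V y).2 = (ω.exit V (opp h)).1 := by
    rw [nb, show (C, (ω.partner V y).2) = ω.partner V y from rfl, hb]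
  have hnoB : ∀ a, ω.nb V C a ≠ (ω.exit V (opp h)).1 := by
    intro a e
    refine hCc (subset_nbrs _ (mem_nbrs_of_partner (w := (C, a)) hV hCV ?_))
    change ω.nb V C a ∈ _
    rw [e]
    exact Finset.mem_insert_of_mem (Finset.mem_insert_self _ _)
  rw [hex]
  refine not_not.2 fun a b hab => ?_
  by_cases ha : a = (ω.partner V y).2 <;> by_cases hb' : b = (ω.partner V y).2
  · rw [ha, hb']
  · rw [ha, hself, hother b hb'] at hab
    exact absurd hab.symm (hnoB b)
  · rw [hb', hself, hother a ha] at hab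
    exact absurd hab (hnoB a)
  · rw [hother a ha, hother b hb'] at hab
    exact hCinj hab

include hV ho hE in
theorem step_danger : ω.danger (ω.remove V (ω.exit V h).1) h ≤ ω.danger V h - 1 := by
  obtain ⟨ho', -, -⟩ := step_exit hV ho hE
  by_cases he : (ω.exit V h).1 = (ω.exit V (opp h)).1
  · rw [(danger_eq_two hV ho).2 he]
    have h1 : ω.danger (ω.remove V (ω.exit V h).1) h ≠ 2 := fun h2 =>
      step_ends_ne_of_eq hV ho hE he ((danger_eq_two (hV.remove _) ho').1 h2)
    have := danger_le_two (ω := ω) (V := ω.remove V (ω.exit V h).1) (h := h)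
    omega
  · rw [danger_eq_zero.2 (step_not_defective hV ho hE he)]
    omega

-- Gluing replaces links to the two glued faces by links to neighbours of the opposite one. A face
-- could be linked twice to the same face afterwards only if the two glued faces were already joined
-- by a short chain of links, which distance greater than three excludes.
include hV ho hE in
theorem step_defects (hG : ¬ ω.Defective V (ω.exit V h).1) :
    ω.defects (ω.remove V (ω.exit V h).1) ⊆ ω.defects V := by
  intro F hF
  obtain ⟨hF, hd⟩ := mem_defects.1 hF
  obtain ⟨hFV, hFG, hFY⟩ := mem_remove.1 hF
  refine mem_defects.2 ⟨hFV, fun hinj => hd ?_⟩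
  set G := (ω.exit V h).1 with hGdef
  set Y := ω.mate G with hY
  have hGV : G ∈ V := ho.exit_mem
  have hYV : Y ∈ V := mate_exit_mem hV ho
  have hGc : G ∈ ω.core V h := Finset.mem_insert_self _ _
  have hYnbG : ∀ a, ω.nb V Y a ≠ G := fun a e =>
    nb_mate_notMem_core hV ho hE a (by rw [← hGdef, ← hY, e]; exact hGc)
  have hGnbY : ∀ a, ω.nb V G a ≠ Y := by
    intro a e
    obtain ⟨b, hb⟩ := nb_eq_comm (a := a) hV hGV
    rw [e] at hb
    exact hYnbG b hb
  -- the three kinds of new links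
  have hgen : ∀ a, ω.nb V F a ≠ G → ω.nb V F a ≠ Y →
      ω.nb (ω.remove V G) F a = ω.nb V F a := by
    intro a h1 h2
    rw [nb, partner_remove_of_mem (mem_remove.2 ⟨nb_mem hV hFV a, h1, h2⟩), nb]
  have hnG : ∀ a, ω.nb V F a = G → ∃ c, ω.nb (ω.remove V G) F a = ω.nb V Y c := by
    intro a h1
    have h2 : (ω.partner V (F, a)).1 ∉ ω.remove V G := fun hm => (mem_remove.1 hm).2.1 h1
    have h3 := partner_cross_mem_remove hV ho hE (z := ω.partner V (F, a)) h1
    refine ⟨(ω.cross (ω.partner V (F, a))).2, ?_⟩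
    rw [nb, partner_remove_of_cross h2 h3, nb]
    congr 2
    exact Prod.ext (by rw [cross_fst]; exact congrArg ω.mate h1) rfl
  have hnY : ∀ a, ω.nb V F a = Y → ∃ c, ω.nb (ω.remove V G) F a = ω.nb V G c := by
    intro a h1
    have h2 : (ω.partner V (F, a)).1 ∉ ω.remove V G := fun hm => (mem_remove.1 hm).2.2 h1
    have h4 : (ω.cross (ω.partner V (F, a))).1 = G := by
      rw [cross_fst, show (ω.partner V (F, a)).1 = Y from h1, hY, ω.mate_mate]
    have h5 : ω.cross (ω.partner V (F, a)) = (G, (ω.cross (ω.partner V (F, a))).2) :=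
      Prod.ext h4 rfl
    have h3 : (ω.partner V (ω.cross (ω.partner V (F, a)))).1 ∈ ω.remove V G := by
      rw [h5]
      exact mem_remove.2 ⟨nb_mem hV hGV _, nb_ne_of_not_defective hV hGV hG _, hGnbY _⟩
    refine ⟨(ω.cross (ω.partner V (F, a))).2, ?_⟩
    rw [nb, partner_remove_of_cross h2 h3, nb, ← h5]
  -- a neighbour of `Y` is not linked to a neighbour of `G`
  have hfar : ∀ a b c, ω.nb V F a = Y → ω.nb V F b = ω.nb V G c → False := by
    intro a b c h1 h2
    obtain ⟨d, hd⟩ := nb_eq_comm (a := a) hV hFV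
    rw [h1] at hd
    refine nb_nb_mate_notMem hV ho hE d b ?_
    rw [← hGdef, ← hY, hd, h2]
    obtain ⟨e, he⟩ := nb_eq_comm (a := c) hV hGV
    have hm : ω.nb V (ω.nb V G c) e ∈ ω.core V h := by rw [he]; exact hGc
    exact mem_nbrs_of_partner (w := (_, e)) hV (nb_mem hV hGV c) hm
  have hfar' : ∀ a b c, ω.nb V F a = G → ω.nb V F b = ω.nb V Y c → False := by
    intro a b c h1 h2
    obtain ⟨e, he⟩ := nb_eq_comm (a := b) hV hFV
    rw [h2] at he
    refine nb_nb_mate_notMem hV ho hE c e ?_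
    rw [← hGdef, ← hY, he]
    refine mem_nbrs_of_partner (w := (F, a)) hV hFV ?_
    change ω.nb V F a ∈ _
    rw [h1]; exact hGc
  have hfar2 : ∀ a b, ω.nb V F a = G → ω.nb V F b = Y → False := by
    intro a b h1 h2
    obtain ⟨d, hd⟩ := nb_eq_comm (a := b) hV hFV
    rw [h2] at hd
    refine nb_nb_mate_notMem hV ho hE d a ?_
    rw [← hGdef, ← hY, hd, h1]
    exact subset_nbrs _ hGc
  intro a b hab
  by_cases ha1 : ω.nb V F a = G
  · obtain ⟨c, hc⟩ := hnG a ha1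
    by_cases hb1 : ω.nb V F b = G
    · exact hinj (ha1.trans hb1.symm)
    · by_cases hb2 : ω.nb V F b = Y
      · exact (hfar2 a b ha1 hb2).elim
      · rw [hc, hgen b hb1 hb2] at hab
        exact (hfar' a b c ha1 hab.symm).elim
  · by_cases ha2 : ω.nb V F a = Y
    · obtain ⟨c, hc⟩ := hnY a ha2
      by_cases hb1 : ω.nb V F b = G
      · exact (hfar2 b a hb1 ha2).elim
      · by_cases hb2 : ω.nb V F b = Y
        · exact hinj (ha2.trans hb2.symm)
        · rw [hc, hgen b hb1 hb2] at hab
          exact (hfar a b c ha2 hab.symm).elim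
    · rw [hgen a ha1 ha2] at hab
      by_cases hb1 : ω.nb V F b = G
      · obtain ⟨c, hc⟩ := hnG b hb1
        exact (hfar' b a c hb1 (by rw [hab, hc])).elim
      · by_cases hb2 : ω.nb V F b = Y
        · obtain ⟨c, hc⟩ := hnY b hb2
          exact (hfar b a c hb2 (by rw [hab, hc])).elim
        · rw [hgen b hb1 hb2] at hab
          exact hinj hab

-- At most six defects arise, and they arise only if the end of the path was defective; in that case
-- the danger drops by at least one. The factor `6` makes this drop pay for them.
include hV ho hE in
theorem step_weight :
    (ω.defects (ω.remove V (ω.exit V h).1)).card + 6 * ω.danger (ω.remove V (ω.exit V h).1) h ≤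
      (ω.defects V).card + 6 * ω.danger V h := by
  have h1 := step_danger hV ho hE
  by_cases hG : ω.Defective V (ω.exit V h).1
  · have h2 := card_defects_remove_le hV (ω.exit V h).1
    have h3 : ω.danger V h ≠ 0 := fun e => danger_eq_zero.1 e hG
    omega
  · have h2 := Finset.card_le_card (step_defects hV ho hE hG)
    have h3 := danger_eq_zero.2 hG
    omega

end step

/-! ### How a path can close. -/

section closing

variable (hV : ω.MateClosed V) (ho : ω.IsOpen V h)

include hV in
theorem isOpen_remove_of_exit_opp {F : Face n}
    (hm : (ω.exit V (opp h)).1 ∈ ω.remove V F) : ω.IsOpen (ω.remove V F) h :=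
  (isOpen_opp_iff (hV.remove F)).1 (isOpen_of_exit_mem hm)

include hV ho in
/-- From a state without danger, the path through `h` can only close by gluing its two ends to
each other. -/
theorem cross_exit_of_closing (hG : ¬ ω.Defective V (ω.exit V h).1)
    (hc : ¬ ω.IsOpen (ω.remove V (ω.exit V h).1) h) :
    ω.cross (ω.exit V h) = ω.exit V (opp h) := by
  set f := ω.exit V h with hf
  set b := ω.exit V (opp h) with hb
  have hfV : f.1 ∈ V := ho.exit_mem
  have hfb : ω.partner V f = b := partner_exit hV ho
  have hbV : b.1 ∈ V := (ho.opp hV).exit_mem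
  have hbG : b.1 ≠ f.1 := fun e => hG (defective_of_exit_fst_eq hV ho e.symm)
  have hbY : b.1 = ω.mate f.1 := by
    by_contra hne
    exact hc (isOpen_remove_of_exit_opp hV (mem_remove.2 ⟨hbV, hbG, hne⟩))
  by_contra hne
  have hinj : Function.Injective (ω.nb V f.1) := not_not.1 hG
  have hz : (ω.cross b).1 = f.1 := by rw [cross_fst, hbY, ω.mate_mate]
  have hzeq : ω.cross b = (f.1, (ω.cross b).2) := Prod.ext hz rfl
  have hzne : (ω.cross b).2 ≠ f.2 := by
    intro e
    apply hne
    have : ω.cross b = f := Prod.ext hz e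
    rw [← this, cross_cross]
  -- If the other end `b` is at the mate but is not glued to `f`, it is glued to another side of the
  -- face of `f`. That side is not linked to the mate, because `f` already is, so the path continues
  -- to a free face.
  have hp : (ω.partner V (ω.cross b)).1 ∈ ω.remove V f.1 := by
    refine mem_remove.2 ⟨partner_mem hV (by rw [hz]; exact hfV), ?_, ?_⟩
    · rw [hzeq]; exact nb_ne_of_not_defective hV hfV hG _
    · intro e
      refine hzne (hinj ?_)
      rw [nb, ← hzeq, e, nb, show (f.1, f.2) = f from rfl, hfb, hbY]
  refine hc ((isOpen_opp_iff (hV.remove _)).1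
    (exit_of_partner_mem (h := opp h) (remove_subset _) ?_ hp).1)
  intro hm
  exact (mem_remove.1 hm).2.2 hbY

include hV ho in
/-- From a state without danger, at most one path closes. -/
theorem same_edge_of_closing {h' : HalfEdge n} (ho' : ω.IsOpen V h')
    (hG : ¬ ω.Defective V (ω.exit V h).1)
    (hc : ¬ ω.IsOpen (ω.remove V (ω.exit V h).1) h)
    (hc' : ¬ ω.IsOpen (ω.remove V (ω.exit V h).1) h') :
    ω.exit V h' = ω.exit V h ∨ ω.exit V h' = ω.exit V (opp h) := by
  have hcr := cross_exit_of_closing hV ho hG hc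
  set f := ω.exit V h with hf
  set b := ω.exit V (opp h) with hb
  have hfV : f.1 ∈ V := ho.exit_mem
  have hfb : ω.partner V f = b := partner_exit hV ho
  have hbY : b.1 = ω.mate f.1 := by rw [← hcr, cross_fst]
  have hinj : Function.Injective (ω.nb V f.1) := not_not.1 hG
  set f' := ω.exit V h' with hf'
  set b' := ω.exit V (opp h') with hb'
  have hfb' : ω.partner V f' = b' := partner_exit hV ho'
  have hf'V : f'.1 ∈ V := ho'.exit_mem
  by_contra! hcon
  -- the other half-edges of the face of `f` are linked to remaining faces
  have hkey : ∀ z : HalfEdge n, z.1 = f.1 → z ≠ f →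
      (ω.partner V z).1 ∈ ω.remove V f.1 := by
    intro z hz hzf
    have hzeq : z = (f.1, z.2) := Prod.ext hz rfl
    refine mem_remove.2 ⟨partner_mem hV (by rw [hz]; exact hfV), ?_, ?_⟩
    · rw [hzeq]; exact nb_ne_of_not_defective hV hfV hG _
    · intro e
      refine hzf (Prod.ext hz (hinj ?_))
      rw [nb, ← hzeq, e, nb, show (f.1, f.2) = f from rfl, hfb, hbY]
  by_cases h1 : f'.1 = f.1
  · have := hkey f' h1 hcon.1
    rw [hfb'] at this
    exact hc' (isOpen_remove_of_exit_opp hV this)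
  by_cases h2 : f'.1 = ω.mate f.1
  · have h3 : (ω.cross f').1 = f.1 := by rw [cross_fst, h2, ω.mate_mate]
    have h4 : ω.cross f' ≠ f := by
      intro e
      apply hcon.2
      rw [← hcr, ← e, cross_cross]
    exact hc' (exit_of_partner_mem (remove_subset _)
      (fun hm => (mem_remove.1 hm).2.2 h2) (hkey _ h3 h4)).1
  · exact hc' (isOpen_of_exit_mem (mem_remove.2 ⟨hf'V, h1, h2⟩))

-- Every gluing that keeps the path open adds at least one tetrahedron, which is why an induction on
-- the missing length terminates.
omit ho in
include hV in
theorem pathLength_lt_remove (ho' : ω.IsOpen (ω.remove V (ω.exit V h).1) h) :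
    ω.pathLength V h < ω.pathLength (ω.remove V (ω.exit V h).1) h := by
  have h1 := idx_nested (remove_subset _) exit_fst_notMem_remove ho'
  have h2 := idx_mono (remove_subset _) (ho'.opp (hV.remove _))
  unfold pathLength
  omega

end closing

end Gluing
end TetGluing

/-! ### Conditioning on the revealed gluings. -/

namespace TetGluing
namespace Gluing

variable {n : ℕ}

open Classical in
/-- The gluings that agree with `ω` outside the faces in `V`. -/
noncomputable def cylinder (ω : Gluing n) (V : Finset (Face n)) : Finset (Gluing n) :=
  Finset.univ.filter fun ω' => ∀ z : HalfEdge n, z.1 ∉ V → ω'.cross z = ω.cross z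

section cylinder

variable {ω ω' : Gluing n} {V : Finset (Face n)} {h : HalfEdge n}

theorem mem_cylinder : ω' ∈ cylinder ω V ↔
    ∀ z : HalfEdge n, z.1 ∉ V → ω'.cross z = ω.cross z := by
  classical
  simp [cylinder]

theorem self_mem_cylinder (ω : Gluing n) (V : Finset (Face n)) : ω ∈ cylinder ω V :=
  mem_cylinder.2 fun _ _ => rfl

theorem card_cylinder_pos (ω : Gluing n) (V : Finset (Face n)) :
    (0 : ℝ) < ((cylinder ω V).card : ℝ) :=
  Nat.cast_pos.2 (Finset.card_pos.2 ⟨ω, self_mem_cylinder ω V⟩)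

theorem cylinder_univ (ω : Gluing n) : cylinder ω Finset.univ = Finset.univ := by
  ext ω'
  simp [mem_cylinder]

theorem cylinder_symm (hω : ω' ∈ cylinder ω V) : ω ∈ cylinder ω' V :=
  mem_cylinder.2 fun z hz => (mem_cylinder.1 hω z hz).symm

/-- A path up to its first free face uses only revealed gluings. Hence exits, links, defects and
danger are constant on a cylinder. -/
theorem iterate_turn_of_mem_cylinder (hω : ω' ∈ cylinder ω V) {i : ℕ}
    (hi : ∀ j < i, (ω.turn^[j] h).1 ∉ V) : ω'.turn^[i] h = ω.turn^[i] h := by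
  induction i with
  | zero => rfl
  | succ i ih =>
    rw [Function.iterate_succ_apply', Function.iterate_succ_apply', turn, turn,
      ih fun j hj => hi j (hj.trans (Nat.lt_succ_self i)),
      mem_cylinder.1 hω _ (hi i (Nat.lt_succ_self i))]

theorem isOpen_of_mem_cylinder (hω : ω' ∈ cylinder ω V) (ho : ω.IsOpen V h) :
    ω'.IsOpen V h :=
  ⟨ω.idx V h, by
    rw [iterate_turn_of_mem_cylinder hω fun _ hj => notMem_of_lt_idx hj]
    exact ho.exit_mem⟩

theorem isOpen_cylinder_iff (hω : ω' ∈ cylinder ω V) : ω'.IsOpen V h ↔ ω.IsOpen V h :=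
  ⟨isOpen_of_mem_cylinder (cylinder_symm hω), isOpen_of_mem_cylinder hω⟩

theorem idx_cylinder (hω : ω' ∈ cylinder ω V) : ω'.idx V = ω.idx V := by
  funext h
  by_cases ho : ω.IsOpen V h
  · refine idx_eq ?_ fun j hj => ?_
    · rw [iterate_turn_of_mem_cylinder hω fun _ hj => notMem_of_lt_idx hj]
      exact ho.exit_mem
    · rw [iterate_turn_of_mem_cylinder hω fun l hl => notMem_of_lt_idx (hl.trans hj)]
      exact notMem_of_lt_idx hj
  · have ho' : ¬ ω'.IsOpen V h := fun h' => ho ((isOpen_cylinder_iff hω).1 h')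
    have h1 : {i | (ω.turn^[i] h).1 ∈ V} = ∅ :=
      Set.eq_empty_of_forall_notMem fun i hi => ho ⟨i, hi⟩
    have h2 : {i | (ω'.turn^[i] h).1 ∈ V} = ∅ :=
      Set.eq_empty_of_forall_notMem fun i hi => ho' ⟨i, hi⟩
    rw [idx, idx, h1, h2]

theorem exit_cylinder (hω : ω' ∈ cylinder ω V) : ω'.exit V = ω.exit V := by
  funext h
  rw [exit, exit, idx_cylinder hω]
  exact iterate_turn_of_mem_cylinder hω fun _ hj => notMem_of_lt_idx hj

theorem pathLength_cylinder (hω : ω' ∈ cylinder ω V) : ω'.pathLength V h = ω.pathLength V h := by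
  rw [pathLength, pathLength, idx_cylinder hω]

theorem nb_cylinder (hω : ω' ∈ cylinder ω V) : ω'.nb V = ω.nb V := by
  funext F a
  rw [nb, nb, partner, partner, exit_cylinder hω]

theorem defects_cylinder (hω : ω' ∈ cylinder ω V) : ω'.defects V = ω.defects V := by
  unfold defects Defective
  rw [nb_cylinder hω]

theorem danger_cylinder (hω : ω' ∈ cylinder ω V) : ω'.danger V h = ω.danger V h := by
  unfold danger Defective
  rw [nb_cylinder hω, exit_cylinder hω]

theorem exceptional_cylinder (hω : ω' ∈ cylinder ω V) :
    ω'.exceptional V h = ω.exceptional V h := by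
  unfold exceptional nbrs core partner
  rw [defects_cylinder hω, exit_cylinder hω]

/-- A free face matched with a revealed one would contradict the revealed gluing of the latter. -/
theorem MateClosed.of_mem_cylinder (hV : ω.MateClosed V) (hω : ω' ∈ cylinder ω V) :
    ω'.MateClosed V := by
  intro F hF
  by_contra hm
  have h1 := congrArg Prod.fst (mem_cylinder.1 hω (ω'.mate F, 0) hm)
  simp only [cross_fst, ω'.mate_mate] at h1
  have h2 : ω.mate F = ω'.mate F := by
    conv_lhs => rw [h1, ω.mate_mate]
  exact hm (h2 ▸ hV F hF)

end cylinder

section conj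

variable (π : Equiv.Perm (Face n)) (s : Face n → Fin 3)

/-- The action of a permutation and rotations of the faces on half-edges. -/
def moveHalfEdge (z : HalfEdge n) : HalfEdge n := (π z.1, z.2 + s z.1)

/-- The gluing obtained by permuting and rotating the faces. -/
def conj (ω : Gluing n) : Gluing n where
  mate F := π (ω.mate (π.symm F))
  mate_mate F := by simp [ω.mate_mate]
  mate_ne F e := ω.mate_ne (π.symm F) (by rw [Equiv.eq_symm_apply]; exact e)
  glue F a := ω.glue (π.symm F) (a - s (π.symm F)) + s (ω.mate (π.symm F))
  glue_reverse F a := by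
    rw [show a + 1 - s (π.symm F) = (a - s (π.symm F)) + 1 by abel, ω.glue_reverse]
    abel
  glue_glue F a := by simp [ω.mate_mate, ω.glue_glue]

theorem moveHalfEdge_injective : Function.Injective (moveHalfEdge π s) := by
  rintro ⟨F, a⟩ ⟨F', a'⟩ h
  simp only [moveHalfEdge, Prod.mk.injEq, EmbeddingLike.apply_eq_iff_eq] at h
  obtain ⟨rfl, h⟩ := h
  rw [add_left_injective _ h]

theorem cross_conj (ω : Gluing n) (z : HalfEdge n) :
    (conj π s ω).cross (moveHalfEdge π s z) = moveHalfEdge π s (ω.cross z) := by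
  simp [conj, cross, moveHalfEdge]

theorem conj_injective : Function.Injective (conj (n := n) π s) := by
  intro ω ω' h
  refine ext_cross fun z => moveHalfEdge_injective π s ?_
  rw [← cross_conj, ← cross_conj, h]

end conj

section fiber

variable (ω : Gluing n) (V : Finset (Face n)) (f : HalfEdge n)

/-- The gluings in a cylinder for which `f` is glued to `y`. -/
noncomputable def fiber (y : HalfEdge n) : Finset (Gluing n) :=
  (cylinder ω V).filter fun ω' => ω'.cross f = y

/-- The half-edges to which `f` can be glued. -/
def targets : Finset (HalfEdge n) := Finset.univ.filter fun y => y.1 ∈ V ∧ y.1 ≠ f.1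

variable {ω V f}

theorem mem_targets {y : HalfEdge n} : y ∈ targets V f ↔ y.1 ∈ V ∧ y.1 ≠ f.1 := by
  simp [targets]

theorem card_filter_fst (E : Finset (Face n)) :
    (Finset.univ.filter fun y : HalfEdge n => y.1 ∈ E).card = E.card * 3 := by
  have : (Finset.univ.filter fun y : HalfEdge n => y.1 ∈ E) =
      E ×ˢ (Finset.univ : Finset (Fin 3)) := by ext; simp
  rw [this]; simp

theorem card_targets (hf : f.1 ∈ V) : (targets V f).card = (V.card - 1) * 3 := by
  have : targets V f = Finset.univ.filter fun y : HalfEdge n => y.1 ∈ V.erase f.1 := by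
    ext; simp [mem_targets, and_comm]
  rw [this, card_filter_fst, Finset.card_erase_of_mem hf]

/-- Swapping the faces of `y` and `y'`, with a rotation carrying `y` to `y'`, injects one fiber into
the other and leaves the revealed gluings alone. By symmetry all fibers have the same size, so the
target of `f` is uniform. -/
theorem card_fiber_le (hV : ω.MateClosed V) {y y' : HalfEdge n}
    (hy : y ∈ targets V f) (hy' : y' ∈ targets V f) :
    (fiber ω V f y).card ≤ (fiber ω V f y').card := by
  rw [mem_targets] at hy hy'
  set π := Equiv.swap y.1 y'.1 with hπ
  set s : Face n → Fin 3 := fun F => if F = y.1 then y'.2 - y.2 else 0 with hs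
  have hfix : ∀ z : HalfEdge n, z.1 ≠ y.1 → z.1 ≠ y'.1 → moveHalfEdge π s z = z := by
    intro z h1 h2
    simp [moveHalfEdge, hπ, hs, Equiv.swap_apply_of_ne_of_ne h1 h2, h1]
  have hyy : moveHalfEdge π s y = y' := by
    simp [moveHalfEdge, hπ, hs]
  refine Finset.card_le_card_of_injOn (conj π s) ?_ (conj_injective π s).injOn
  intro ω' hω'
  obtain ⟨hω', hc⟩ := Finset.mem_filter.1 hω'
  refine Finset.mem_coe.2 (Finset.mem_filter.2 ⟨mem_cylinder.2 fun z hz => ?_, ?_⟩)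
  · have hz1 : ∀ F ∈ V, z.1 ≠ F := fun F hF e => hz (e ▸ hF)
    have h1 := cross_conj π s ω' z
    rw [hfix z (hz1 _ hy.1) (hz1 _ hy'.1), mem_cylinder.1 hω' z hz] at h1
    rw [h1]
    have hz2 : ∀ F ∈ V, (ω.cross z).1 ≠ F := fun F hF e => hz (by
      rw [← hV.mem_iff, ← cross_fst, e]; exact hF)
    exact hfix _ (hz2 _ hy.1) (hz2 _ hy'.1)
  · have h1 := cross_conj π s ω' f
    rw [hfix f hy.2.symm hy'.2.symm, hc, hyy] at h1
    exact h1

theorem cross_mem_targets (hV : ω.MateClosed V) (hf : f.1 ∈ V) {ω' : Gluing n}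
    (hω : ω' ∈ cylinder ω V) : ω'.cross f ∈ targets V f :=
  mem_targets.2 ⟨hV.of_mem_cylinder hω _ hf, ω'.mate_ne _⟩

/-- Knowing where `f` goes is the same as knowing the gluing of its whole face, by `glue_eq`; so one
step of the exploration passes from a cylinder to a cylinder with two fewer free faces. -/
theorem fiber_eq_cylinder {ω' : Gluing n} (hω : ω' ∈ cylinder ω V) :
    fiber ω V f (ω'.cross f) = cylinder ω' (ω'.remove V f.1) := by
  ext ω''
  constructor
  · intro h
    obtain ⟨h1, h2⟩ := Finset.mem_filter.1 h
    have hG : ∀ z : HalfEdge n, z.1 = f.1 → ω''.cross z = ω'.cross z := by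
      intro z hz
      have h3 : ω''.mate f.1 = ω'.mate f.1 := congrArg Prod.fst h2
      have h4 : ω''.glue f.1 f.2 = ω'.glue f.1 f.2 := congrArg Prod.snd h2
      rw [glue_eq ω'', glue_eq ω'] at h4
      refine Prod.ext ?_ ?_
      · rw [cross_fst, cross_fst, hz, h3]
      · change ω''.glue z.1 z.2 = ω'.glue z.1 z.2
        rw [hz, glue_eq ω'', glue_eq ω', sub_left_injective h4]
    refine mem_cylinder.2 fun z hz => ?_
    by_cases hzV : z.1 ∈ V
    · by_cases hzG : z.1 = f.1
      · exact hG z hzG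
      · have hzY : z.1 = ω'.mate f.1 := by
          by_contra hne
          exact hz (mem_remove.2 ⟨hzV, hzG, hne⟩)
        have h3 := hG (ω'.cross z) (by rw [cross_fst, hzY, ω'.mate_mate])
        rw [cross_cross] at h3
        rw [← h3, cross_cross, h3]
    · rw [mem_cylinder.1 h1 z hzV, mem_cylinder.1 hω z hzV]
  · intro h
    have h1 := mem_cylinder.1 h
    refine Finset.mem_filter.2 ⟨mem_cylinder.2 fun z hz => ?_, h1 f ?_⟩
    · rw [h1 z fun hm => hz (remove_subset _ hm), mem_cylinder.1 hω z hz]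
    · simp [mem_remove]

/-- The glued face of `f` is uniformly distributed: an upper bound for the averages over the
cylinders that are obtained by gluing `f` gives one for the average over the cylinder. -/
theorem sum_cylinder_le (hV : ω.MateClosed V) (hf : f.1 ∈ V) (X : Gluing n → ℝ)
    (v : HalfEdge n → ℝ)
    (hstep : ∀ ω' ∈ cylinder ω V, ∑ ω'' ∈ cylinder ω' (ω'.remove V f.1), X ω'' ≤
      v (ω'.cross f) * ((cylinder ω' (ω'.remove V f.1)).card : ℝ)) :
    (∑ ω' ∈ cylinder ω V, X ω') * (3 * ((V.card : ℝ) - 1)) ≤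
      (∑ y ∈ targets V f, v y) * ((cylinder ω V).card : ℝ) := by
  set c := (fiber ω V f (ω.cross f)).card with hc
  have hself := cross_mem_targets hV hf (self_mem_cylinder ω V)
  have hcard : ∀ y ∈ targets V f, (fiber ω V f y).card = c := fun y hy =>
    le_antisymm (card_fiber_le hV hy hself) (card_fiber_le hV hself hy)
  have hcpos : 0 < c := Finset.card_pos.2 ⟨ω, Finset.mem_filter.2 ⟨self_mem_cylinder ω V, rfl⟩⟩
  have hmaps : ∀ ω' ∈ cylinder ω V, ω'.cross f ∈ targets V f := fun ω' hω =>
    cross_mem_targets hV hf hω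
  have hV1 : 1 ≤ V.card := Finset.card_pos.2 ⟨_, hf⟩
  have htot : ((cylinder ω V).card : ℝ) = 3 * ((V.card : ℝ) - 1) * c := by
    have h1 : (cylinder ω V).card = ∑ _y ∈ targets V f, c :=
      (Finset.card_eq_sum_card_fiberwise hmaps).trans (Finset.sum_congr rfl hcard)
    rw [h1, Finset.sum_const, card_targets hf]
    push_cast [Nat.cast_sub hV1, smul_eq_mul]
    ring
  have hsum : ∑ ω' ∈ cylinder ω V, X ω' ≤ (∑ y ∈ targets V f, v y) * c := by
    rw [← Finset.sum_fiberwise_of_maps_to hmaps, Finset.sum_mul]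
    refine Finset.sum_le_sum fun y hy => ?_
    obtain ⟨ω', hω'⟩ := Finset.card_pos.1 ((hcard y hy).symm ▸ hcpos)
    obtain ⟨h1, rfl⟩ := Finset.mem_filter.1 hω'
    have h2 := hstep ω' h1
    rw [← fiber_eq_cylinder h1, hcard _ hy] at h2
    exact h2
  have hpos : (0 : ℝ) ≤ 3 * ((V.card : ℝ) - 1) := by
    have : (1 : ℝ) ≤ V.card := by exact_mod_cast hV1
    linarith
  calc _ ≤ (∑ y ∈ targets V f, v y) * c * (3 * ((V.card : ℝ) - 1)) :=
        mul_le_mul_of_nonneg_right hsum hpos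
    _ = _ := by rw [htot]; ring

theorem le_sum_cylinder (hV : ω.MateClosed V) (hf : f.1 ∈ V) (X : Gluing n → ℝ)
    (v : HalfEdge n → ℝ)
    (hstep : ∀ ω' ∈ cylinder ω V, v (ω'.cross f) * ((cylinder ω' (ω'.remove V f.1)).card : ℝ) ≤
      ∑ ω'' ∈ cylinder ω' (ω'.remove V f.1), X ω'') :
    (∑ y ∈ targets V f, v y) * ((cylinder ω V).card : ℝ) ≤
      (∑ ω' ∈ cylinder ω V, X ω') * (3 * ((V.card : ℝ) - 1)) := by
  have := sum_cylinder_le hV hf (fun ω' => - X ω') (fun y => - v y) (by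
    intro ω' hω'
    have := hstep ω' hω'
    rw [Finset.sum_neg_distrib]
    linarith)
  simp only [Finset.sum_neg_distrib] at this
  linarith

end fiber

end Gluing
end TetGluing

/-! ### The probability that a path closes. -/

namespace TetGluing
namespace Gluing

variable {n : ℕ}

/-- The weight that controls the number of exceptional gluings. -/
noncomputable def weight (ω : Gluing n) (V : Finset (Face n)) (h : HalfEdge n) : ℕ :=
  (ω.defects V).card + 1 + 6 * ω.danger V h

section

variable {ω ω' : Gluing n} {V : Finset (Face n)} {h : HalfEdge n}

theorem weight_cylinder (hω : ω' ∈ cylinder ω V) : ω'.weight V h = ω.weight V h := by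
  rw [weight, weight, defects_cylinder hω, danger_cylinder hω]

/-- In the worst case there are `6` more defects and the danger rises from `0` to `2`: `18 = 6 + 6 *
2`. -/
theorem weight_remove_le (hV : ω.MateClosed V) (F : Face n) :
    ω.weight (ω.remove V F) h ≤ ω.weight V h + 18 := by
  have h1 := card_defects_remove_le hV F
  have h2 := danger_le_two (ω := ω) (V := ω.remove V F) (h := h)
  unfold weight
  omega

/-- Three half-edges for each exceptional face: `3 * 64 * (d + 2) ≤ 384 * (d + 1)`, where `d` is the
number of defects. -/
theorem card_exceptional_targets_le (f : HalfEdge n) :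
    ((targets V f).filter fun y => y.1 ∈ ω.exceptional V h).card ≤
      384 * ω.weight V h := by
  have h1 : ((targets V f).filter fun y => y.1 ∈ ω.exceptional V h).card ≤
      (Finset.univ.filter fun y : HalfEdge n => y.1 ∈ ω.exceptional V h).card :=
    Finset.card_le_card fun y hy =>
      Finset.mem_filter.2 ⟨Finset.mem_univ _, (Finset.mem_filter.1 hy).2⟩
  rw [card_filter_fst] at h1
  have h2 := card_exceptional_le (ω := ω) (V := V) (h := h)
  unfold weight
  omega

theorem card_remove_cast (hV : ω.MateClosed V) {F : Face n} (hF : F ∈ V) :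
    ((ω.remove V F).card : ℝ) = V.card - 2 := by
  have := card_remove hV hF
  rw [← this]; push_cast; ring

theorem sum_cylinder_const_le (X : Gluing n → ℝ) {c : ℝ}
    (hX : ∀ ω' ∈ cylinder ω V, X ω' ≤ c) :
    ∑ ω' ∈ cylinder ω V, X ω' ≤ c * (cylinder ω V).card := by
  calc _ ≤ ∑ _ω' ∈ cylinder ω V, c := Finset.sum_le_sum hX
    _ = _ := by rw [Finset.sum_const, nsmul_eq_mul, mul_comm]

theorem sum_targets_ite_le (f : HalfEdge n) (E : Finset (Face n)) (A B e : ℝ)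
    (hAB : 0 ≤ A) (he : (((targets V f).filter fun y => y.1 ∈ E).card : ℝ) ≤ e) :
    ∑ y ∈ targets V f, (if y.1 ∈ E then B + A else B) ≤
      B * (targets V f).card + A * e := by
  have : ∀ y : HalfEdge n, (if y.1 ∈ E then B + A else B) = B + if y.1 ∈ E then A else 0 := by
    intro y; split_ifs <;> simp
  simp only [this]
  rw [Finset.sum_add_distrib, Finset.sum_const, nsmul_eq_mul, ← Finset.sum_filter,
    Finset.sum_const, nsmul_eq_mul]
  nlinarith [mul_le_mul_of_nonneg_left he hAB]

theorem cast_card_targets {f : HalfEdge n} (hf : f.1 ∈ V) :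
    ((targets V f).card : ℝ) = 3 * ((V.card : ℝ) - 1) := by
  have hV1 : 1 ≤ V.card := Finset.card_pos.2 ⟨_, hf⟩
  rw [card_targets hf]
  push_cast [Nat.cast_sub hV1]
  ring

theorem mem_cylinder_of_mem_remove {ω'' : Gluing n} {f : HalfEdge n} (hω : ω' ∈ cylinder ω V)
    (hω' : ω'' ∈ cylinder ω' (ω'.remove V f.1)) :
    ω'' ∈ cylinder ω V ∧ ω''.cross f = ω'.cross f := by
  rw [← fiber_eq_cylinder hω] at hω'
  exact Finset.mem_filter.1 hω'

/-- Only one of the `3 (|V| - 1)` equally likely targets of the first end is the other end of the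
path. -/
theorem sum_cylinder_le_of_length_eq (hV : ω.MateClosed V) (ho : ω.IsOpen V h) {k : ℕ}
    (hk : k = ω.pathLength V h) {θ M : ℝ} (hθ : 0 ≤ θ) (hM : 0 < M)
    (hMV : M ≤ 3 * ((V.card : ℝ) - 1)) (X : Gluing n → ℝ)
    (heq : ∀ ω V, MateClosed ω V → ω.IsOpen V h → k = ω.pathLength V h →
      X ω ≤ if ω.cross (ω.exit V h) = ω.exit V (opp h) then θ else 0) :
    ∑ ω' ∈ cylinder ω V, X ω' ≤ θ / M * (cylinder ω V).card := by
  have h1 := sum_cylinder_le hV ho.exit_mem X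
    (fun y => if y = ω.exit V (opp h) then θ else 0) (by
      intro ω' hω'
      refine sum_cylinder_const_le X fun ω'' hω'' => ?_
      obtain ⟨h1, h2⟩ := mem_cylinder_of_mem_remove hω' hω''
      have h3 := heq ω'' V (hV.of_mem_cylinder h1) (isOpen_of_mem_cylinder h1 ho)
        (by rw [pathLength_cylinder h1, hk])
      rwa [exit_cylinder h1, h2] at h3)
  have h2 : ∑ y ∈ targets V (ω.exit V h), (if y = ω.exit V (opp h) then θ else 0) ≤ θ := by
    rw [Finset.sum_ite_eq']
    split_ifs <;> simp [hθ]
  have hc := card_cylinder_pos ω V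
  have h3 := h1.trans (mul_le_mul_of_nonneg_right h2 hc.le)
  have hQ : 0 < 3 * ((V.card : ℝ) - 1) := hM.trans_le hMV
  calc _ ≤ θ / (3 * ((V.card : ℝ) - 1)) * (cylinder ω V).card := by
        rw [div_mul_eq_mul_div, le_div_iff₀ hQ]; exact h3
    _ ≤ _ := by gcongr

/-- The bound in `sum_cylinder_le_of_closing` is chosen to reproduce itself after one step: `R`
stands for the weight, `J` for the danger, and the last summand on the left is the contribution of
the exceptional targets. For `J > 0` an immediate closing, with probability at most `384 R / M`, is
paid for by the drop of `J`; for `J = 0` only the quadratic term grows. -/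
theorem closing_identity {M : ℝ} (hM : M ≠ 0) (θ R r : ℝ) (J : ℕ) :
    θ / M + 384 / M * (R * (J - 1 : ℕ) + 384 * 398 * r / M * R ^ 2) +
      (384 / M * (398 * R) + if J = 0 then 0 else 1) * (384 * R) / M =
    θ / M + 384 / M * (R * J + 384 * 398 * (r + 1) / M * R ^ 2) := by
  rcases J with _ | j
  · simp
    field_simp
    ring
  · simp
    field_simp
    ring

/-- A bound for the probability that the path through `h` closes in a specified way. The event `X`
must exclude paths longer than `k`, and paths that close without danger before they have length
`k`; those that close with length `k` and without danger contribute `θ / M`. -/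
theorem sum_cylinder_le_of_closing (h : HalfEdge n) (k : ℕ) (θ M : ℝ) (hθ : 0 ≤ θ) (hM : 0 < M)
    (X : Gluing n → ℝ) (hX1 : ∀ ω, X ω ≤ 1)
    (hlong : ∀ ω V, MateClosed ω V → ω.IsOpen V h → k < ω.pathLength V h → X ω ≤ 0)
    (heq : ∀ ω V, MateClosed ω V → ω.IsOpen V h → k = ω.pathLength V h →
      X ω ≤ if ω.cross (ω.exit V h) = ω.exit V (opp h) then θ else 0)
    (hclose : ∀ ω V, MateClosed ω V → ω.IsOpen V h → ω.pathLength V h < k →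
      ¬ ω.IsOpen (ω.remove V (ω.exit V h).1) h → ω.danger V h = 0 → X ω ≤ 0)
    (r : ℕ) : ∀ (ω : Gluing n) (V : Finset (Face n)), MateClosed ω V → ω.IsOpen V h →
      k ≤ ω.pathLength V h + r → M + 6 * r ≤ 3 * ((V.card : ℝ) - 1) →
      384 * 398 * (r : ℝ) ≤ M →
      ∑ ω' ∈ cylinder ω V, X ω' ≤ (θ / M + 384 / M * ((ω.weight V h : ℝ) * ω.danger V h +
        384 * 398 * r / M * (ω.weight V h : ℝ) ^ 2)) * (cylinder ω V).card := by
  have hbase : ∀ (ω : Gluing n) (V : Finset (Face n)) (r : ℕ), MateClosed ω V → ω.IsOpen V h →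
      M ≤ 3 * ((V.card : ℝ) - 1) → k ≤ ω.pathLength V h →
      ∑ ω' ∈ cylinder ω V, X ω' ≤ (θ / M + 384 / M * ((ω.weight V h : ℝ) * ω.danger V h +
        384 * 398 * r / M * (ω.weight V h : ℝ) ^ 2)) * (cylinder ω V).card := by
    intro ω V r hV ho hMV hk
    have h1 : ∑ ω' ∈ cylinder ω V, X ω' ≤ θ / M * (cylinder ω V).card := by
      rcases hk.eq_or_lt with hk | hk
      · exact sum_cylinder_le_of_length_eq hV ho hk hθ hM hMV X heq
      · refine (sum_cylinder_const_le (c := 0) X fun ω' hω' => ?_).trans (by simp; positivity)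
        exact hlong ω' V (hV.of_mem_cylinder hω') (isOpen_of_mem_cylinder hω' ho)
          (by rwa [pathLength_cylinder hω'])
    refine h1.trans (mul_le_mul_of_nonneg_right ?_ (card_cylinder_pos ω V).le)
    rw [le_add_iff_nonneg_right]
    positivity
  induction r with
  | zero =>
    intro ω V hV ho hk hMV _
    exact hbase ω V 0 hV ho (by simpa using hMV) (by simpa using hk)
  | succ r ih =>
    intro ω V hV ho hk hMV hrM
    push_cast at hMV hrM
    have hr0 : (0 : ℝ) ≤ r := Nat.cast_nonneg r
    have hMV' : M ≤ 3 * ((V.card : ℝ) - 1) := by linarith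
    by_cases hkD : k ≤ ω.pathLength V h
    · exact hbase ω V (r + 1) hV ho hMV' hkD
    rw [not_le] at hkD
    set f := ω.exit V h with hf
    obtain ⟨R, hR⟩ : ∃ R : ℝ, R = ω.weight V h := ⟨_, rfl⟩
    have hR1 : 1 ≤ R := by
      rw [hR]; exact_mod_cast (by unfold weight; omega : 1 ≤ ω.weight V h)
    set J := ω.danger V h with hJ
    obtain ⟨a, ha⟩ : ∃ a : ℝ, a = 384 * 398 * r / M := ⟨_, rfl⟩
    have ha0 : 0 ≤ a := by rw [ha]; positivity
    have ha1 : a ≤ 1 := by rw [ha, div_le_one hM]; linarith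
    -- `B` bounds the conditional mean after a generic step, which lowers the danger and does not
    -- raise the weight.
    set B : ℝ := θ / M + 384 / M * (R * (J - 1 : ℕ) + a * R ^ 2) with hB
    -- `A` is the extra cost of an exceptional target: either the state gets worse, or, if there was
    -- danger, the path may close at once.
    set A : ℝ := 384 / M * (398 * R) + (if J = 0 then 0 else 1) with hA
    have hif : (0 : ℝ) ≤ if J = 0 then 0 else 1 := by split_ifs <;> norm_num
    have hB0 : 0 ≤ B := by positivity
    have hA0 : 0 ≤ A := by positivity
    have hstep := sum_cylinder_le hV ho.exit_mem X
      (fun y => if y.1 ∈ ω.exceptional V h then B + A else B) (by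
        intro ω' hω'
        rw [← hf]
        have hV' := hV.of_mem_cylinder hω'
        have ho' := isOpen_of_mem_cylinder hω' ho
        have hf' : ω'.exit V h = f := by rw [exit_cylinder hω']
        have hfV : f.1 ∈ V := ho.exit_mem
        by_cases hop : ω'.IsOpen (ω'.remove V f.1) h
        · have hlen := pathLength_lt_remove (h := h) hV' (by rw [hf']; exact hop)
          rw [hf', pathLength_cylinder hω'] at hlen
          have h1 := ih ω' (ω'.remove V f.1) (hV'.remove _) hop (by omega)
            (by rw [card_remove_cast hV' hfV]; linarith) (by linarith)
          refine h1.trans (mul_le_mul_of_nonneg_right ?_ (Nat.cast_nonneg _))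
          rw [← ha]
          split_ifs with hE
          · have h2 : (ω'.weight (ω'.remove V f.1) h : ℝ) ≤ R + 18 := by
              rw [hR, ← weight_cylinder hω']
              exact_mod_cast weight_remove_le hV' f.1
            have h3 : (ω'.danger (ω'.remove V f.1) h : ℝ) ≤ 2 := by exact_mod_cast danger_le_two
            have h4 : (ω'.weight (ω'.remove V f.1) h : ℝ) * ω'.danger (ω'.remove V f.1) h +
                a * (ω'.weight (ω'.remove V f.1) h : ℝ) ^ 2 ≤
                (R + 18) * 2 + a * (R + 18) ^ 2 := by gcongr
            -- With `a ≤ 1 ≤ R`, the excess is at most `2 R + 36 R + 36 R + 324 R = 398 R`.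
            have h5 : (R + 18) * 2 + a * (R + 18) ^ 2 ≤ a * R ^ 2 + 398 * R := by
              nlinarith [mul_le_mul_of_nonneg_right ha1 (by positivity : (0:ℝ) ≤ R)]
            have h6 := mul_le_mul_of_nonneg_left (h4.trans h5)
              (by positivity : (0 : ℝ) ≤ 384 / M)
            have h7 : (0 : ℝ) ≤ 384 / M * (R * (J - 1 : ℕ)) := by positivity
            rw [hB, hA]
            linarith
          · have hE' : ω'.mate (ω'.exit V h).1 ∉ ω'.exceptional V h := by
              rw [hf', exceptional_cylinder hω']; exact hE
            have h2 : (ω'.weight (ω'.remove V f.1) h : ℝ) ≤ R := by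
              have := step_weight hV' ho' hE'
              rw [hf'] at this
              rw [hR, ← weight_cylinder hω']
              exact_mod_cast (by unfold weight; omega :
                ω'.weight (ω'.remove V f.1) h ≤ ω'.weight V h)
            have h3 : (ω'.danger (ω'.remove V f.1) h : ℝ) ≤ (J - 1 : ℕ) := by
              have := step_danger hV' ho' hE'
              rw [hf', danger_cylinder hω'] at this
              exact_mod_cast this
            rw [hB]
            gcongr
        · have hE : (ω'.cross f).1 ∈ ω.exceptional V h := by
            by_contra hE
            refine hop ?_
            have := (step_exit (h := h) hV' ho' (by
              rw [hf', exceptional_cylinder hω']; exact hE)).1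
            rwa [hf'] at this
          simp only [hE, if_true]
          refine sum_cylinder_const_le X fun ω'' hω'' => ?_
          obtain ⟨h1, h2⟩ := mem_cylinder_of_mem_remove hω' hω''
          by_cases hJ0 : J = 0
          · have h3 := hclose ω'' V (hV.of_mem_cylinder h1) (isOpen_of_mem_cylinder h1 ho)
              (by rwa [pathLength_cylinder h1]) (by
                have h4 : ω''.remove V f.1 = ω'.remove V f.1 := by
                  unfold remove; rw [← cross_fst, h2, cross_fst]
                rw [exit_cylinder h1, ← hf, h4, isOpen_cylinder_iff hω'']
                exact hop) (by rw [danger_cylinder h1]; exact hJ0)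
            linarith
          · have h3 : 1 ≤ A := by
              rw [hA, if_neg hJ0]
              have : (0 : ℝ) ≤ 384 / M * (398 * R) := by positivity
              linarith
            linarith [hX1 ω''])
    have he : (((targets V f).filter fun y => y.1 ∈ ω.exceptional V h).card : ℝ) ≤ 384 * R := by
      rw [hR]; exact_mod_cast card_exceptional_targets_le f
    have hsum := sum_targets_ite_le f (ω.exceptional V h) A B _ hA0 he
    rw [cast_card_targets ho.exit_mem] at hsum
    have hc := card_cylinder_pos ω V
    have h3 := hstep.trans (mul_le_mul_of_nonneg_right hsum hc.le)
    have hQ : 0 < 3 * ((V.card : ℝ) - 1) := hM.trans_le hMV'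
    rw [← le_div_iff₀ hQ, mul_div_right_comm, add_div, mul_div_cancel_right₀ _ hQ.ne'] at h3
    rw [← hR]
    refine h3.trans (mul_le_mul_of_nonneg_right ?_ hc.le)
    have h4 : A * (384 * R) / (3 * ((V.card : ℝ) - 1)) ≤ A * (384 * R) / M := by gcongr
    refine (add_le_add_right h4 B).trans ?_
    rw [hB, hA, ha, closing_identity hM.ne']
    push_cast
    exact le_rfl

end

end Gluing
end TetGluing

/-! ### Upper bounds for one edge and for two edges. -/

namespace TetGluing
namespace Gluing

variable {n : ℕ}

section initial

variable (ω : Gluing n) (h : HalfEdge n)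

theorem mateClosed_univ : ω.MateClosed Finset.univ := fun _ _ => Finset.mem_univ _

theorem isOpen_univ : ω.IsOpen Finset.univ h := isOpen_of_mem (Finset.mem_univ _)

theorem pathLength_univ : ω.pathLength Finset.univ h = 1 := by
  rw [pathLength, idx_of_mem (Finset.mem_univ _), idx_of_mem (Finset.mem_univ _)]

theorem danger_univ : ω.danger Finset.univ h = 0 := by
  refine danger_eq_zero.2 fun hd => ?_
  have := mem_defects.2 ⟨Finset.mem_univ _, hd⟩
  rw [defects_univ] at this
  exact absurd this (Finset.notMem_empty _)

theorem weight_univ : ω.weight Finset.univ h = 1 := by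
  rw [weight, danger_univ, defects_univ]; rfl

theorem card_univ_face : ((Finset.univ : Finset (Face n)).card : ℝ) = 4 * n := by
  simp; ring

end initial

section probability

theorem expect_eq (X : Gluing n → ℝ) :
    expect X = (∑ ω, X ω) / ((Finset.univ : Finset (Gluing n)).card : ℝ) := rfl

theorem expect_le_of_forall (X : Gluing n → ℝ) {c : ℝ} (hc : 0 ≤ c)
    (H : ∀ ω : Gluing n, ∑ ω' ∈ cylinder ω Finset.univ, X ω' ≤
      c * (cylinder ω Finset.univ).card) : expect X ≤ c := by
  rw [expect_eq]
  refine div_le_of_le_mul₀ (Nat.cast_nonneg _) hc ?_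
  rcases (Finset.univ : Finset (Gluing n)).eq_empty_or_nonempty with he | ⟨ω, -⟩
  · rw [he]; simp
  · have := H ω
    rwa [cylinder_univ] at this

theorem le_expect_of_forall [Nonempty (Gluing n)] (X : Gluing n → ℝ) {c : ℝ}
    (H : ∀ ω : Gluing n, c * (cylinder ω Finset.univ).card ≤
      ∑ ω' ∈ cylinder ω Finset.univ, X ω') : c ≤ expect X := by
  obtain ⟨ω⟩ := ‹Nonempty (Gluing n)›
  have h1 := H ω
  have h2 := card_cylinder_pos ω Finset.univ
  rw [cylinder_univ] at h1 h2
  rw [expect_eq, le_div_iff₀ h2]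
  exact h1

/-- The probability of an event. -/
noncomputable def prob (p : Gluing n → Prop) [DecidablePred p] : ℝ :=
  expect fun ω => if p ω then 1 else 0

variable {M : ℝ}

/-- The exploration starts with weight `1`, danger `0` and length `1`; without initial danger the
error is of second order, `O(k / n²)`. -/
theorem expect_le_of_closing (h : HalfEdge n) (k : ℕ) (θ : ℝ) (hθ : 0 ≤ θ) (hM : 0 < M)
    (hMn : M + 6 * k + 3 ≤ 12 * n) (hkM : 384 * 398 * (k : ℝ) ≤ M)
    (X : Gluing n → ℝ) (hX1 : ∀ ω, X ω ≤ 1)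
    (hlong : ∀ ω V, MateClosed ω V → ω.IsOpen V h → k < ω.pathLength V h → X ω ≤ 0)
    (heq : ∀ ω V, MateClosed ω V → ω.IsOpen V h → k = ω.pathLength V h →
      X ω ≤ if ω.cross (ω.exit V h) = ω.exit V (opp h) then θ else 0)
    (hclose : ∀ ω V, MateClosed ω V → ω.IsOpen V h → ω.pathLength V h < k →
      ¬ ω.IsOpen (ω.remove V (ω.exit V h).1) h → ω.danger V h = 0 → X ω ≤ 0) :
    expect X ≤ θ / M + 384 / M * (384 * 398 * k / M) := by
  refine expect_le_of_forall X (by positivity) fun ω => ?_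
  have := sum_cylinder_le_of_closing h k θ M hθ hM X hX1 hlong heq hclose k ω Finset.univ
    (mateClosed_univ ω) (isOpen_univ ω h) (by omega) (by rw [card_univ_face]; linarith) hkM
  rw [weight_univ, danger_univ] at this
  simpa using this

open Classical in
/-- The probability that an edge has degree `k` is at most `(1 + O(k / n)) / (12 n)`. -/
theorem prob_deg_eq_le (h : HalfEdge n) (k : ℕ) (hM : 0 < M) (hMn : M + 6 * k + 3 ≤ 12 * n)
    (hkM : 384 * 398 * (k : ℝ) ≤ M) :
    prob (fun ω : Gluing n => ω.deg h = k) ≤ 1 / M + 384 / M * (384 * 398 * k / M) := by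
  refine expect_le_of_closing h k 1 zero_le_one hM hMn hkM _ (fun ω => ?_) ?_ ?_ ?_
  · split_ifs <;> norm_num
  · intro ω V hV ho hlt
    rw [if_neg]
    have := (pathLength_le_deg hV ho).1
    omega
  · intro ω V hV ho hk
    by_cases hd : ω.deg h = k
    · rw [if_pos ((pathLength_le_deg hV ho).2.1 (by omega))]
      split_ifs <;> norm_num
    · rw [if_neg hd]
      split_ifs <;> norm_num
  · intro ω V hV ho hlt hc hJ
    rw [if_neg]
    -- A path that closes without danger glues its two ends, so its degree is its length, which is
    -- smaller than `k`.
    have := (pathLength_le_deg hV ho).2.2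
      (cross_exit_of_closing hV ho (danger_eq_zero.1 hJ) hc)
    omega

end probability

section touched

/-- The half-edges `h` and `h'` belong to the same edge of the complex. -/
def SameEdge (ω : Gluing n) (h h' : HalfEdge n) : Prop :=
  ∃ i, ω.turn^[i] h = h' ∨ ω.turn^[i] (opp h) = h'

/-- The face `F` is crossed when turning around the edge of `h`. -/
def Touches (ω : Gluing n) (h : HalfEdge n) (F : Face n) : Prop :=
  ∃ i, (ω.turn^[i] h).1 = F ∨ ω.mate (ω.turn^[i] h).1 = F

variable {ω : Gluing n} {V : Finset (Face n)} {h h' : HalfEdge n}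

/-- Whether an edge is still open depends only on the set of faces it crosses; two edges crossing
the same faces must close at the same step. -/
theorem isOpen_iff_touches (hV : ω.MateClosed V) :
    ω.IsOpen V h ↔ ∃ F ∈ V, ω.Touches h F := by
  constructor
  · rintro ⟨i, hi⟩
    exact ⟨_, hi, i, Or.inl rfl⟩
  · rintro ⟨F, hF, i, rfl | rfl⟩
    · exact ⟨i, hF⟩
    · exact ⟨i, hV.mem_iff.1 hF⟩

theorem exists_iterate_of_iterate_eq {x z : HalfEdge n} {i j : ℕ}
    (he : ω.turn^[i] x = ω.turn^[j] z) : ∃ m, ω.turn^[m] x = z := by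
  obtain ⟨m, hm, hmz⟩ := ω.exists_iterate_turn_eq z j
  refine ⟨m - j + i, ?_⟩
  rw [Function.iterate_add_apply, he, ← Function.iterate_add_apply, Nat.sub_add_cancel hm.le, hmz]

open Classical in
/-- Two distinct edges with the same faces are unlikely. -/
theorem prob_touches_eq_le (h h' : HalfEdge n) (K : ℕ) {M : ℝ} (hM : 0 < M)
    (hMn : M + 6 * (K + 1) + 3 ≤ 12 * n) (hkM : 384 * 398 * ((K : ℝ) + 1) ≤ M) :
    prob (fun ω : Gluing n => ω.deg h ≤ K ∧ ¬ ω.SameEdge h h' ∧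
      ∀ F, ω.Touches h F ↔ ω.Touches h' F) ≤ 384 / M * (384 * 398 * (K + 1) / M) := by
  -- With `θ = 0` and length `K + 1` there is no main term: a closing without danger closes only one
  -- edge, and the event would require `h'` to close with `h`.
  have := expect_le_of_closing (M := M) h (K + 1) 0 le_rfl hM (by push_cast; exact hMn)
    (by push_cast; exact hkM)
    (fun ω : Gluing n => if ω.deg h ≤ K ∧ ¬ ω.SameEdge h h' ∧
      ∀ F, ω.Touches h F ↔ ω.Touches h' F then 1 else 0) (fun ω => ?_) ?_ ?_ ?_
  · simpa [prob] using this
  · split_ifs <;> norm_num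
  · intro ω V hV ho hlt
    have := (pathLength_le_deg hV ho).1
    rw [if_neg (by omega)]
  · intro ω V hV ho hk
    have := (pathLength_le_deg hV ho).1
    rw [if_neg (by omega)]
    split_ifs <;> norm_num
  · intro ω V hV ho hlt hc hJ
    rw [if_neg]
    rintro ⟨-, hs, ht⟩
    have ho' : ω.IsOpen V h' := by
      obtain ⟨F, hF, hT⟩ := (isOpen_iff_touches hV).1 ho
      exact (isOpen_iff_touches hV).2 ⟨F, hF, (ht F).1 hT⟩
    have hc' : ¬ ω.IsOpen (ω.remove V (ω.exit V h).1) h' := fun hop => hc (by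
      obtain ⟨F, hF, hT⟩ := (isOpen_iff_touches (hV.remove _)).1 hop
      exact (isOpen_iff_touches (hV.remove _)).2 ⟨F, hF, (ht F).2 hT⟩)
    rcases same_edge_of_closing hV ho ho' (danger_eq_zero.1 hJ) hc hc' with he | he
    · obtain ⟨m, hm⟩ := exists_iterate_of_iterate_eq he.symm
      exact hs ⟨m, Or.inl hm⟩
    · obtain ⟨m, hm⟩ := exists_iterate_of_iterate_eq he.symm
      exact hs ⟨m, Or.inr hm⟩

theorem card_add_card_compl : (V.card : ℝ) + ((Finset.univ \ V).card : ℝ) = 4 * n := by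
  rw [← card_univ_face, ← Finset.card_sdiff_add_card_eq_card (Finset.subset_univ V)]
  push_cast; ring

theorem card_compl_remove (hV : ω.MateClosed V) {F : Face n} (hF : F ∈ V) :
    (Finset.univ \ ω.remove V F).card = (Finset.univ \ V).card + 2 := by
  have h1 := card_remove hV hF
  have h2 := Finset.card_sdiff_add_card_eq_card (Finset.subset_univ V)
  have h3 := Finset.card_sdiff_add_card_eq_card (Finset.subset_univ (ω.remove V F))
  omega

open Classical in
/-- A rough bound for the probability that an edge has degree at most `L`, given part of the
gluing. -/
theorem sum_cylinder_deg_le (h : HalfEdge n) (L T : ℕ) {M : ℝ} (hM : 0 < M)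
    (hMn : M + 3 * T + 3 ≤ 12 * n) (r : ℕ) :
    ∀ (ω : Gluing n) (V : Finset (Face n)), MateClosed ω V → ω.IsOpen V h →
      L + 1 ≤ ω.pathLength V h + r → (Finset.univ \ V).card + 2 * r ≤ T →
      ∑ ω' ∈ cylinder ω V, (if ω'.deg h ≤ L then (1 : ℝ) else 0) ≤
        r * (192 * (3 * T + 2)) / M * (cylinder ω V).card := by
  induction r with
  | zero =>
    intro ω V hV ho hk _
    refine (sum_cylinder_const_le (c := 0) _ fun ω' hω' => ?_).trans (by simp)
    have h1 := (pathLength_le_deg (hV.of_mem_cylinder hω') (isOpen_of_mem_cylinder hω' ho)).1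
    rw [pathLength_cylinder hω'] at h1
    rw [if_neg (by omega)]
  | succ r ih =>
    intro ω V hV ho hk hT
    set f := ω.exit V h with hf
    have hfV : f.1 ∈ V := ho.exit_mem
    obtain ⟨B, hB⟩ : ∃ B : ℝ, B = r * (192 * (3 * T + 2)) / M := ⟨_, rfl⟩
    have hB0 : 0 ≤ B := by rw [hB]; positivity
    have hstep := sum_cylinder_le hV hfV (fun ω' => if ω'.deg h ≤ L then (1 : ℝ) else 0)
      (fun y => if y.1 ∈ ω.exceptional V h then B + 1 else B) (by
        intro ω' hω'
        have hV' := hV.of_mem_cylinder hω'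
        have ho' := isOpen_of_mem_cylinder hω' ho
        have hf' : ω'.exit V h = f := by rw [exit_cylinder hω']
        by_cases hop : ω'.IsOpen (ω'.remove V f.1) h
        · have hlen := pathLength_lt_remove (h := h) hV' (by rw [hf']; exact hop)
          rw [hf', pathLength_cylinder hω'] at hlen
          have h1 := ih ω' (ω'.remove V f.1) (hV'.remove _) hop (by omega)
            (by rw [card_compl_remove hV' hfV]; omega)
          refine h1.trans (mul_le_mul_of_nonneg_right ?_ (Nat.cast_nonneg _))
          rw [← hB]
          split_ifs <;> linarith
        -- The path closes only at an exceptional target. The number of these is bounded crudely,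
        -- through the number of revealed faces; `r` steps give a union bound.
        · have hE : (ω'.cross f).1 ∈ ω.exceptional V h := by
            by_contra hE
            refine hop ?_
            have := (step_exit (h := h) hV' ho' (by
              rw [hf', exceptional_cylinder hω']; exact hE)).1
            rwa [hf'] at this
          simp only [hE, if_true]
          refine sum_cylinder_const_le _ fun ω'' _ => ?_
          split_ifs <;> linarith)
    have he : (((targets V f).filter fun y => y.1 ∈ ω.exceptional V h).card : ℝ) ≤
        192 * (3 * T + 2) := by
      have h1 : ((targets V f).filter fun y => y.1 ∈ ω.exceptional V h).card ≤
          (Finset.univ.filter fun y : HalfEdge n => y.1 ∈ ω.exceptional V h).card :=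
        Finset.card_le_card fun y hy =>
          Finset.mem_filter.2 ⟨Finset.mem_univ _, (Finset.mem_filter.1 hy).2⟩
      rw [card_filter_fst] at h1
      have h2 := card_exceptional_le (ω := ω) (V := V) (h := h)
      have h3 := card_defects_le (ω := ω) (V := V)
      have h4 : ((targets V f).filter fun y => y.1 ∈ ω.exceptional V h).card ≤
          192 * (3 * T + 2) := by omega
      exact_mod_cast h4
    have hsum := sum_targets_ite_le f (ω.exceptional V h) 1 B _ zero_le_one he
    rw [cast_card_targets hfV] at hsum
    have hc := card_cylinder_pos ω V
    have h3 := hstep.trans (mul_le_mul_of_nonneg_right hsum hc.le)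
    have hTr : ((Finset.univ \ V).card : ℝ) ≤ T := by exact_mod_cast (by omega)
    have hMQ : M ≤ 3 * ((V.card : ℝ) - 1) := by
      have := card_add_card_compl (V := V)
      linarith
    have hQ : 0 < 3 * ((V.card : ℝ) - 1) := hM.trans_le hMQ
    rw [← le_div_iff₀ hQ, mul_div_right_comm, add_div, mul_div_cancel_right₀ _ hQ.ne'] at h3
    refine h3.trans (mul_le_mul_of_nonneg_right ?_ hc.le)
    have h4 : (1 : ℝ) * (192 * (3 * T + 2)) / (3 * ((V.card : ℝ) - 1)) ≤
      1 * (192 * (3 * T + 2)) / M := by gcongr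
    refine (add_le_add_right h4 B).trans (le_of_eq ?_)
    rw [hB]
    push_cast
    ring

open Classical in
/-- If the second edge has a face that is not at the first one, then its degree is almost
independent of the first one. -/
theorem sum_cylinder_two_edges_le (h h' : HalfEdge n) (K L T : ℕ) {M : ℝ} (hM : 0 < M)
    (hMn : M + 3 * T + 3 ≤ 12 * n) (r : ℕ) :
    ∀ (ω : Gluing n) (V : Finset (Face n)), MateClosed ω V →
      (ω.IsOpen V h → K + 1 ≤ ω.pathLength V h + r) →
      (Finset.univ \ V).card + 2 * r + 2 * L ≤ T →
      (∀ ω' ∈ cylinder ω V, ∀ F ∉ V, ω'.Touches h F) →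
      ∑ ω' ∈ cylinder ω V, ((if ω'.deg h ≤ K ∧ ω'.deg h' ≤ L ∧
          ∃ F, ω'.Touches h' F ∧ ¬ ω'.Touches h F then (1 : ℝ) else 0) -
        L * (192 * (3 * T + 2)) / M * if ω'.deg h ≤ K then 1 else 0) ≤ 0 := by
  have hβ : (0 : ℝ) ≤ L * (192 * (3 * T + 2)) / M := by positivity
  -- Once the edge of `h` is closed, all revealed faces are known to touch it. An edge with a face
  -- outside of it is then still open, and the bound for one edge applies conditionally.
  have hclosed : ∀ (ω : Gluing n) (V : Finset (Face n)), MateClosed ω V → ¬ ω.IsOpen V h →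
      (Finset.univ \ V).card + 2 * L ≤ T → (∀ ω' ∈ cylinder ω V, ∀ F ∉ V, ω'.Touches h F) →
      ∑ ω' ∈ cylinder ω V, ((if ω'.deg h ≤ K ∧ ω'.deg h' ≤ L ∧
          ∃ F, ω'.Touches h' F ∧ ¬ ω'.Touches h F then (1 : ℝ) else 0) -
        L * (192 * (3 * T + 2)) / M * if ω'.deg h ≤ K then 1 else 0) ≤ 0 := by
    intro ω V hV hno hT htouch
    have hdeg : ∀ ω' ∈ cylinder ω V, ω'.deg h = ω.deg h := by
      intro ω' hω'
      have hit : ∀ i, ω'.turn^[i] h = ω.turn^[i] h := fun i =>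
        iterate_turn_of_mem_cylinder hω' fun j _ hm => hno ⟨j, hm⟩
      unfold deg
      refine Nat.dvd_antisymm ?_ ?_
      · refine Function.IsPeriodicPt.minimalPeriod_dvd ?_
        rw [Function.IsPeriodicPt, Function.IsFixedPt, hit]
        exact Function.isPeriodicPt_minimalPeriod _ _
      · refine Function.IsPeriodicPt.minimalPeriod_dvd ?_
        rw [Function.IsPeriodicPt, Function.IsFixedPt, ← hit]
        exact Function.isPeriodicPt_minimalPeriod _ _
    by_cases hK : ω.deg h ≤ K
    · by_cases ho' : ω.IsOpen V h'
      · have h1 := sum_cylinder_deg_le h' L T hM hMn L ω V hV ho'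
          (by unfold pathLength; omega) hT
        have h2 : ∑ ω' ∈ cylinder ω V, (if ω'.deg h ≤ K then (1 : ℝ) else 0) =
            (cylinder ω V).card := by
          rw [Finset.sum_congr (g := fun _ => (1 : ℝ)) rfl fun ω' hω' => by
            rw [hdeg ω' hω', if_pos hK]]
          simp
        rw [Finset.sum_sub_distrib, ← Finset.mul_sum, sub_nonpos, h2]
        refine (Finset.sum_le_sum fun ω' _ => ?_).trans h1
        split_ifs with h2 h3 h3
        · exact le_rfl
        · exact absurd h2.2.1 h3
        · exact zero_le_one
        · exact le_rfl
      · refine Finset.sum_nonpos fun ω' hω' => ?_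
        rw [if_neg]
        · rw [zero_sub, neg_nonpos]
          split_ifs <;> simp [hβ]
        · rintro ⟨-, -, F, hF, hF'⟩
          have hFV : F ∈ V := by
            by_contra hm
            exact hF' (htouch ω' hω' F hm)
          exact ho' ((isOpen_cylinder_iff hω').1
            ((isOpen_iff_touches (hV.of_mem_cylinder hω')).2 ⟨F, hFV, hF⟩))
    · refine (Finset.sum_nonpos fun ω' hω' => ?_)
      have := hdeg ω' hω'
      rw [if_neg (by omega), if_neg (by omega)]
      simp
  induction r with
  | zero =>
    intro ω V hV hk hT htouch
    by_cases ho : ω.IsOpen V h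
    · refine Finset.sum_nonpos fun ω' hω' => ?_
      have h1 := (pathLength_le_deg (hV.of_mem_cylinder hω') (isOpen_of_mem_cylinder hω' ho)).1
      rw [pathLength_cylinder hω'] at h1
      have h2 := hk ho
      rw [if_neg (by omega), if_neg (by omega)]
      simp
    · exact hclosed ω V hV ho (by omega) htouch
  | succ r ih =>
    intro ω V hV hk hT htouch
    by_cases ho : ω.IsOpen V h
    · set f := ω.exit V h with hf
      have hfV : f.1 ∈ V := ho.exit_mem
      have hstep := sum_cylinder_le hV hfV (fun ω' => (if ω'.deg h ≤ K ∧ ω'.deg h' ≤ L ∧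
          ∃ F, ω'.Touches h' F ∧ ¬ ω'.Touches h F then (1 : ℝ) else 0) -
        L * (192 * (3 * T + 2)) / M * if ω'.deg h ≤ K then 1 else 0) (fun _ => 0) (by
          intro ω' hω'
          have hV' := hV.of_mem_cylinder hω'
          rw [zero_mul]
          refine ih ω' _ (hV'.remove _) (fun hop => ?_)
            (by rw [card_compl_remove hV' hfV]; omega) ?_
          · have hf' : ω'.exit V h = f := by rw [exit_cylinder hω']
            have hlen := pathLength_lt_remove (h := h) hV' (by rw [hf']; exact hop)
            rw [hf', pathLength_cylinder hω'] at hlen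
            have := hk ho
            omega
          -- Only the face at the end of the path of `h` and its mate have been newly revealed, and
          -- both are crossed by the edge of `h`.
          · intro ω'' hω'' F hF
            obtain ⟨h1, h2⟩ := mem_cylinder_of_mem_remove hω' hω''
            have hf'' : ω''.exit V h = f := by rw [exit_cylinder h1]
            by_cases hFV : F ∈ V
            · by_cases hFf : F = f.1
              · exact ⟨ω''.idx V h, Or.inl (by rw [hFf, ← hf'']; rfl)⟩
              · have hFm : F = ω'.mate f.1 := by
                  by_contra hne
                  exact hF (mem_remove.2 ⟨hFV, hFf, hne⟩)
                refine ⟨ω''.idx V h, Or.inr ?_⟩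
                change ω''.mate (ω''.exit V h).1 = F
                rw [hf'', hFm, ← cross_fst, h2, cross_fst]
            · exact htouch ω'' h1 F hFV)
      rw [Finset.sum_const_zero, zero_mul] at hstep
      have hQ : 0 < 3 * ((V.card : ℝ) - 1) := by
        have h1 := card_add_card_compl (V := V)
        have hTr : ((Finset.univ \ V).card : ℝ) ≤ T := by exact_mod_cast (by omega)
        linarith
      exact nonpos_of_mul_nonpos_left hstep hQ
    · exact hclosed ω V hV ho (by omega) htouch

end touched

end Gluing
end TetGluing

/-! ### Bounds for probabilities of small degrees. -/

namespace TetGluing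
namespace Gluing

variable {n : ℕ}

section bounds

variable {M : ℝ}

theorem expect_add (X Y : Gluing n → ℝ) :
    expect (fun ω => X ω + Y ω) = expect X + expect Y := by
  rw [expect, Finset.sum_add_distrib, add_div]; rfl

theorem expect_sub (X Y : Gluing n → ℝ) :
    expect (fun ω => X ω - Y ω) = expect X - expect Y := by
  rw [expect, Finset.sum_sub_distrib, sub_div]; rfl

theorem expect_const_mul (c : ℝ) (X : Gluing n → ℝ) :
    expect (fun ω => c * X ω) = c * expect X := by
  rw [expect, ← Finset.mul_sum, mul_div_assoc]; rfl

theorem expect_sum {ι : Type*} (s : Finset ι) (X : ι → Gluing n → ℝ) :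
    expect (fun ω => ∑ i ∈ s, X i ω) = ∑ i ∈ s, expect (X i) := by
  rw [expect, Finset.sum_comm, Finset.sum_div]; rfl

theorem expect_mono {X Y : Gluing n → ℝ} (hXY : ∀ ω, X ω ≤ Y ω) : expect X ≤ expect Y :=
  div_le_div_of_nonneg_right (Finset.sum_le_sum fun ω _ => hXY ω) (Nat.cast_nonneg _)

theorem expect_nonneg {X : Gluing n → ℝ} (hX : ∀ ω, 0 ≤ X ω) : 0 ≤ expect X :=
  div_nonneg (Finset.sum_nonneg fun ω _ => hX ω) (Nat.cast_nonneg _)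

-- Summation over the degrees `1, …, K`, each of probability at most `385 / M`: a main term `1 / M`
-- and an error at most `384 / M`.
open Classical in
theorem prob_deg_le_le (h : HalfEdge n) (K : ℕ) (hM : 0 < M) (hMn : M + 6 * K + 3 ≤ 12 * n)
    (hkM : 384 * 398 * (K : ℝ) ≤ M) :
    prob (fun ω : Gluing n => ω.deg h ≤ K) ≤ 385 * K / M := by
  have h1 : prob (fun ω : Gluing n => ω.deg h ≤ K) =
      ∑ k ∈ Finset.Icc 1 K, prob fun ω : Gluing n => ω.deg h = k := by
    unfold prob
    rw [← expect_sum]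
    congr 1
    funext ω
    rw [Finset.sum_ite_eq]
    have := ω.deg_pos h
    simp only [Finset.mem_Icc]
    congr 1
    exact propext ⟨fun h => ⟨this, h⟩, fun h => h.2⟩
  rw [h1]
  have h2 : ∀ k ∈ Finset.Icc 1 K, prob (fun ω : Gluing n => ω.deg h = k) ≤ 385 / M := by
    intro k hk
    have hkK : (k : ℝ) ≤ K := by exact_mod_cast (Finset.mem_Icc.1 hk).2
    refine (prob_deg_eq_le h k hM (by linarith) (by linarith)).trans ?_
    have : 384 * 398 * (k : ℝ) / M ≤ 1 := by rw [div_le_one hM]; linarith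
    calc 1 / M + 384 / M * (384 * 398 * k / M) ≤ 1 / M + 384 / M * 1 := by gcongr
      _ = _ := by ring
  refine (Finset.sum_le_sum h2).trans ?_
  rw [Finset.sum_const, Nat.card_Icc, nsmul_eq_mul]
  simp only [Nat.add_sub_cancel]
  apply le_of_eq
  ring

-- The value `2 (K + L)` for `T` leaves room for `K` steps along the first edge and `L` along the
-- second, each revealing two faces.
open Classical in
theorem prob_two_edges_le (h h' : HalfEdge n) (K L : ℕ) (hM : 0 < M)
    (hMn : M + 6 * (K + L) + 3 ≤ 12 * n) (hkM : 384 * 398 * (K : ℝ) ≤ M) :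
    prob (fun ω : Gluing n => ω.deg h ≤ K ∧ ω.deg h' ≤ L ∧
      ∃ F, ω.Touches h' F ∧ ¬ ω.Touches h F) ≤
      L * (192 * (6 * (K + L) + 2)) / M * (385 * K / M) := by
  have h1 := expect_le_of_forall (n := n)
    (fun ω' => (if ω'.deg h ≤ K ∧ ω'.deg h' ≤ L ∧
          ∃ F, ω'.Touches h' F ∧ ¬ ω'.Touches h F then (1 : ℝ) else 0) -
        L * (192 * (3 * (2 * (K + L) : ℕ) + 2)) / M * if ω'.deg h ≤ K then 1 else 0) le_rfl (by
      intro ω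
      rw [zero_mul]
      refine sum_cylinder_two_edges_le h h' K L (2 * (K + L)) hM ?_ K ω Finset.univ
        (mateClosed_univ ω) ?_ ?_ ?_
      · push_cast; linarith
      · intro _; rw [pathLength_univ]; omega
      · simp; omega
      · intro _ _ F hF; exact absurd (Finset.mem_univ _) hF)
  rw [expect_sub, expect_const_mul, sub_nonpos] at h1
  refine h1.trans ?_
  have h2 := prob_deg_le_le h K hM (by have : (0:ℝ) ≤ L := Nat.cast_nonneg L; linarith) hkM
  refine (mul_le_mul_of_nonneg_left h2 (by positivity)).trans (le_of_eq ?_)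
  push_cast
  ring

theorem sameEdge_symm {ω : Gluing n} {h h' : HalfEdge n} (hs : ω.SameEdge h h') :
    ω.SameEdge h' h := by
  obtain ⟨i, hi | hi⟩ := hs
  · obtain ⟨m, hm⟩ := exists_iterate_of_iterate_eq (ω := ω) (x := h') (z := h) (i := 0) (j := i)
      hi.symm
    exact ⟨m, Or.inl hm⟩
  · have h1 := ω.iterate_turn_opp i 0 (opp h)
    simp only [add_zero, Function.iterate_zero, id, opp_opp] at h1
    rw [hi] at h1
    exact ⟨i, Or.inr h1⟩

theorem prob_le_add_add {p q r s : Gluing n → Prop} [DecidablePred p] [DecidablePred q]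
    [DecidablePred r] [DecidablePred s] (H : ∀ ω, p ω → q ω ∨ r ω ∨ s ω) :
    prob p ≤ prob q + prob r + prob s := by
  unfold prob
  rw [← expect_add, ← expect_add]
  refine expect_mono fun ω => ?_
  have := H ω
  by_cases h1 : p ω <;> by_cases h2 : q ω <;> by_cases h3 : r ω <;> by_cases h4 : s ω <;>
    (simp_all; try norm_num)

open Classical in
/-- The probability that two half-edges belong to distinct edges of small degrees. -/
theorem prob_distinct_edges_le (h h' : HalfEdge n) (N : ℕ) (hN : 1 ≤ N) (hM : 0 < M)
    (hMn : M + 18 * N + 3 ≤ 12 * n) (hkM : 384 * 398 * (2 * (N : ℝ)) ≤ M) :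
    prob (fun ω : Gluing n => ω.deg h ≤ N ∧ ω.deg h' ≤ N ∧ ¬ ω.SameEdge h h') ≤
      10 ^ 10 * N ^ 3 / M ^ 2 := by
  have hN1 : (1 : ℝ) ≤ N := by exact_mod_cast hN
  have h1 := prob_two_edges_le h h' N N hM (by linarith) (by linarith)
  have h2 := prob_two_edges_le h' h N N hM (by linarith) (by linarith)
  have h3 := prob_touches_eq_le (M := M) h h' N hM (by linarith) (by linarith)
  have h4 : prob (fun ω : Gluing n => ω.deg h ≤ N ∧ ω.deg h' ≤ N ∧ ¬ ω.SameEdge h h') ≤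
      prob (fun ω : Gluing n => ω.deg h ≤ N ∧ ω.deg h' ≤ N ∧
        ∃ F, ω.Touches h' F ∧ ¬ ω.Touches h F) +
      prob (fun ω : Gluing n => ω.deg h' ≤ N ∧ ω.deg h ≤ N ∧
        ∃ F, ω.Touches h F ∧ ¬ ω.Touches h' F) +
      prob (fun ω : Gluing n => ω.deg h ≤ N ∧ ¬ ω.SameEdge h h' ∧
        ∀ F, ω.Touches h F ↔ ω.Touches h' F) := by
    -- Either one of the two edges crosses a face that the other does not, or both cross the same
    -- faces.
    refine prob_le_add_add fun ω hA => ?_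
    by_cases hB : ∃ F, ω.Touches h' F ∧ ¬ ω.Touches h F
    · exact Or.inl ⟨hA.1, hA.2.1, hB⟩
    by_cases hC : ∃ F, ω.Touches h F ∧ ¬ ω.Touches h' F
    · exact Or.inr (Or.inl ⟨hA.2.1, hA.1, hC⟩)
    push Not at hB hC
    exact Or.inr (Or.inr ⟨hA.1, hA.2.2, fun F => ⟨hC F, hB F⟩⟩)
  have hN3 : (N : ℝ) ≤ N ^ 3 := by nlinarith [mul_nonneg (by linarith : (0:ℝ) ≤ N) (sq_nonneg ((N : ℝ) - 1))]
  have hN2 : (N : ℝ) ^ 2 ≤ N ^ 3 := pow_le_pow_right₀ hN1 (by norm_num)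
  have h5 : (N : ℝ) * (192 * (6 * (N + N) + 2)) / M * (385 * N / M) ≤
      192 * 14 * 385 * N ^ 3 / M ^ 2 := by
    rw [div_mul_div_comm, ← pow_two]
    refine div_le_div_of_nonneg_right ?_ (by positivity)
    linarith
  have h6 : 384 / M * (384 * 398 * ((N : ℝ) + 1) / M) ≤ 384 * 384 * 398 * 2 * N ^ 3 / M ^ 2 := by
    rw [div_mul_div_comm, ← pow_two]
    refine div_le_div_of_nonneg_right ?_ (by positivity)
    linarith
  have h7 : (192 * 14 * 385 * (N : ℝ) ^ 3 / M ^ 2) + 192 * 14 * 385 * N ^ 3 / M ^ 2 +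
      384 * 384 * 398 * 2 * N ^ 3 / M ^ 2 ≤ 10 ^ 10 * N ^ 3 / M ^ 2 := by
    rw [← add_div, ← add_div]
    refine div_le_div_of_nonneg_right ?_ (by positivity)
    linarith
  linarith

end bounds

/-! ### Lower bounds. -/

section lower

variable {ω : Gluing n} {V : Finset (Face n)} {h : HalfEdge n}

theorem card_pos_of_mem (hV : ω.MateClosed V) {F : Face n} (hF : F ∈ V) :
    0 < 3 * ((V.card : ℝ) - 1) := by
  have h1 := card_remove hV hF
  have h2 : (2 : ℝ) ≤ V.card := by exact_mod_cast (by omega)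
  linarith

theorem card_targets_le : 3 * ((V.card : ℝ) - 1) ≤ 12 * n := by
  have h1 := card_add_card_compl (V := V)
  have h2 : (0 : ℝ) ≤ ((Finset.univ \ V).card : ℝ) := Nat.cast_nonneg _
  linarith

theorem le_sum_cylinder_of_targets (hV : ω.MateClosed V) {f : HalfEdge n} (hf : f.1 ∈ V)
    (X : Gluing n → ℝ) (v : HalfEdge n → ℝ) {w : ℝ}
    (hstep : ∀ ω' ∈ cylinder ω V, v (ω'.cross f) * ((cylinder ω' (ω'.remove V f.1)).card : ℝ) ≤
      ∑ ω'' ∈ cylinder ω' (ω'.remove V f.1), X ω'')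
    (hw : w * (3 * ((V.card : ℝ) - 1)) ≤ ∑ y ∈ targets V f, v y) :
    w * (cylinder ω V).card ≤ ∑ ω' ∈ cylinder ω V, X ω' := by
  have h1 := le_sum_cylinder hV hf X v hstep
  have h2 := mul_le_mul_of_nonneg_right hw (card_cylinder_pos ω V).le
  refine le_of_mul_le_mul_right ?_ (card_pos_of_mem hV hf)
  linarith

theorem le_sum_cylinder_const (X : Gluing n → ℝ) {c : ℝ}
    (hX : ∀ ω' ∈ cylinder ω V, c ≤ X ω') :
    c * (cylinder ω V).card ≤ ∑ ω' ∈ cylinder ω V, X ω' := by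
  calc c * (cylinder ω V).card = ∑ _ω' ∈ cylinder ω V, c := by
        rw [Finset.sum_const, nsmul_eq_mul, mul_comm]
    _ ≤ _ := Finset.sum_le_sum hX

/-- The tetrahedra that are met when turning around the edge of `h` are distinct. -/
def IsSimple (ω : Gluing n) (h : HalfEdge n) : Prop :=
  Set.InjOn (fun j => (ω.turn^[j] h).1.1) (Set.Iio (ω.deg h))

theorem opp_fst_ne_exit
    (hinj : Set.InjOn (fun j => (ω.turn^[j] h).1.1) (Set.Iio (ω.idx V h + 1))) :
    (opp h).1 ≠ (ω.exit V h).1 := by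
  intro e
  have h1 : ω.idx V h = 0 := hinj (Set.mem_Iio.2 (Nat.lt_succ_self _))
    (Set.mem_Iio.2 (Nat.succ_pos _)) (congrArg Prod.fst e).symm
  rw [exit, h1] at e
  exact opp_fst_ne h e

theorem card_filter_tet (A : Finset (Fin n)) :
    ((Finset.univ.filter fun y : HalfEdge n => y.1.1 ∉ A).card : ℝ) = 12 * ((n : ℝ) - A.card) := by
  have h1 : (Finset.univ.filter fun y : HalfEdge n => y.1.1 ∉ A) =
      ((Finset.univ \ A) ×ˢ (Finset.univ : Finset (Fin 4))) ×ˢ (Finset.univ : Finset (Fin 3)) := by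
    ext; simp
  have h2 := Finset.card_sdiff_add_card_eq_card (Finset.subset_univ A)
  rw [h1, Finset.card_product, Finset.card_product]
  simp only [Finset.card_univ, Fintype.card_fin] at h2 ⊢
  have h3 : ((Finset.univ \ A).card : ℝ) = n - A.card := by
    rw [eq_sub_iff_add_eq]; exact_mod_cast h2
  push_cast
  rw [h3]
  ring

theorem iterate_turn_cylinder {ω' : Gluing n} (hω : ω' ∈ cylinder ω V) {j : ℕ}
    (hj : j < ω.idx V h + 1) : ω'.turn^[j] h = ω.turn^[j] h :=
  iterate_turn_of_mem_cylinder hω fun _ hl => notMem_of_lt_idx (by omega)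

open Classical in
/-- If the path through `h` has only met distinct tetrahedra, then with high probability the same
holds until it closes with length `k`. -/
theorem le_sum_cylinder_simple (h : HalfEdge n) (k : ℕ) (hkn : k ≤ n) (r : ℕ) :
    ∀ (ω : Gluing n) (V : Finset (Face n)), MateClosed ω V → ω.IsOpen V h → (opp h).1 ∈ V →
      k = ω.idx V h + 1 + r →
      Set.InjOn (fun j => (ω.turn^[j] h).1.1) (Set.Iio (ω.idx V h + 1)) →
      (∀ F ∉ V, ∃ j < ω.idx V h + 1, F.1 = (ω.turn^[j] h).1.1) →
      (1 - (k : ℝ) / n) ^ r / (12 * n) * (cylinder ω V).card ≤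
        ∑ ω' ∈ cylinder ω V, if ω'.IsSimple h ∧ ω'.deg h = k then (1 : ℝ) else 0 := by
  have hn : (0 : ℝ) < n := Nat.cast_pos.2 (Fin.pos h.1.1)
  have hkn' : (k : ℝ) ≤ n := by exact_mod_cast hkn
  have hq : 0 ≤ 1 - (k : ℝ) / n := by rw [sub_nonneg, div_le_one hn]; exact hkn'
  have hnn : ∀ ω' : Gluing n, (0 : ℝ) ≤ if ω'.IsSimple h ∧ ω'.deg h = k then (1 : ℝ) else 0 :=
    fun ω' => by split_ifs <;> norm_num
  induction r with
  | zero =>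
    intro ω V hV ho hopp hk hinj htet
    -- The backward end has never been moved and is still `opp h`; gluing the forward end to it
    -- closes the edge, with probability at least `1 / (12 n)`.
    refine le_sum_cylinder_of_targets hV ho.exit_mem _
      (fun y => if y = opp h then 1 else 0) ?_ ?_
    · intro ω' hω'
      refine le_sum_cylinder_const _ fun ω'' hω'' => ?_
      obtain ⟨h1, h2⟩ := mem_cylinder_of_mem_remove hω' hω''
      rw [← h2]
      by_cases hy : ω''.cross (ω.exit V h) = opp h
      · have hd : ω''.deg h = k := by
          rw [← (pathLength_le_deg (hV.of_mem_cylinder h1) (isOpen_of_mem_cylinder h1 ho)).2.2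
            (by rw [exit_cylinder h1, hy, exit_of_mem hopp]), pathLength_cylinder h1, pathLength,
            idx_of_mem hopp]
          omega
        have hs : ω''.IsSimple h := by
          unfold IsSimple
          rw [hd, hk, add_zero]
          intro a ha b hb hab
          simp only [iterate_turn_cylinder h1 ha, iterate_turn_cylinder h1 hb] at hab
          exact hinj ha hb hab
        rw [if_pos hy, if_pos ⟨hs, hd⟩]
      · rw [if_neg hy]
        exact hnn ω''
    · rw [Finset.sum_ite_eq', if_pos (mem_targets.2 ⟨hopp, opp_fst_ne_exit hinj⟩), pow_zero,
        div_mul_eq_mul_div, one_mul]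
      exact div_le_one_of_le₀ card_targets_le (by positivity)
  | succ r ih =>
    intro ω V hV ho hopp hk hinj htet
    set f := ω.exit V h with hf
    have hfV : f.1 ∈ V := ho.exit_mem
    have hftet : f.1.1 = (ω.turn^[ω.idx V h] h).1.1 := rfl
    set A := (Finset.range (ω.idx V h + 1)).image fun j => (ω.turn^[j] h).1.1 with hA
    have hmemA : ∀ {j}, j < ω.idx V h + 1 → (ω.turn^[j] h).1.1 ∈ A := fun hj =>
      Finset.mem_image.2 ⟨_, Finset.mem_range.2 hj, rfl⟩
    have halive : ∀ F : Face n, F.1 ∉ A → F ∈ V := by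
      intro F hF
      by_contra hm
      obtain ⟨j, hj, he⟩ := htet F hm
      exact hF (he ▸ hmemA hj)
    -- Only targets in tetrahedra not yet met are kept. All their faces are free, so the path
    -- advances by exactly one; they make up a proportion at least `1 - k / n` of the targets.
    refine le_sum_cylinder_of_targets hV hfV _
      (fun y => if y.1.1 ∉ A then (1 - (k : ℝ) / n) ^ r / (12 * n) else 0) ?_ ?_
    · intro ω' hω'
      have hV' := hV.of_mem_cylinder hω'
      have hf' : ω'.exit V h = f := by rw [exit_cylinder hω']
      have hidx : ω'.idx V h = ω.idx V h := by rw [idx_cylinder hω']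
      obtain ⟨y, hy⟩ : ∃ y, ω'.cross f = y := ⟨_, rfl⟩
      have hym : ω'.mate f.1 = y.1 := by rw [← hy, cross_fst]
      rw [hy]
      by_cases hyA : y.1.1 ∈ A
      · rw [if_neg (not_not.2 hyA), zero_mul]
        exact Finset.sum_nonneg fun ω'' _ => hnn ω''
      rw [if_pos hyA]
      have hoy : (opp y).1 ∈ V := halive _ hyA
      have hoy' : (opp y).1 ∈ ω'.remove V f.1 := by
        refine mem_remove.2 ⟨hoy, fun e => hyA ?_, ?_⟩
        · rw [← opp_fst_fst, e]; exact hmemA (Nat.lt_succ_self _)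
        · rw [hym]; exact opp_fst_ne y
      obtain ⟨hop, -, hidx'⟩ := exit_of_partner_mem (ω := ω') (V := V) (h := h)
        (remove_subset f.1) (by rw [hf']; simp [mem_remove])
        (by rw [hf', hy, partner, exit_of_mem hoy]; exact hoy')
      rw [hf', hy, idx_of_mem hoy, add_zero, hidx] at hidx'
      have hlast : ω'.turn^[ω.idx V h + 1] h = opp y := by
        rw [← hidx, iterate_idx_succ, hf', hy]
      have hit : ∀ j < ω.idx V h + 1, ω'.turn^[j] h = ω.turn^[j] h := fun j hj =>
        iterate_turn_cylinder hω' hj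
      have hyj : ∀ j < ω.idx V h + 1, (ω.turn^[j] h).1.1 ≠ y.1.1 := fun j hj e =>
        hyA (e ▸ hmemA hj)
      refine ih ω' _ (hV'.remove _) hop ?_ (by omega) ?_ ?_
      · refine mem_remove.2 ⟨hopp, opp_fst_ne_exit hinj, fun e => hyA ?_⟩
        rw [← hym, ← e, opp_fst_fst]
        exact hmemA (j := 0) (Nat.succ_pos _)
      · rw [hidx']
        intro a ha b hb hab
        rw [Set.mem_Iio] at ha hb
        rcases Nat.lt_succ_iff_lt_or_eq.1 ha with ha | rfl <;>
          rcases Nat.lt_succ_iff_lt_or_eq.1 hb with hb | rfl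
        · simp only [hit a ha, hit b hb] at hab
          exact hinj ha hb hab
        · simp only [hit a ha, hlast] at hab
          exact absurd hab (hyj a ha)
        · simp only [hit b hb, hlast] at hab
          exact absurd hab.symm (hyj b hb)
        · rfl
      · rw [hidx']
        intro F hF
        by_cases hFV : F ∈ V
        · by_cases hFf : F = f.1
          · exact ⟨ω.idx V h, by omega, by rw [hit _ (Nat.lt_succ_self _), hFf, hftet]⟩
          · refine ⟨ω.idx V h + 1, by omega, ?_⟩
            rw [hlast, opp_fst_fst, ← hym]
            by_contra hne
            exact hF (mem_remove.2 ⟨hFV, hFf, fun e => hne (by rw [e])⟩)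
        · obtain ⟨j, hj, he⟩ := htet F hFV
          exact ⟨j, by omega, by rw [hit j hj, he]⟩
    · have h1 : (targets V f).filter (fun y => y.1.1 ∉ A) =
          Finset.univ.filter fun y : HalfEdge n => y.1.1 ∉ A := by
        ext y
        simp only [Finset.mem_filter, mem_targets, Finset.mem_univ, true_and, and_iff_right_iff_imp]
        intro hy
        refine ⟨halive _ hy, fun e => hy ?_⟩
        rw [e]; exact hmemA (Nat.lt_succ_self _)
      rw [← Finset.sum_filter, h1, Finset.sum_const, nsmul_eq_mul, card_filter_tet]
      have hAk : (A.card : ℝ) ≤ k := by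
        have : A.card ≤ ω.idx V h + 1 := Finset.card_image_le.trans (by simp)
        exact_mod_cast (by omega : A.card ≤ k)
      have hQ := card_targets_le (V := V)
      have h2 : (1 - (k : ℝ) / n) * (3 * ((V.card : ℝ) - 1)) ≤ 12 * ((n : ℝ) - A.card) := by
        calc (1 - (k : ℝ) / n) * (3 * ((V.card : ℝ) - 1)) ≤ (1 - (k : ℝ) / n) * (12 * n) := by
              gcongr
          _ = 12 * (n - k) := by field_simp
          _ ≤ _ := by linarith
      have h3 : 0 ≤ (1 - (k : ℝ) / n) ^ r / (12 * n) := by positivity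
      calc _ = (1 - (k : ℝ) / n) * (3 * ((V.card : ℝ) - 1)) *
            ((1 - (k : ℝ) / n) ^ r / (12 * n)) := by rw [pow_succ]; ring
        _ ≤ _ := mul_le_mul_of_nonneg_right h2 h3

open Classical in
/-- The probability that an edge is simple of degree `k` is at least `(1 - k² / n) / (12 n)`. -/
theorem le_prob_simple [Nonempty (Gluing n)] (h : HalfEdge n) (k : ℕ) (hk : 1 ≤ k) (hkn : k ≤ n) :
    (1 - (k : ℝ) ^ 2 / n) / (12 * n) ≤ prob fun ω : Gluing n => ω.IsSimple h ∧ ω.deg h = k := by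
  have hn : (0 : ℝ) < n := Nat.cast_pos.2 (Fin.pos h.1.1)
  have hkn' : (k : ℝ) ≤ n := by exact_mod_cast hkn
  refine le_expect_of_forall _ fun ω => ?_
  have hidx : ω.idx Finset.univ h = 0 := idx_of_mem (Finset.mem_univ _)
  refine le_trans ?_ (le_sum_cylinder_simple h k hkn (k - 1) ω Finset.univ (mateClosed_univ ω)
    (isOpen_univ ω h) (Finset.mem_univ _) (by omega) ?_ ?_)
  · refine mul_le_mul_of_nonneg_right ?_ (Nat.cast_nonneg _)
    refine div_le_div_of_nonneg_right ?_ (by positivity)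
    have h1 : (k : ℝ) / n ≤ 1 := (div_le_one hn).2 hkn'
    -- Bernoulli's inequality for the `k - 1` steps that precede the closing.
    have h2 := one_add_mul_le_pow (a := -((k : ℝ) / n)) (by linarith) (k - 1)
    rw [← sub_eq_add_neg] at h2
    refine le_trans ?_ h2
    rw [Nat.cast_sub hk]
    have h3 : (k : ℝ) ^ 2 / n = k * (k / n) := by ring
    have h4 : 0 ≤ (k : ℝ) / n := by positivity
    push_cast
    rw [h3]
    linarith
  · rw [hidx]
    intro a ha b hb _
    rw [Set.mem_Iio] at ha hb
    omega
  · exact fun F hF => absurd (Finset.mem_univ _) hF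

open Classical in
/-- A lower bound for the probability of degree at most `k`, from a state without defects. -/
theorem le_sum_cylinder_deg_le (h : HalfEdge n) (k : ℕ) {M : ℝ} (hM : 0 < M)
    (hMn : M + 6 * k + 3 ≤ 12 * n) (hkM : 390 * (k : ℝ) ≤ M) (r : ℕ) :
    ∀ (ω : Gluing n) (V : Finset (Face n)), MateClosed ω V → ω.IsOpen V h →
      ω.defects V = ∅ → (Finset.univ \ V).card + 2 ≤ 2 * ω.pathLength V h →
      k + 1 ≤ ω.pathLength V h + r →
      (1 - 390 * k / M) / (12 * n) * (k + 1 - ω.pathLength V h) * (cylinder ω V).card ≤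
        ∑ ω' ∈ cylinder ω V, if ω'.deg h ≤ k then (1 : ℝ) else 0 := by
  have hn : (0 : ℝ) < n := Nat.cast_pos.2 (Fin.pos h.1.1)
  obtain ⟨δ, hδdef⟩ : ∃ δ : ℝ, δ = 390 * k / M := ⟨_, rfl⟩
  have hδ : 0 ≤ 1 - δ := by
    rw [hδdef, sub_nonneg, div_le_one hM]; exact hkM
  have hnn : ∀ ω' : Gluing n, (0 : ℝ) ≤ if ω'.deg h ≤ k then (1 : ℝ) else 0 :=
    fun ω' => by split_ifs <;> norm_num
  rw [← hδdef]
  -- Each remaining unit of length should contribute at least `c` to the probability of closing in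
  -- time.
  obtain ⟨c, hc⟩ : ∃ c : ℝ, c = (1 - δ) / (12 * n) := ⟨_, rfl⟩
  have hc0 : 0 ≤ c := by rw [hc]; positivity
  rw [← hc]
  have htriv : ∀ (ω : Gluing n) (V : Finset (Face n)), k + 1 ≤ ω.pathLength V h →
      c * (k + 1 - ω.pathLength V h) * (cylinder ω V).card ≤
        ∑ ω' ∈ cylinder ω V, if ω'.deg h ≤ k then (1 : ℝ) else 0 := by
    intro ω V hk
    refine le_sum_cylinder_const _ fun ω' _ => (mul_nonpos_of_nonneg_of_nonpos hc0 ?_).trans (hnn ω')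
    have : ((k : ℝ) + 1) ≤ ω.pathLength V h := by exact_mod_cast hk
    linarith
  induction r with
  | zero => exact fun ω V _ _ _ _ hk => htriv ω V hk
  | succ r ih =>
    intro ω V hV ho hdef hcomp hk
    by_cases hDk : k + 1 ≤ ω.pathLength V h
    · exact htriv ω V hDk
    have hDk : ω.pathLength V h ≤ k := by omega
    set f := ω.exit V h with hf
    set b := ω.exit V (opp h) with hb
    have hfV : f.1 ∈ V := ho.exit_mem
    have hnd : ∀ F ∈ V, ¬ ω.Defective V F := fun F hF hd => by
      have := mem_defects.2 ⟨hF, hd⟩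
      rw [hdef] at this
      exact absurd this (Finset.notMem_empty _)
    have hne : f.1 ≠ b.1 := fun e => hnd _ hfV (defective_of_exit_fst_eq hV ho e)
    have hbt : b ∈ targets V f := mem_targets.2 ⟨(ho.opp hV).exit_mem, hne.symm⟩
    have hbE : b.1 ∈ ω.exceptional V h :=
      subset_nbrs _ (subset_nbrs _ (subset_nbrs _
        (Finset.mem_insert_of_mem (Finset.mem_insert_self _ _))))
    have hkD : (0 : ℝ) ≤ k - ω.pathLength V h := by
      rw [sub_nonneg]; exact_mod_cast hDk
    -- Gluing the two ends succeeds at once; exceptional targets are given up; a generic target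
    -- keeps the state free of defects and uses up `1 + idx (opp y)` of the remaining length.
    refine le_sum_cylinder_of_targets hV hfV _
      (fun y => if y = b then 1 else if y.1 ∈ ω.exceptional V h then 0 else
        c * (k - ω.pathLength V h - ω.idx V (opp y))) ?_ ?_
    · intro ω' hω'
      have hV' := hV.of_mem_cylinder hω'
      have ho' := isOpen_of_mem_cylinder hω' ho
      have hf' : ω'.exit V h = f := by rw [exit_cylinder hω']
      split_ifs with hy hE
      · refine le_sum_cylinder_const _ fun ω'' hω'' => ?_
        obtain ⟨h1, h2⟩ := mem_cylinder_of_mem_remove hω' hω''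
        have := (pathLength_le_deg (hV.of_mem_cylinder h1) (isOpen_of_mem_cylinder h1 ho)).2.2
          (by rw [exit_cylinder h1, ← hf, ← hb, h2, hy])
        rw [pathLength_cylinder h1] at this
        rw [if_pos (by omega)]
      · rw [zero_mul]
        exact Finset.sum_nonneg fun ω'' _ => hnn ω''
      · have hE' : ω'.mate (ω'.exit V h).1 ∉ ω'.exceptional V h := by
          rw [hf', exceptional_cylinder hω']; exact hE
        have h1 := step_exit hV' ho' hE'
        have h2 := step_pathLength hV' ho' hE' (by rw [exit_cylinder hω']; exact hne)
        have h3 := step_defects hV' ho' hE' (by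
          rw [hf', Defective, nb_cylinder hω']; exact hnd _ hfV)
        rw [hf'] at h1 h2 h3
        rw [pathLength_cylinder hω', idx_cylinder hω'] at h2
        have h4 := ih ω' _ (hV'.remove _) h1.1 (by
            rw [defects_cylinder hω', hdef] at h3
            exact Finset.subset_empty.1 h3)
          (by rw [card_compl_remove hV' hfV]; omega) (by omega)
        refine le_trans (le_of_eq ?_) h4
        rw [h2]
        push_cast
        ring
    · have hpt : ∀ y ∈ targets V f, (if y = b then (1 : ℝ) else 0) +
          (c * (k - ω.pathLength V h) - c * (ω.idx V (opp y)) -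
            if y.1 ∈ ω.exceptional V h then c * (k - ω.pathLength V h) else 0) ≤
          if y = b then 1 else if y.1 ∈ ω.exceptional V h then 0 else
            c * (k - ω.pathLength V h - ω.idx V (opp y)) := by
        intro y _
        have h1 : 0 ≤ c * (ω.idx V (opp y) : ℝ) := by positivity
        split_ifs with hy hE hE
        · linarith
        · exact absurd (hy ▸ hbE) hE
        · linarith
        · linarith
      refine le_trans ?_ (Finset.sum_le_sum hpt)
      rw [Finset.sum_add_distrib, Finset.sum_sub_distrib, Finset.sum_sub_distrib,
        Finset.sum_ite_eq', if_pos hbt, Finset.sum_const, nsmul_eq_mul, ← Finset.mul_sum,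
        ← Finset.sum_filter, Finset.sum_const, nsmul_eq_mul, cast_card_targets hfV]
      -- Disjointness of the paths bounds their total excess length by three times the number of
      -- glued faces, of which there are at most `2 k`. So a step has mean length close to one.
      have hidx : ∑ y ∈ targets V f, (ω.idx V (opp y) : ℝ) ≤ 6 * k := by
        have h1 : ∑ y ∈ targets V f, ω.idx V (opp y) ≤
            ∑ z : HalfEdge n with z.1 ∈ V, ω.idx V (opp z) := by
          refine Finset.sum_le_sum_of_subset fun y hy => ?_
          exact Finset.mem_filter.2 ⟨Finset.mem_univ _, (mem_targets.1 hy).1⟩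
        have h2 := sum_idx_opp_le hV
        rw [Finset.sum_add_distrib, Finset.sum_const, card_filter_fst, smul_eq_mul, mul_one] at h2
        have h3 := Finset.card_sdiff_add_card_eq_card (Finset.subset_univ V)
        have h4 : (Finset.univ : Finset (Face n)).card = 4 * n := by simp; ring
        have h5 : ∑ y ∈ targets V f, ω.idx V (opp y) ≤ 6 * k := by omega
        exact_mod_cast h5
      have he : (((targets V f).filter fun y => y.1 ∈ ω.exceptional V h).card : ℝ) ≤ 384 := by
        have h1 := card_exceptional_targets_le (ω := ω) (V := V) (h := h) f
        have h2 : ω.weight V h = 1 := by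
          rw [weight, danger_eq_zero.2 (hnd _ hfV), hdef]; rfl
        rw [h2] at h1
        exact_mod_cast h1
      have hTr : ((Finset.univ \ V).card : ℝ) ≤ 2 * k := by exact_mod_cast (by omega)
      have hQM : M ≤ 3 * ((V.card : ℝ) - 1) := by
        have := card_add_card_compl (V := V)
        linarith
      have hQn := card_targets_le (V := V)
      obtain ⟨Q, hQ⟩ : ∃ Q : ℝ, Q = 3 * ((V.card : ℝ) - 1) := ⟨_, rfl⟩
      rw [← hQ] at hQM hQn ⊢
      -- The loss is at most `c * 390 k`: `6 k` from the excess lengths, and at most `k` for each of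
      -- at most `384` exceptional targets.
      have hkδ : 390 * (k : ℝ) ≤ Q * δ := by
        have h1 : 390 * (k : ℝ) = M * δ := by rw [hδdef]; field_simp
        have h2 : 0 ≤ δ := by rw [hδdef]; positivity
        rw [h1]
        gcongr
      have hcQ : c * Q * (1 + δ) ≤ 1 := by
        have h1 : c * Q ≤ 1 - δ := by
          rw [hc, div_mul_eq_mul_div, div_le_iff₀ (by positivity)]
          gcongr
        have h2 : 0 ≤ δ := by rw [hδdef]; positivity
        nlinarith [mul_le_mul_of_nonneg_right h1 (by linarith : 0 ≤ 1 + δ)]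
      have hDpos : (0 : ℝ) ≤ ω.pathLength V h := Nat.cast_nonneg _
      have h1 := mul_le_mul_of_nonneg_left hidx hc0
      have h2 := mul_le_mul_of_nonneg_right he (mul_nonneg hc0 hkD)
      have h3 := mul_le_mul_of_nonneg_left hkδ hc0
      have h4 := mul_nonneg hc0 hDpos
      nlinarith

open Classical in
/-- The probability of degree at most `k` is at least `k (1 - O(k / n)) / (12 n)`. -/
theorem le_prob_deg_le [Nonempty (Gluing n)] (h : HalfEdge n) (k : ℕ) {M : ℝ} (hM : 0 < M)
    (hMn : M + 6 * k + 3 ≤ 12 * n) (hkM : 390 * (k : ℝ) ≤ M) :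
    (1 - 390 * k / M) / (12 * n) * k ≤ prob fun ω : Gluing n => ω.deg h ≤ k := by
  refine le_expect_of_forall _ fun ω => ?_
  have := le_sum_cylinder_deg_le h k hM hMn hkM k ω Finset.univ (mateClosed_univ ω)
    (isOpen_univ ω h) defects_univ (by rw [pathLength_univ]; simp)
    (by rw [pathLength_univ]; omega)
  rw [pathLength_univ] at this
  simpa using this

end lower

end Gluing
end TetGluing

/-! ### From half-edges to the edges of the complex. -/

namespace TetGluing

/-- The edge of a tetrahedron that a half-edge belongs to. -/
def HalfEdge.edge {n : ℕ} (h : HalfEdge n) : TetEdge n :=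
  (h.1.1, ⟨{faceVertex h.1.2 (h.2 + 1), faceVertex h.1.2 (h.2 + 2)}, by
    rw [Finset.card_pair]
    intro e
    have := faceVertex_injective _ e
    revert this
    generalize h.2 = a
    revert a
    decide⟩)

section

variable {n : ℕ}

/-- A finite check that an edge of a tetrahedron lies in exactly two faces, exchanged by `opp`. -/
theorem faceVertex_pair_eq : ∀ (j j' : Fin 4) (a a' : Fin 3),
    (({faceVertex j (a + 1), faceVertex j (a + 2)} : Finset (Fin 4)) =
      {faceVertex j' (a' + 1), faceVertex j' (a' + 2)}) ↔
    (j' = j ∧ a' = a) ∨ (j' = faceVertex j a ∧ a' = vertexPos (faceVertex j a) j) := by decide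

theorem exists_faceVertex_pair : ∀ s : Finset (Fin 4), s.card = 2 → ∃ j a,
    ({faceVertex j (a + 1), faceVertex j (a + 2)} : Finset (Fin 4)) = s := by decide

theorem edge_eq_iff {h h' : HalfEdge n} : h.edge = h'.edge ↔ h' = h ∨ h' = opp h := by
  obtain ⟨⟨i, j⟩, a⟩ := h
  obtain ⟨⟨i', j'⟩, a'⟩ := h'
  simp only [HalfEdge.edge, opp, Prod.mk.injEq, Subtype.mk.injEq, faceVertex_pair_eq]
  constructor
  · rintro ⟨rfl, h | h⟩ <;> simp [h]
  · rintro (⟨⟨rfl, h⟩, h'⟩ | ⟨⟨rfl, h⟩, h'⟩) <;> simp [h, h']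

theorem edge_surjective : Function.Surjective (HalfEdge.edge (n := n)) := by
  rintro ⟨i, s, hs⟩
  obtain ⟨j, a, h⟩ := exists_faceVertex_pair s hs
  exact ⟨((i, j), a), by simp [HalfEdge.edge, h]⟩

theorem edge_opp (h : HalfEdge n) : (opp h).edge = h.edge := (edge_eq_iff.2 (Or.inr rfl)).symm

theorem card_edge_fiber (c : TetEdge n) :
    (Finset.univ.filter fun h : HalfEdge n => h.edge = c).card = 2 := by
  obtain ⟨h, rfl⟩ := edge_surjective c
  have : (Finset.univ.filter fun x : HalfEdge n => x.edge = h.edge) = {h, opp h} := by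
    ext x
    rw [Finset.mem_filter, eq_comm, edge_eq_iff]
    simp
  rw [this, Finset.card_pair (opp_ne h).symm]

theorem exists_third : ∀ a b : Fin 3, a ≠ b → ∃ x : Fin 3,
    (a = x + 1 ∧ b = x + 2) ∨ (a = x + 2 ∧ b = x + 1) := by decide

end

namespace Gluing

variable {n : ℕ} {ω : Gluing n}

theorem glue_add_one (F : Face n) (x : Fin 3) : ω.glue F (x + 1) = ω.glue F x + 2 := by
  rw [ω.glue_reverse]
  generalize ω.glue F x = c
  revert c; decide

theorem glue_add_two (F : Face n) (x : Fin 3) : ω.glue F (x + 2) = ω.glue F x + 1 := by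
  rw [show x + 2 = x + 1 + 1 by rw [add_assoc]; rfl, glue_add_one, glue_add_one]
  generalize ω.glue F x = c
  revert c; decide

/-- Two distinct positions on a face are the ends of the side opposite to the third one, and
reversal sends opposite sides to opposite sides. -/
theorem identified_iff {c c' : TetEdge n} :
    ω.Identified c c' ↔ ∃ h : HalfEdge n, h.edge = c ∧ (ω.cross h).edge = c' := by
  constructor
  · rintro ⟨F, a, b, hab, h1, h2, h3, h4⟩
    obtain ⟨x, hx⟩ := exists_third a b hab
    refine ⟨(F, x), Prod.ext h1.symm (Subtype.ext ?_), Prod.ext h3.symm (Subtype.ext ?_)⟩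
    · rw [h2]
      rcases hx with ⟨rfl, rfl⟩ | ⟨rfl, rfl⟩
      · rfl
      · exact Finset.pair_comm _ _
    · rw [h4]
      rcases hx with ⟨rfl, rfl⟩ | ⟨rfl, rfl⟩
      · rw [glue_add_one, glue_add_two]; exact Finset.pair_comm _ _
      · rw [glue_add_one, glue_add_two]; rfl
  · rintro ⟨⟨F, x⟩, rfl, rfl⟩
    refine ⟨F, x + 1, x + 2, ?_, rfl, rfl, rfl, ?_⟩
    · revert x; decide
    · rw [glue_add_one, glue_add_two]; exact Finset.pair_comm _ _

theorem sameEdge_refl (h : HalfEdge n) : ω.SameEdge h h := ⟨0, Or.inl rfl⟩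

theorem sameEdge_opp (h : HalfEdge n) : ω.SameEdge h (opp h) := ⟨0, Or.inr rfl⟩

theorem sameEdge_turn (h : HalfEdge n) : ω.SameEdge h (ω.turn h) := ⟨1, Or.inl rfl⟩

theorem exists_iterate_opp (i : ℕ) (x : HalfEdge n) :
    ∃ m, ω.turn^[m] (opp x) = opp (ω.turn^[i] x) := by
  have h1 := ω.iterate_turn_opp i 0 x
  simp only [add_zero, Function.iterate_zero, id] at h1
  exact exists_iterate_of_iterate_eq (i := 0) (j := i) h1.symm

theorem sameEdge_trans {h h' h'' : HalfEdge n} (h1 : ω.SameEdge h h') (h2 : ω.SameEdge h' h'') :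
    ω.SameEdge h h'' := by
  obtain ⟨i, rfl | rfl⟩ := h1 <;> obtain ⟨j, rfl | rfl⟩ := h2
  · exact ⟨j + i, Or.inl (Function.iterate_add_apply _ _ _ _)⟩
  · obtain ⟨m, hm⟩ := exists_iterate_opp (ω := ω) i h
    exact ⟨j + m, Or.inr (by rw [Function.iterate_add_apply, hm])⟩
  · exact ⟨j + i, Or.inr (Function.iterate_add_apply _ _ _ _)⟩
  · obtain ⟨m, hm⟩ := exists_iterate_opp (ω := ω) i (opp h)
    rw [opp_opp] at hm
    exact ⟨j + m, Or.inl (by rw [Function.iterate_add_apply, hm])⟩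

theorem sameEdge_of_edge_eq {h h' : HalfEdge n} (he : h.edge = h'.edge) : ω.SameEdge h h' := by
  rcases edge_eq_iff.1 he with rfl | rfl
  · exact sameEdge_refl _
  · exact sameEdge_opp _

theorem toEdge_turn (h : HalfEdge n) : ω.toEdge (ω.turn h).edge = ω.toEdge h.edge := by
  rw [turn, edge_opp]
  exact (Quot.sound (identified_iff.2 ⟨h, rfl, rfl⟩)).symm

/-- The relation `SameEdge` is an equivalence containing the generating identifications; conversely
each `turn` and each `opp` stays in the same class. -/
theorem toEdge_eq_iff {h h' : HalfEdge n} :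
    ω.toEdge h.edge = ω.toEdge h'.edge ↔ ω.SameEdge h h' := by
  constructor
  · intro he
    have h1 := Quot.eqvGen_exact he
    have key : ∀ c c' : TetEdge n, Relation.EqvGen ω.Identified c c' →
        ∀ h h' : HalfEdge n, h.edge = c → h'.edge = c' → ω.SameEdge h h' := by
      intro c c' hg
      induction hg with
      | rel c c' hr =>
        intro h h' hc hc'
        obtain ⟨x, hx, hx'⟩ := identified_iff.1 hr
        refine sameEdge_trans (sameEdge_of_edge_eq (hc.trans hx.symm))
          (sameEdge_trans (sameEdge_turn x) (sameEdge_of_edge_eq ?_))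
        rw [turn, edge_opp, hx', hc']
      | refl c => exact fun h h' hc hc' => sameEdge_of_edge_eq (hc.trans hc'.symm)
      | symm c c' _ ih => exact fun h h' hc hc' => sameEdge_symm (ih h' h hc' hc)
      | trans c c' c'' _ _ ih1 ih2 =>
        intro h h' hc hc'
        obtain ⟨x, hx⟩ := edge_surjective c'
        exact sameEdge_trans (ih1 h x hc hx) (ih2 x h' hx hc')
    exact key _ _ h1 h h' rfl rfl
  · have hit : ∀ i (x : HalfEdge n), ω.toEdge (ω.turn^[i] x).edge = ω.toEdge x.edge := by
      intro i x
      induction i with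
      | zero => rfl
      | succ i ih => rw [Function.iterate_succ_apply', toEdge_turn, ih]
    rintro ⟨i, rfl | rfl⟩
    · rw [hit]
    · rw [hit, edge_opp]

theorem deg_opp (h : HalfEdge n) : ω.deg (opp h) = ω.deg h := by
  have key : ∀ x : HalfEdge n, ω.deg (opp x) ∣ ω.deg x := by
    intro x
    refine Function.IsPeriodicPt.minimalPeriod_dvd ?_
    have h1 := ω.iterate_turn_opp (ω.deg x) 0 x
    rw [add_zero, iterate_deg] at h1
    exact h1
  exact Nat.dvd_antisymm (key h) (by simpa using key (opp h))

theorem exists_iterate_lt_deg (i : ℕ) (h : HalfEdge n) :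
    ∃ j < ω.deg h, ω.turn^[j] h = ω.turn^[i] h :=
  ⟨i % ω.deg h, Nat.mod_lt _ (ω.deg_pos h), Function.iterate_mod_minimalPeriod_eq⟩

-- The half-edges of an edge form the two cycles of `h` and `opp h`, of equal length and disjoint by
-- `iterate_turn_ne_opp`.
open Classical in
theorem card_sameEdge (h : HalfEdge n) :
    (Finset.univ.filter fun h' : HalfEdge n => ω.SameEdge h h').card = 2 * ω.deg h := by
  have h1 : (Finset.univ.filter fun h' : HalfEdge n => ω.SameEdge h h') =
      (Finset.range (ω.deg h)).image (fun i => ω.turn^[i] h) ∪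
        (Finset.range (ω.deg (opp h))).image fun i => ω.turn^[i] (opp h) := by
    ext x
    simp only [Finset.mem_filter, Finset.mem_univ, true_and, Finset.mem_union, Finset.mem_image,
      Finset.mem_range]
    constructor
    · rintro ⟨i, rfl | rfl⟩
      · exact Or.inl (exists_iterate_lt_deg i h)
      · exact Or.inr (exists_iterate_lt_deg i (opp h))
    · rintro (⟨i, -, hi⟩ | ⟨i, -, hi⟩)
      · exact ⟨i, Or.inl hi⟩
      · exact ⟨i, Or.inr hi⟩
  have hinj : ∀ x : HalfEdge n,
      ((Finset.range (ω.deg x)).image fun i => ω.turn^[i] x).card = ω.deg x := by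
    intro x
    rw [Finset.card_image_of_injOn, Finset.card_range]
    rw [Finset.coe_range]
    exact Function.iterate_injOn_Iio_minimalPeriod
  rw [h1, Finset.card_union_of_disjoint, hinj, hinj, deg_opp, two_mul]
  rw [Finset.disjoint_left]
  rintro x hx hx'
  obtain ⟨i, -, rfl⟩ := Finset.mem_image.1 hx
  obtain ⟨j, -, hj⟩ := Finset.mem_image.1 hx'
  obtain ⟨m, hm⟩ := exists_iterate_of_iterate_eq hj.symm
  exact ω.iterate_turn_ne_opp m h hm

instance : Finite ω.Edge := Quot.finite _

noncomputable instance : Fintype ω.Edge := Fintype.ofFinite _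

open Classical in
theorem card_filter_toEdge (e : ω.Edge) :
    (Finset.univ.filter fun h : HalfEdge n => ω.toEdge h.edge = e).card = 2 * ω.edgeDegree e := by
  rw [edgeDegree, Nat.card_eq_fintype_card, Fintype.card_subtype,
    Finset.card_eq_sum_card_fiberwise (f := HalfEdge.edge)
      (t := Finset.univ.filter fun c => ω.toEdge c = e)
      (fun h hh => by simpa using hh)]
  rw [Finset.sum_congr (g := fun _ => 2) rfl, Finset.sum_const, smul_eq_mul, mul_comm]
  intro c hc
  refine (congrArg Finset.card ?_).trans (card_edge_fiber c)
  ext h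
  simp only [Finset.mem_filter, Finset.mem_univ, true_and] at hc ⊢
  exact ⟨fun h => h.2, fun h => ⟨by rw [h, hc], h⟩⟩

/-- Both sides, doubled, count the half-edges over the edge: two for each tetrahedron edge on the
left, two cycles on the right. -/
theorem edgeDegree_toEdge (h : HalfEdge n) : ω.edgeDegree (ω.toEdge h.edge) = ω.deg h := by
  classical
  have h1 := card_filter_toEdge (ω.toEdge h.edge)
  have h2 := card_sameEdge (ω := ω) h
  have h3 : (Finset.univ.filter fun x : HalfEdge n => ω.toEdge x.edge = ω.toEdge h.edge) =
      Finset.univ.filter fun h' : HalfEdge n => ω.SameEdge h h' := by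
    ext x
    simp only [Finset.mem_filter, Finset.mem_univ, true_and]
    rw [eq_comm, toEdge_eq_iff]
  rw [h3] at h1
  omega

theorem toEdge_edge_surjective : Function.Surjective fun h : HalfEdge n => ω.toEdge h.edge := by
  intro e
  obtain ⟨c, rfl⟩ := Quot.exists_rep e
  obtain ⟨h, rfl⟩ := edge_surjective c
  exact ⟨h, rfl⟩

/-- A sum over the edges of the complex as a sum over half-edges. -/
theorem sum_edges_eq (g : ω.Edge → ℝ) :
    ∑ e, g e = ∑ h : HalfEdge n, g (ω.toEdge h.edge) / (2 * ω.deg h) := by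
  classical
  rw [← Finset.sum_fiberwise (s := Finset.univ) (g := fun h : HalfEdge n => ω.toEdge h.edge)]
  refine Finset.sum_congr rfl fun e _ => ?_
  have h1 : ∀ h ∈ Finset.univ.filter (fun h : HalfEdge n => ω.toEdge h.edge = e),
      g (ω.toEdge h.edge) / (2 * ω.deg h) = g e / (2 * ω.edgeDegree e) := by
    intro h hh
    rw [← edgeDegree_toEdge, (Finset.mem_filter.1 hh).2]
  rw [Finset.sum_congr rfl h1, Finset.sum_const, card_filter_toEdge, nsmul_eq_mul]
  have h2 : (ω.edgeDegree e : ℝ) ≠ 0 := by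
    obtain ⟨h, rfl⟩ := toEdge_edge_surjective e
    rw [edgeDegree_toEdge]
    exact_mod_cast (ω.deg_pos h).ne'
  push_cast
  field_simp

theorem natCard_subtype_edge (p : ω.Edge → Prop) [DecidablePred p] :
    (Nat.card {e : ω.Edge // p e} : ℝ) = ∑ e, if p e then (1 : ℝ) else 0 := by
  rw [Nat.card_eq_fintype_card, Fintype.card_subtype, Finset.sum_boole]

theorem numEdges_eq : (ω.numEdges : ℝ) = ∑ h : HalfEdge n, 1 / (2 * (ω.deg h : ℝ)) := by
  rw [← sum_edges_eq (fun _ => 1), numEdges, Nat.card_eq_fintype_card]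
  simp

theorem numEdgesOfDegree_eq (k : ℕ) : (ω.numEdgesOfDegree k : ℝ) =
    ∑ h : HalfEdge n, 1 / (2 * (k : ℝ)) * if ω.deg h = k then 1 else 0 := by
  classical
  rw [numEdgesOfDegree, natCard_subtype_edge, sum_edges_eq]
  refine Finset.sum_congr rfl fun h _ => ?_
  rw [edgeDegree_toEdge]
  split_ifs with hk
  · rw [hk, mul_one]
  · simp

theorem isSimpleEdge_of_isSimple {h : HalfEdge n} (hs : ω.IsSimple h) :
    ω.IsSimpleEdge (ω.toEdge h.edge) := by
  have key : ∀ c : TetEdge n, ω.toEdge c = ω.toEdge h.edge →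
      ∃ i < ω.deg h, c = (ω.turn^[i] h).edge := by
    intro c hc
    obtain ⟨x, rfl⟩ := edge_surjective c
    obtain ⟨i, rfl | rfl⟩ := toEdge_eq_iff.1 hc.symm
    · obtain ⟨j, hj, he⟩ := exists_iterate_lt_deg (ω := ω) i h
      exact ⟨j, hj, by rw [he]⟩
    · obtain ⟨m, hm⟩ := exists_iterate_opp (ω := ω) i (opp h)
      rw [opp_opp] at hm
      obtain ⟨j, hj, he⟩ := exists_iterate_lt_deg (ω := ω) m h
      exact ⟨j, hj, by rw [he, hm, edge_opp]⟩
  intro c c' hc hc' htet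
  obtain ⟨i, hi, rfl⟩ := key c hc
  obtain ⟨j, hj, rfl⟩ := key c' hc'
  rw [hs (Set.mem_Iio.2 hi) (Set.mem_Iio.2 hj) htet]

open Classical in
theorem le_numSimpleEdgesOfDegree (k : ℕ) :
    ∑ h : HalfEdge n, 1 / (2 * (k : ℝ)) * (if ω.IsSimple h ∧ ω.deg h = k then 1 else 0) ≤
      (ω.numSimpleEdgesOfDegree k : ℝ) := by
  rw [numSimpleEdgesOfDegree, natCard_subtype_edge, sum_edges_eq]
  refine Finset.sum_le_sum fun h _ => ?_
  rw [edgeDegree_toEdge]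
  by_cases hs : ω.IsSimple h ∧ ω.deg h = k
  · rw [if_pos hs, if_pos ⟨isSimpleEdge_of_isSimple hs.1, hs.2⟩, hs.2, mul_one]
  · rw [if_neg hs, mul_zero]
    split_ifs <;> positivity

theorem numSimpleEdgesOfDegree_le (k : ℕ) : ω.numSimpleEdgesOfDegree k ≤ ω.numEdgesOfDegree k :=
  Nat.card_le_card_of_injective
    (fun e : {e : ω.Edge // ω.IsSimpleEdge e ∧ ω.edgeDegree e = k} =>
      (⟨e.1, e.2.2⟩ : {e : ω.Edge // ω.edgeDegree e = k}))
    (fun _ _ he => Subtype.ext (Subtype.mk.inj he))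

-- Choosing for each pair of edges two half-edges in a common tetrahedron is injective, since the
-- half-edges determine the edges.
open Classical in
theorem numAdjacentPairs_le (K L N : ℕ) (hK : K ≤ N) (hL : L ≤ N) :
    (ω.numAdjacentPairs K L : ℝ) ≤ ∑ p : HalfEdge n × HalfEdge n with p.1.1.1 = p.2.1.1,
      if ω.deg p.1 ≤ N ∧ ω.deg p.2 ≤ N ∧ ¬ ω.SameEdge p.1 p.2 then (1 : ℝ) else 0 := by
  rw [Finset.sum_boole, numAdjacentPairs, Finset.filter_filter, ← Fintype.card_subtype,
    ← Nat.card_eq_fintype_card]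
  have hch : ∀ p : {p : ω.Edge × ω.Edge // p.1 ≠ p.2 ∧ ω.edgeDegree p.1 ≤ K ∧
      ω.edgeDegree p.2 ≤ L ∧ ω.ShareTet p.1 p.2}, ∃ x : {p : HalfEdge n × HalfEdge n //
      p.1.1.1 = p.2.1.1 ∧ ω.deg p.1 ≤ N ∧ ω.deg p.2 ≤ N ∧ ¬ ω.SameEdge p.1 p.2},
      p.1 = (ω.toEdge x.1.1.edge, ω.toEdge x.1.2.edge) := by
    rintro ⟨⟨e, e'⟩, hne, hd, hd', c, c', hc, hc', ht⟩
    obtain ⟨h, rfl⟩ := edge_surjective c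
    obtain ⟨h', rfl⟩ := edge_surjective c'
    simp only at hc hc' hne hd hd'
    subst hc hc'
    rw [edgeDegree_toEdge] at hd hd'
    exact ⟨⟨(h, h'), ht, hd.trans hK, hd'.trans hL, fun hs => hne (toEdge_eq_iff.2 hs)⟩, rfl⟩
  choose φ hφ using hch
  refine Nat.cast_le.2 (Nat.card_le_card_of_injective φ fun p q hpq => Subtype.ext ?_)
  rw [hφ p, hφ q, hpq]

theorem card_pairs_same_tet :
    (Finset.univ.filter fun p : HalfEdge n × HalfEdge n => p.1.1.1 = p.2.1.1).card = 144 * n := by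
  have h1 : (Finset.univ.filter fun p : HalfEdge n × HalfEdge n => p.1.1.1 = p.2.1.1) =
      (Finset.univ : Finset (Fin n × (Fin 4 × Fin 3) × (Fin 4 × Fin 3))).image
        fun x => (((x.1, x.2.1.1), x.2.1.2), ((x.1, x.2.2.1), x.2.2.2)) := by
    ext ⟨⟨⟨i, j⟩, a⟩, ⟨⟨i', j'⟩, a'⟩⟩
    simp only [Finset.mem_filter, Finset.mem_univ, true_and, Finset.mem_image, Prod.mk.injEq,
      Prod.exists]
    constructor
    · rintro rfl
      exact ⟨i, j, a, j', a', by simp⟩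
    · rintro ⟨_, _, _, _, _, h⟩
      rw [← h.1.1.1, ← h.2.1.1]
  rw [h1, Finset.card_image_of_injective]
  · simp; ring
  · rintro ⟨i, ⟨j, a⟩, ⟨j', a'⟩⟩ ⟨i2, ⟨j2, a2⟩, ⟨j2', a2'⟩⟩ h
    simp only [Prod.mk.injEq] at h ⊢
    tauto

/-- In every tetrahedron, face `0` is glued to face `1` and face `2` to face `3`; `a ↦ -a` reverses
the cyclic order and is an involution. -/
instance : Nonempty (Gluing n) :=
  ⟨{ mate := fun F => (F.1, ![1, 0, 3, 2] F.2)
     mate_mate := by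
      rintro ⟨i, j⟩
      fin_cases j <;> rfl
     mate_ne := by
      rintro ⟨i, j⟩ h
      have := congrArg Prod.snd h
      revert this
      fin_cases j <;> simp
     glue := fun _ a => -a
     glue_reverse := fun _ a => by abel
     glue_glue := fun _ a => neg_neg a }⟩

end Gluing
end TetGluing

/-! ### Harmonic sums and expected numbers of edges. -/

namespace TetGluing

theorem log_succ_div_le_sum {k₁ k₂ : ℕ} (h1 : 1 ≤ k₁) (h2 : k₁ ≤ k₂) :
    Real.log (((k₂ : ℝ) + 1) / k₁) ≤ ∑ l ∈ Finset.Icc k₁ k₂, 1 / (l : ℝ) := by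
  have h1' : (1 : ℝ) ≤ k₁ := by exact_mod_cast h1
  induction k₂, h2 using Nat.le_induction with
  | base =>
    rw [Finset.Icc_self, Finset.sum_singleton]
    refine (Real.log_le_sub_one_of_pos (by positivity)).trans (le_of_eq ?_)
    field_simp
    ring
  | succ m hm ih =>
    rw [← Finset.insert_Icc_right_eq_Icc_add_one (by omega), Finset.sum_insert (by simp)]
    have hm' : (1 : ℝ) ≤ m := by exact_mod_cast h1.trans hm
    have h3 : (((m + 1 : ℕ) : ℝ) + 1) / k₁ = ((m : ℝ) + 2) / (m + 1) * (((m : ℝ) + 1) / k₁) := by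
      push_cast
      field_simp
      ring
    rw [h3, Real.log_mul (by positivity) (by positivity)]
    have h4 := Real.log_le_sub_one_of_pos (show (0 : ℝ) < ((m : ℝ) + 2) / (m + 1) by positivity)
    have h5 : ((m : ℝ) + 2) / (m + 1) - 1 = 1 / ((m + 1 : ℕ) : ℝ) := by
      push_cast
      field_simp
      ring
    linarith

theorem log_div_le_sum {k₁ k₂ : ℕ} (h1 : 1 ≤ k₁) (h2 : k₁ ≤ k₂) :
    Real.log ((k₂ : ℝ) / k₁) ≤ ∑ l ∈ Finset.Icc k₁ k₂, 1 / (l : ℝ) := by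
  refine le_trans (Real.log_le_log ?_ ?_) (log_succ_div_le_sum h1 h2)
  · have h1' : (0 : ℝ) < k₁ := by exact_mod_cast h1
    have h2' : (0 : ℝ) < k₂ := by exact_mod_cast h1.trans h2
    positivity
  · gcongr
    linarith

theorem sum_le_log_div {k₁ k₂ : ℕ} (h1 : 1 ≤ k₁) (h2 : k₁ ≤ k₂) :
    ∑ l ∈ Finset.Icc k₁ k₂, 1 / (l : ℝ) ≤ 1 / k₁ + Real.log ((k₂ : ℝ) / k₁) := by
  have h1' : (1 : ℝ) ≤ k₁ := by exact_mod_cast h1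
  induction k₂, h2 using Nat.le_induction with
  | base => simp [div_self (show (k₁ : ℝ) ≠ 0 by positivity)]
  | succ m hm ih =>
    rw [← Finset.insert_Icc_right_eq_Icc_add_one (by omega), Finset.sum_insert (by simp)]
    have hm' : (1 : ℝ) ≤ m := by exact_mod_cast h1.trans hm
    have h3 : ((m + 1 : ℕ) : ℝ) / k₁ = ((m : ℝ) + 1) / m * ((m : ℝ) / k₁) := by
      push_cast
      field_simp
    rw [h3, Real.log_mul (by positivity) (by positivity)]
    have h4 := Real.one_sub_inv_le_log_of_pos (show (0 : ℝ) < ((m : ℝ) + 1) / m by positivity)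
    have h5 : 1 - (((m : ℝ) + 1) / m)⁻¹ = 1 / ((m + 1 : ℕ) : ℝ) := by
      push_cast
      field_simp
      ring
    linarith

/-- The sum of `1 / k - 1 / (k + 1)` over `d ≤ k ≤ K` telescopes. This is summation by parts: it
expresses inverse degrees through the events of degree at most `k`, for which the sharper lower
bound is available. -/
theorem sum_ite_le_inv (K d : ℕ) (hd : 1 ≤ d) :
    ∑ k ∈ Finset.Icc 1 K, 1 / ((k : ℝ) * (k + 1)) * (if d ≤ k then 1 else 0) ≤
      if d ≤ K then 1 / (d : ℝ) - 1 / (K + 1) else 0 := by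
  have hd' : (1 : ℝ) ≤ d := by exact_mod_cast hd
  induction K with
  | zero =>
    rw [if_neg (by omega)]
    simp
  | succ K ih =>
    rw [← Finset.insert_Icc_right_eq_Icc_add_one (by omega), Finset.sum_insert (by simp)]
    by_cases h1 : d ≤ K
    · rw [if_pos h1] at ih
      have h2 : d ≤ K + 1 := h1.trans K.le_succ
      rw [if_pos h2, if_pos h2]
      have : 1 / (((K + 1 : ℕ) : ℝ) * ((K + 1 : ℕ) + 1)) =
          1 / ((K : ℝ) + 1) - 1 / (((K + 1 : ℕ) : ℝ) + 1) := by
        push_cast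
        field_simp
        ring
      rw [this]
      linarith
    · rw [if_neg h1] at ih
      by_cases h2 : d ≤ K + 1
      · obtain rfl : d = K + 1 := by omega
        rw [if_pos le_rfl, if_pos le_rfl]
        have : 1 / (((K + 1 : ℕ) : ℝ) * ((K + 1 : ℕ) + 1)) =
            1 / ((K + 1 : ℕ) : ℝ) - 1 / (((K + 1 : ℕ) : ℝ) + 1) := by
          push_cast
          field_simp
          ring
        rw [this]
        linarith
      · rw [if_neg h2, if_neg h2]
        linarith

theorem inv_le_sum_ite (K d : ℕ) (hd : 1 ≤ d) :
    1 / (2 * (d : ℝ)) ≤ (∑ k ∈ Finset.Icc 1 K, 1 / (2 * (k : ℝ)) * (if d = k then 1 else 0)) +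
      1 / (2 * ((K : ℝ) + 1)) := by
  by_cases h : d ≤ K
  · have : 1 / (2 * (d : ℝ)) ≤
        ∑ k ∈ Finset.Icc 1 K, 1 / (2 * (k : ℝ)) * (if d = k then 1 else 0) := by
      refine le_trans (le_of_eq ?_) (Finset.single_le_sum
        (f := fun k : ℕ => 1 / (2 * (k : ℝ)) * (if d = k then 1 else 0)) (fun k _ => ?_)
        (Finset.mem_Icc.2 ⟨hd, h⟩))
      · simp
      · positivity
    have : (0 : ℝ) ≤ 1 / (2 * ((K : ℝ) + 1)) := by positivity
    linarith
  · have h1 : 1 / (2 * (d : ℝ)) ≤ 1 / (2 * ((K : ℝ) + 1)) := by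
      have : (K : ℝ) + 1 ≤ d := by exact_mod_cast (not_le.1 h)
      gcongr
    have : 0 ≤ ∑ k ∈ Finset.Icc 1 K, 1 / (2 * (k : ℝ)) * (if d = k then (1 : ℝ) else 0) :=
      Finset.sum_nonneg fun k _ => by positivity
    linarith

namespace Gluing

variable {n : ℕ}

theorem card_halfEdge : (Finset.univ : Finset (HalfEdge n)).card = 12 * n := by
  simp
  ring

theorem expect_sum_halfEdge_le (X : HalfEdge n → Gluing n → ℝ) {c : ℝ}
    (hX : ∀ h, expect (X h) ≤ c) : expect (fun ω => ∑ h, X h ω) ≤ 12 * n * c := by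
  rw [expect_sum]
  refine (Finset.sum_le_card_nsmul _ _ c fun h _ => hX h).trans (le_of_eq ?_)
  rw [card_halfEdge, nsmul_eq_mul]
  push_cast
  ring

theorem le_expect_sum_halfEdge (X : HalfEdge n → Gluing n → ℝ) {c : ℝ}
    (hX : ∀ h, c ≤ expect (X h)) : 12 * n * c ≤ expect (fun ω => ∑ h, X h ω) := by
  rw [expect_sum]
  refine le_trans (le_of_eq ?_) (Finset.card_nsmul_le_sum _ _ c fun h _ => hX h)
  rw [card_halfEdge, nsmul_eq_mul]
  push_cast
  ring

theorem expect_numEdgesOfDegree_le {k : ℕ} (hk : 1 ≤ k) (hkn : 10 ^ 6 * k ≤ n) :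
    expect (fun ω : Gluing n => (ω.numEdgesOfDegree k : ℝ)) ≤
      1 / (2 * (k : ℝ)) + 6 * 10 ^ 6 / n := by
  have hk' : (1 : ℝ) ≤ k := by exact_mod_cast hk
  have hkn' : (10 : ℝ) ^ 6 * k ≤ n := by exact_mod_cast hkn
  have hn : (0 : ℝ) < n := by linarith
  set M : ℝ := 12 * n - 6 * k - 3 with hM
  have hM11 : 11 * (n : ℝ) ≤ M := by linarith
  have hM0 : 0 < M := by linarith
  simp only [numEdgesOfDegree_eq]
  have hp : ∀ h : HalfEdge n, expect (fun ω : Gluing n =>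
      1 / (2 * (k : ℝ)) * if ω.deg h = k then 1 else 0) ≤
      1 / (2 * (k : ℝ)) * (1 / (12 * n) + 10 ^ 6 * k / (n : ℝ) ^ 2) := by
    intro h
    rw [expect_const_mul]
    refine mul_le_mul_of_nonneg_left ?_ (by positivity)
    refine (prob_deg_eq_le h k hM0 (by linarith) (by linarith)).trans ?_
    -- The `6 k + 3` half-edges by which `M` falls short of `12 n` cost only a relative error `O(k /
    -- n)`.
    have h1 : 1 / M ≤ 1 / (12 * (n : ℝ)) + k / (n : ℝ) ^ 2 := by
      have : 1 / M - 1 / (12 * (n : ℝ)) = (6 * k + 3) / (12 * n * M) := by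
        field_simp
        linarith
      have h2 : (6 * (k : ℝ) + 3) / (12 * n * M) ≤ (12 * k) / (12 * n * n) := by
        gcongr <;> linarith
      have h3 : (12 * (k : ℝ)) / (12 * n * n) = k / (n : ℝ) ^ 2 := by
        field_simp
      linarith
    have h2 : 384 / M * (384 * 398 * k / M) ≤ (999999 : ℝ) * k / (n : ℝ) ^ 2 := by
      calc 384 / M * (384 * 398 * k / M)
          ≤ 384 / (11 * n) * (384 * 398 * k / (11 * n)) := by gcongr
        _ = (384 * 384 * 398 / 121) * k / (n : ℝ) ^ 2 := by field_simp; ring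
        _ ≤ (999999 : ℝ) * k / (n : ℝ) ^ 2 := by gcongr; norm_num
    calc _ ≤ (1 / (12 * (n : ℝ)) + k / (n : ℝ) ^ 2) + (999999 : ℝ) * k / (n : ℝ) ^ 2 :=
          add_le_add h1 h2
      _ = _ := by ring
  refine (expect_sum_halfEdge_le _ hp).trans (le_of_eq ?_)
  field_simp
  ring

theorem le_expect_numSimpleEdgesOfDegree {k : ℕ} (hk : 1 ≤ k) (hkn : k ≤ n) :
    1 / (2 * (k : ℝ)) * (1 - (k : ℝ) ^ 2 / n) ≤
      expect (fun ω : Gluing n => (ω.numSimpleEdgesOfDegree k : ℝ)) := by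
  classical
  have hk' : (1 : ℝ) ≤ k := by exact_mod_cast hk
  have hn : (1 : ℝ) ≤ n := by exact_mod_cast hk.trans hkn
  refine le_trans ?_ (expect_mono fun ω => le_numSimpleEdgesOfDegree k)
  refine le_trans (le_of_eq ?_) (le_expect_sum_halfEdge _
    (c := 1 / (2 * (k : ℝ)) * ((1 - (k : ℝ) ^ 2 / n) / (12 * n))) fun h => ?_)
  · field_simp
  · rw [expect_const_mul]
    refine mul_le_mul_of_nonneg_left ?_ (by positivity)
    refine (le_prob_simple h k hk hkn).trans (le_of_eq ?_)
    unfold prob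
    congr!

theorem expect_numSimpleEdgesOfDegree_le (k : ℕ) :
    expect (fun ω : Gluing n => (ω.numSimpleEdgesOfDegree k : ℝ)) ≤
      expect (fun ω : Gluing n => (ω.numEdgesOfDegree k : ℝ)) :=
  expect_mono fun _ => Nat.cast_le.2 (numSimpleEdgesOfDegree_le k)

theorem expect_sum_numEdgesOfDegree_le {k₁ k₂ : ℕ} (h1 : 1 ≤ k₁) (h2 : k₁ ≤ k₂)
    (hkn : 10 ^ 6 * k₂ ≤ n) :
    expect (fun ω : Gluing n => ∑ l ∈ Finset.Icc k₁ k₂, (ω.numEdgesOfDegree l : ℝ)) ≤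
      1 / 2 * Real.log ((k₂ : ℝ) / (k₁ : ℝ)) + 7 := by
  have hkn' : (10 : ℝ) ^ 6 * k₂ ≤ n := by exact_mod_cast hkn
  have h1' : (1 : ℝ) ≤ k₁ := by exact_mod_cast h1
  have h2' : (k₁ : ℝ) ≤ k₂ := by exact_mod_cast h2
  have hn : (0 : ℝ) < n := by linarith
  rw [expect_sum]
  have h3 : ∑ l ∈ Finset.Icc k₁ k₂, expect (fun ω : Gluing n => (ω.numEdgesOfDegree l : ℝ)) ≤
      ∑ l ∈ Finset.Icc k₁ k₂, (1 / 2 * (1 / (l : ℝ)) + 6 * 10 ^ 6 / n) := by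
    refine Finset.sum_le_sum fun l hl => ?_
    rw [Finset.mem_Icc] at hl
    refine (expect_numEdgesOfDegree_le (h1.trans hl.1) (by omega)).trans (le_of_eq ?_)
    rw [one_div_mul_one_div]
  refine h3.trans ?_
  rw [Finset.sum_add_distrib, ← Finset.mul_sum, Finset.sum_const, nsmul_eq_mul, Nat.card_Icc]
  have h4 := sum_le_log_div h1 h2
  have h5 : 1 / (k₁ : ℝ) ≤ 1 := by rw [div_le_one (by linarith)]; exact h1'
  have h6 : ((k₂ + 1 - k₁ : ℕ) : ℝ) * (6 * 10 ^ 6 / n) ≤ 6 := by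
    have : ((k₂ + 1 - k₁ : ℕ) : ℝ) ≤ k₂ := by exact_mod_cast (by omega : k₂ + 1 - k₁ ≤ k₂)
    rw [mul_div_assoc', div_le_iff₀ hn]
    nlinarith
  linarith

theorem expect_const (c : ℝ) : expect (fun _ : Gluing n => c) = c := by
  rw [expect, Finset.sum_const, nsmul_eq_mul, Finset.card_univ]
  exact mul_div_cancel_left₀ _ (Nat.cast_ne_zero.2 Fintype.card_ne_zero)

/-- The degree bounds hold up to a fixed fraction `K` of `n`. Half-edges of larger degree contribute
at most `12 n / (2 (K + 1))` in total, which is bounded. -/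
theorem expect_numEdges_le (hn : 10 ^ 6 ≤ n) :
    expect (fun ω : Gluing n => (ω.numEdges : ℝ)) ≤ 1 / 2 * Real.log n + 7 * 10 ^ 6 := by
  set K := n / 10 ^ 6 with hK
  have hK1 : 1 ≤ K := by omega
  have hKn : 10 ^ 6 * K ≤ n := by omega
  have hnK : n ≤ 10 ^ 6 * (K + 1) := by omega
  have hK1' : (1 : ℝ) ≤ K := by exact_mod_cast hK1
  have hKn' : (10 : ℝ) ^ 6 * K ≤ n := by exact_mod_cast hKn
  have hnK' : (n : ℝ) ≤ 10 ^ 6 * (K + 1) := by exact_mod_cast hnK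
  have h1 : expect (fun ω : Gluing n => (ω.numEdges : ℝ)) ≤
      expect (fun ω : Gluing n => (∑ l ∈ Finset.Icc 1 K, (ω.numEdgesOfDegree l : ℝ)) +
        12 * n * (1 / (2 * ((K : ℝ) + 1)))) := by
    refine expect_mono fun ω => ?_
    rw [numEdges_eq]
    refine (Finset.sum_le_sum fun h _ => inv_le_sum_ite K (ω.deg h) (deg_pos ω h)).trans ?_
    rw [Finset.sum_add_distrib, Finset.sum_comm, Finset.sum_const, card_halfEdge, nsmul_eq_mul]
    simp only [numEdgesOfDegree_eq]
    push_cast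
    exact le_rfl
  rw [expect_add, expect_const] at h1
  have h2 := expect_sum_numEdgesOfDegree_le le_rfl hK1 hKn
  have h3 : Real.log ((K : ℝ) / (1 : ℕ)) ≤ Real.log n := by
    rw [Nat.cast_one, div_one]
    exact Real.log_le_log (by linarith) (by linarith)
  have h4 : 12 * (n : ℝ) * (1 / (2 * ((K : ℝ) + 1))) ≤ 6 * 10 ^ 6 := by
    rw [mul_one_div, div_le_iff₀ (by positivity)]
    linarith
  linarith

/-- Simple edges, controlled only for `k = o(√n)`, would not give the full logarithm. The bound for
degree at most `k`, weighted by `1 / (k (k + 1))`, is valid up to a fixed fraction of `n` and loses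
only a bounded amount. -/
theorem le_expect_numEdges (hn : 10 ^ 6 ≤ n) :
    1 / 2 * Real.log n - 7 * 10 ^ 6 ≤ expect (fun ω : Gluing n => (ω.numEdges : ℝ)) := by
  classical
  set K := n / 10 ^ 6 with hK
  have hK1 : 1 ≤ K := by omega
  have hKn : 10 ^ 6 * K ≤ n := by omega
  have hnK : n ≤ 10 ^ 6 * (K + 1) := by omega
  have hK1' : (1 : ℝ) ≤ K := by exact_mod_cast hK1
  have hKn' : (10 : ℝ) ^ 6 * K ≤ n := by exact_mod_cast hKn
  have hnK' : (n : ℝ) ≤ 10 ^ 6 * (K + 1) := by exact_mod_cast hnK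
  have hn0 : (0 : ℝ) < n := by linarith
  set M : ℝ := 11 * n with hM
  have h1 : expect (fun ω : Gluing n => ∑ h, ∑ k ∈ Finset.Icc 1 K,
      1 / 2 * (1 / ((k : ℝ) * (k + 1))) * (if ω.deg h ≤ k then 1 else 0)) ≤
      expect (fun ω : Gluing n => (ω.numEdges : ℝ)) := by
    refine expect_mono fun ω => ?_
    rw [numEdges_eq]
    refine Finset.sum_le_sum fun h _ => ?_
    simp only [mul_assoc]
    have hd : (1 : ℝ) ≤ ω.deg h := by exact_mod_cast deg_pos ω h
    rw [← Finset.mul_sum, ← one_div_mul_one_div]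
    refine mul_le_mul_of_nonneg_left ?_ (by norm_num)
    refine (sum_ite_le_inv K _ (deg_pos ω h)).trans ?_
    split_ifs
    · have : (0 : ℝ) ≤ 1 / (K + 1) := by positivity
      linarith
    · positivity
  refine le_trans ?_ h1
  have h2 := le_expect_sum_halfEdge (fun h (ω : Gluing n) => ∑ k ∈ Finset.Icc 1 K,
      1 / 2 * (1 / ((k : ℝ) * (k + 1))) * (if ω.deg h ≤ k then (1 : ℝ) else 0))
    (c := ∑ k ∈ Finset.Icc 1 K, 1 / (24 * n) * (1 / ((k : ℝ) + 1) - 390 / M)) ?_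
  · refine le_trans ?_ h2
    rw [← Finset.mul_sum, Finset.sum_sub_distrib, Finset.sum_const, Nat.card_Icc, nsmul_eq_mul]
    have h3 : Real.log n - 10 ^ 6 ≤ ∑ k ∈ Finset.Icc 1 K, 1 / ((k : ℝ) + 1) := by
      have h4 : Real.log (K + 1) ≤ ∑ k ∈ Finset.Icc 1 K, 1 / (k : ℝ) := by
        simpa using log_succ_div_le_sum le_rfl hK1
      have h5 : ∑ k ∈ Finset.Icc 1 K, 1 / (k : ℝ) - ∑ k ∈ Finset.Icc 1 K, 1 / ((k : ℝ) + 1) ≤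
          1 := by
        have h6 := sum_ite_le_inv K 1 le_rfl
        rw [if_pos hK1] at h6
        have h7 : ∑ k ∈ Finset.Icc 1 K, 1 / ((k : ℝ) * (k + 1)) * (if 1 ≤ k then 1 else 0) =
            ∑ k ∈ Finset.Icc 1 K, 1 / (k : ℝ) - ∑ k ∈ Finset.Icc 1 K, 1 / ((k : ℝ) + 1) := by
          rw [← Finset.sum_sub_distrib]
          refine Finset.sum_congr rfl fun k hk => ?_
          have hk1 := (Finset.mem_Icc.1 hk).1
          have : (1 : ℝ) ≤ k := by exact_mod_cast hk1
          rw [if_pos hk1]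
          field_simp
          ring
        rw [h7] at h6
        have : (0 : ℝ) ≤ 1 / (K + 1) := by positivity
        have h8 : (1 : ℝ) / (1 : ℕ) = 1 := by simp
        linarith
      have h6 : Real.log n ≤ Real.log (10 ^ 6) + Real.log (K + 1) := by
        rw [← Real.log_mul (by positivity) (by positivity)]
        exact Real.log_le_log hn0 hnK'
      have h7 : Real.log (10 ^ 6) ≤ 10 ^ 6 - 1 := Real.log_le_sub_one_of_pos (by positivity)
      linarith
    have h4 : 12 * (n : ℝ) * (1 / (24 * n) * (∑ k ∈ Finset.Icc 1 K, 1 / ((k : ℝ) + 1) -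
        ((K + 1 - 1 : ℕ) : ℝ) * (390 / M))) = 1 / 2 * (∑ k ∈ Finset.Icc 1 K, 1 / ((k : ℝ) + 1) -
        K * (390 / M)) := by
      rw [Nat.add_sub_cancel]
      field_simp
      ring
    have h5 : (K : ℝ) * (390 / M) ≤ 1 := by
      rw [mul_div_assoc', div_le_one (by positivity)]
      linarith
    rw [h4]
    linarith
  · intro h
    rw [expect_sum]
    refine Finset.sum_le_sum fun k hk => ?_
    rw [Finset.mem_Icc] at hk
    have hk1 : (1 : ℝ) ≤ k := by exact_mod_cast hk.1
    have hk2 : (k : ℝ) ≤ K := by exact_mod_cast hk.2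
    rw [expect_const_mul]
    have h3 : (1 - 390 * k / M) / (12 * n) * k ≤
        expect fun ω : Gluing n => if ω.deg h ≤ k then (1 : ℝ) else 0 := by
      convert le_prob_deg_le h k (M := M) (by positivity) (by linarith) (by linarith)
      rfl
    refine le_trans ?_ (mul_le_mul_of_nonneg_left h3 (by positivity))
    have h4 : 1 / 2 * (1 / ((k : ℝ) * (k + 1))) * ((1 - 390 * k / M) / (12 * n) * k) =
        1 / (24 * n) * (1 / ((k : ℝ) + 1) - 390 / M * (k / (k + 1))) := by
      field_simp
      ring
    rw [h4]
    refine mul_le_mul_of_nonneg_left ?_ (by positivity)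
    have h5 : 390 / M * ((k : ℝ) / (k + 1)) ≤ 390 / M * 1 := by
      refine mul_le_mul_of_nonneg_left ?_ (by positivity)
      rw [div_le_one (by positivity)]
      linarith
    linarith

theorem expect_numAdjacentPairs_le {K L N : ℕ} (hK : K ≤ N) (hL : L ≤ N) (hN : 1 ≤ N)
    (hNn : 10 ^ 6 * N ≤ n) :
    expect (fun ω : Gluing n => (ω.numAdjacentPairs K L : ℝ)) ≤ 144 * 10 ^ 10 * (N ^ 3 / n) := by
  classical
  have hN1 : (1 : ℝ) ≤ N := by exact_mod_cast hN
  have hNn' : (10 : ℝ) ^ 6 * N ≤ n := by exact_mod_cast hNn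
  have hn0 : (0 : ℝ) < n := by linarith
  refine (expect_mono fun ω => numAdjacentPairs_le K L N hK hL).trans ?_
  rw [expect_sum]
  refine (Finset.sum_le_card_nsmul _ _ (10 ^ 10 * N ^ 3 / (n : ℝ) ^ 2) fun p _ => ?_).trans
    (le_of_eq ?_)
  · refine le_trans (le_of_eq ?_)
      -- The value `M = n` is wasteful but suffices: there are `144 n` pairs, each of probability
      -- `O(N³ / n²)`.
      (prob_distinct_edges_le p.1 p.2 N hN (M := n) hn0 (by linarith) (by linarith))
    unfold prob
    congr!
  · have : (Finset.univ.filter fun p : HalfEdge n × HalfEdge n => p.1.1.1 = p.2.1.1).card =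
        144 * n := by convert card_pairs_same_tet
    rw [this, nsmul_eq_mul]
    push_cast
    field_simp

end Gluing
end TetGluing

/-! ### Asymptotic statements. -/

namespace TetGluing
namespace Gluing

theorem eventually_le_mul_of_isLittleO {κ : ℕ → ℕ} {g : ℕ → ℝ} (hg : ∀ n, 0 ≤ g n)
    (hκ : (fun n => (κ n : ℝ)) =o[atTop] g) {δ : ℝ} (hδ : 0 < δ) :
    ∀ᶠ n : ℕ in atTop, (κ n : ℝ) ≤ δ * g n := by
  filter_upwards [hκ.bound hδ] with n hn
  rwa [Real.norm_of_nonneg (Nat.cast_nonneg _), Real.norm_of_nonneg (hg n)] at hn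

/-- For degrees `o(√n)`, the expected numbers of edges and of simple edges are both close to
`1 / (2 k)`. -/
theorem eventually_expect_bounds {κ : ℕ → ℕ}
    (hκ : (fun n => (κ n : ℝ)) =o[atTop] (fun n : ℕ => Real.sqrt n)) {ε : ℝ} (hε : 0 < ε) :
    ∀ᶠ n : ℕ in atTop, ∀ k : ℕ, 1 ≤ k → k ≤ κ n →
      1 / (2 * (k : ℝ)) * (1 - ε) ≤
        expect (fun ω : Gluing n => (ω.numSimpleEdgesOfDegree k : ℝ)) ∧
      expect (fun ω : Gluing n => (ω.numEdgesOfDegree k : ℝ)) ≤ 1 / (2 * (k : ℝ)) * (1 + ε) := by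
  set δ : ℝ := min 1 ε / 10 ^ 8 with hδ
  have hδ0 : 0 < δ := by positivity
  have hδ1 : 10 ^ 8 * δ ≤ 1 := by
    rw [hδ, mul_div_cancel₀ _ (by positivity)]
    exact min_le_left _ _
  have hδε : 10 ^ 8 * δ ≤ ε := by
    rw [hδ, mul_div_cancel₀ _ (by positivity)]
    exact min_le_right _ _
  filter_upwards [eventually_le_mul_of_isLittleO (fun n => Real.sqrt_nonneg _) hκ hδ0,
    eventually_ge_atTop 1] with n hn hn1 k hk1 hkκ
  have hn1' : (1 : ℝ) ≤ n := by exact_mod_cast hn1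
  have hk1' : (1 : ℝ) ≤ k := by exact_mod_cast hk1
  have hk : (k : ℝ) ≤ δ * Real.sqrt n := le_trans (by exact_mod_cast hkκ) hn
  have hs : Real.sqrt n ≤ n := Real.sqrt_le_iff.2 ⟨by positivity, by nlinarith⟩
  have hkn : (k : ℝ) ≤ δ * n := hk.trans (mul_le_mul_of_nonneg_left hs hδ0.le)
  have hkn' : (10 : ℝ) ^ 6 * k ≤ n := by nlinarith
  have hkn'' : 10 ^ 6 * k ≤ n := by exact_mod_cast hkn'
  constructor
  · refine le_trans ?_ (le_expect_numSimpleEdgesOfDegree hk1 (by omega))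
    refine mul_le_mul_of_nonneg_left (sub_le_sub_left ?_ 1) (by positivity)
    rw [div_le_iff₀ (by positivity)]
    calc (k : ℝ) ^ 2 ≤ (δ * Real.sqrt n) ^ 2 := by gcongr
      _ = δ * δ * n := by rw [mul_pow, Real.sq_sqrt (by positivity), sq]
      _ ≤ ε * n := by
        gcongr
        nlinarith
  -- Relative to `1 / (2 k)`, the error `6 * 10 ^ 6 / n` is `12 * 10 ^ 6 * k / n`, at most `ε` by
  -- the choice of `δ`.
  · refine (expect_numEdgesOfDegree_le hk1 hkn'').trans ?_
    rw [mul_one_add]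
    gcongr
    rw [div_le_iff₀ (by positivity), one_div_mul_eq_div, div_mul_eq_mul_div,
      le_div_iff₀ (by positivity)]
    nlinarith

theorem eventually_abs_expect_sum_sub_le {κ : ℕ → ℕ}
    (hκ : (fun n => (κ n : ℝ)) =o[atTop] (fun n : ℕ => Real.sqrt n)) {ε : ℝ} (hε : 0 < ε) :
    ∀ᶠ n : ℕ in atTop, ∀ k₁ k₂ : ℕ, 1 ≤ k₁ → k₁ ≤ k₂ → k₂ ≤ κ n →
      |expect (fun ω : Gluing n => ∑ l ∈ Finset.Icc k₁ k₂, (ω.numEdgesOfDegree l : ℝ))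
          - 1 / 2 * ∑ l ∈ Finset.Icc k₁ k₂, 1 / (l : ℝ)|
        ≤ ε * (1 / 2 * ∑ l ∈ Finset.Icc k₁ k₂, 1 / (l : ℝ)) := by
  filter_upwards [eventually_expect_bounds hκ hε] with n hn k₁ k₂ h1 _ h3
  rw [expect_sum, Finset.mul_sum, Finset.mul_sum, ← Finset.sum_sub_distrib]
  refine (Finset.abs_sum_le_sum_abs _ _).trans (Finset.sum_le_sum fun l hl => ?_)
  rw [Finset.mem_Icc] at hl
  obtain ⟨h4, h5⟩ := hn l (h1.trans hl.1) (hl.2.trans h3)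
  have h6 := expect_numSimpleEdgesOfDegree_le (n := n) l
  rw [one_div_mul_one_div, abs_le]
  constructor <;> linarith

/-- The harmonic sum differs from `log (k₂ / k₁)` by at most `1 / k₁`, and the assumption on `k₁ log
(k₂ / k₁)` says exactly that this is negligible. -/
theorem expect_sum_isEquivalent_log {κ : ℕ → ℕ}
    (hκ : (fun n => (κ n : ℝ)) =o[atTop] (fun n : ℕ => Real.sqrt n)) {k₁ k₂ : ℕ → ℕ}
    (hk : ∀ᶠ n in atTop, 1 ≤ k₁ n ∧ k₁ n ≤ k₂ n ∧ k₂ n ≤ κ n)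
    (hlog : Tendsto (fun n => (k₁ n : ℝ) * Real.log ((k₂ n : ℝ) / (k₁ n : ℝ))) atTop atTop) :
    (fun n : ℕ => expect (fun ω : Gluing n =>
        ∑ l ∈ Finset.Icc (k₁ n) (k₂ n), (ω.numEdgesOfDegree l : ℝ)))
      ~[atTop] (fun n : ℕ => 1 / 2 * Real.log ((k₂ n : ℝ) / (k₁ n : ℝ))) := by
  refine isLittleO_iff.2 fun c hc => ?_
  set ε : ℝ := min 1 c / 3 with hε
  have hε0 : 0 < ε := by positivity
  have hε1 : 3 * ε ≤ 1 := by
    rw [hε, mul_div_cancel₀ _ (by positivity)]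
    exact min_le_left _ _
  have hεc : 3 * ε ≤ c := by
    rw [hε, mul_div_cancel₀ _ (by positivity)]
    exact min_le_right _ _
  filter_upwards [hk, eventually_abs_expect_sum_sub_le hκ hε0,
    hlog.eventually_ge_atTop (1 / ε)] with n ⟨h1, h2, h3⟩ hn hl
  have hn := hn _ _ h1 h2 h3
  have h4 := log_div_le_sum h1 h2
  have h5 := sum_le_log_div h1 h2
  have hk1 : (0 : ℝ) < k₁ n := by exact_mod_cast h1
  rw [Pi.sub_apply, Real.norm_eq_abs, Real.norm_eq_abs]
  set L := Real.log ((k₂ n : ℝ) / (k₁ n : ℝ))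
  set S := ∑ l ∈ Finset.Icc (k₁ n) (k₂ n), 1 / (l : ℝ)
  have h6 : 1 / (k₁ n : ℝ) ≤ ε * L := by
    rw [div_le_iff₀ hε0] at hl
    rw [div_le_iff₀ hk1]
    linarith
  have hL : 0 < L := by
    have : 0 < ε * L := lt_of_lt_of_le (by positivity) h6
    exact pos_of_mul_pos_right this hε0.le
  rw [abs_of_pos (a := 1 / 2 * L) (by positivity)]
  rw [abs_le] at hn ⊢
  -- Here `S ≤ (1 + ε) L ≤ 2 L`.
  have h7 : ε * S ≤ 2 * ε * L := by nlinarith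
  have h8 : 3 * ε * L ≤ c * L := mul_le_mul_of_nonneg_right hεc hL.le
  constructor <;> linarith

theorem tendsto_expect_numAdjacentPairs {K L : ℕ → ℕ}
    (hK : (fun n => (K n : ℝ)) =o[atTop] (fun n : ℕ => (n : ℝ) ^ (1 / 3 : ℝ)))
    (hL : (fun n => (L n : ℝ)) =o[atTop] (fun n : ℕ => (n : ℝ) ^ (1 / 3 : ℝ))) :
    Tendsto (fun n : ℕ => expect (fun ω : Gluing n => (ω.numAdjacentPairs (K n) (L n) : ℝ)))
      atTop (𝓝 0) := by
  refine Metric.tendsto_nhds.2 fun ε hε => ?_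
  set δ : ℝ := min 1 ε / 10 ^ 13 with hδ
  have hδ0 : 0 < δ := by positivity
  have hδ1 : 10 ^ 13 * δ ≤ 1 := by
    rw [hδ, mul_div_cancel₀ _ (by positivity)]
    exact min_le_left _ _
  have hδε : 10 ^ 13 * δ ≤ ε := by
    rw [hδ, mul_div_cancel₀ _ (by positivity)]
    exact min_le_right _ _
  have hg : ∀ n : ℕ, (0 : ℝ) ≤ (n : ℝ) ^ (1 / 3 : ℝ) := fun n => by positivity
  have hT : Tendsto (fun n : ℕ => (n : ℝ) ^ (1 / 3 : ℝ)) atTop atTop :=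
    (tendsto_rpow_atTop (by norm_num)).comp tendsto_natCast_atTop_atTop
  filter_upwards [eventually_le_mul_of_isLittleO hg hK hδ0,
    eventually_le_mul_of_isLittleO hg hL hδ0, hT.eventually_ge_atTop (1 / δ),
    eventually_ge_atTop 1] with n hKn hLn hn hn1
  have hn1' : (1 : ℝ) ≤ n := by exact_mod_cast hn1
  set r : ℝ := (n : ℝ) ^ (1 / 3 : ℝ)
  have hr3 : r ^ 3 = n := by
    rw [← Real.rpow_natCast, ← Real.rpow_mul (by positivity)]
    norm_num
  have hrn : r ≤ n := by
    refine (Real.rpow_le_rpow_of_exponent_le hn1' (by norm_num : (1 / 3 : ℝ) ≤ 1)).trans ?_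
    rw [Real.rpow_one]
  rw [div_le_iff₀ hδ0] at hn
  -- The maximum with `1` meets the requirement `1 ≤ N`; it is harmless since `n ^ (1 / 3)`
  -- eventually exceeds `1 / δ`.
  set N := max (max (K n) (L n)) 1 with hN
  have hNr : (N : ℝ) ≤ δ * r := by
    rw [hN]
    push_cast
    exact max_le (max_le hKn hLn) (by linarith)
  have hNn : 10 ^ 6 * N ≤ n := by
    have h1 : (10 : ℝ) ^ 6 * N ≤ n := by
      have : δ * r ≤ δ * n := mul_le_mul_of_nonneg_left hrn hδ0.le
      nlinarith
    exact_mod_cast h1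
  have h1 := expect_numAdjacentPairs_le (n := n) (K := K n) (L := L n) (N := N)
    ((le_max_left _ _).trans (le_max_left _ _)) ((le_max_right _ _).trans (le_max_left _ _))
    (le_max_right _ _) hNn
  rw [Real.dist_eq, sub_zero, abs_of_nonneg (expect_nonneg fun _ => Nat.cast_nonneg _)]
  have h2 : (N : ℝ) ^ 3 / n ≤ δ := by
    rw [div_le_iff₀ (by positivity)]
    calc (N : ℝ) ^ 3 ≤ (δ * r) ^ 3 := by gcongr
      _ = δ ^ 3 * n := by rw [mul_pow, hr3]
      _ ≤ δ * n := by
        gcongr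
        exact pow_le_of_le_one hδ0.le (by linarith) (by norm_num)
  linarith

end Gluing
end TetGluing

theorem theorem2p3 :
    -- total number of edges
    ((fun n : ℕ => expect (fun ω : Gluing n => (ω.numEdges : ℝ)) - 1 / 2 * Real.log n)
      =O[atTop] (fun _ => (1 : ℝ))) ∧
    -- simple edges of degree `k = o(√n)`, uniformly in `k`
    (∀ κ : ℕ → ℕ, (fun n => (κ n : ℝ)) =o[atTop] (fun n : ℕ => Real.sqrt n) →
      ∀ ε : ℝ, 0 < ε → ∀ᶠ n : ℕ in atTop, ∀ k : ℕ, 1 ≤ k → k ≤ κ n →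
        |expect (fun ω : Gluing n => (ω.numSimpleEdgesOfDegree k : ℝ)) - 1 / (2 * (k : ℝ))|
          ≤ ε * (1 / (2 * (k : ℝ)))) ∧
    -- upper bounds for degrees `o(n)`
    (∀ κ : ℕ → ℕ, (fun n => (κ n : ℝ)) =o[atTop] (fun n : ℕ => (n : ℝ)) →
      ∃ C : ℝ, ∀ᶠ n : ℕ in atTop,
        (∀ k : ℕ, 1 ≤ k → k ≤ κ n →
          expect (fun ω : Gluing n => (ω.numEdgesOfDegree k : ℝ))
            ≤ 1 / (2 * (k : ℝ)) + C / (n : ℝ)) ∧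
        (∀ k₁ k₂ : ℕ, 1 ≤ k₁ → k₁ ≤ k₂ → k₂ ≤ κ n →
          expect (fun ω : Gluing n => ∑ l ∈ Finset.Icc k₁ k₂, (ω.numEdgesOfDegree l : ℝ))
            ≤ 1 / 2 * Real.log ((k₂ : ℝ) / (k₁ : ℝ)) + C)) ∧
    -- asymptotics for degrees `o(√n)`
    (∀ κ : ℕ → ℕ, (fun n => (κ n : ℝ)) =o[atTop] (fun n : ℕ => Real.sqrt n) →
      (∀ ε : ℝ, 0 < ε → ∀ᶠ n : ℕ in atTop,
        (∀ k : ℕ, 1 ≤ k → k ≤ κ n →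
          |expect (fun ω : Gluing n => (ω.numEdgesOfDegree k : ℝ)) - 1 / (2 * (k : ℝ))|
            ≤ ε * (1 / (2 * (k : ℝ)))) ∧
        (∀ k₁ k₂ : ℕ, 1 ≤ k₁ → k₁ ≤ k₂ → k₂ ≤ κ n →
          |expect (fun ω : Gluing n => ∑ l ∈ Finset.Icc k₁ k₂, (ω.numEdgesOfDegree l : ℝ))
              - 1 / 2 * ∑ l ∈ Finset.Icc k₁ k₂, 1 / (l : ℝ)|
            ≤ ε * (1 / 2 * ∑ l ∈ Finset.Icc k₁ k₂, 1 / (l : ℝ))) ∧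
        (∀ k : ℕ, 1 ≤ k → k ≤ κ n →
          |expect (fun ω : Gluing n =>
              (ω.numEdgesOfDegree k : ℝ) - (ω.numSimpleEdgesOfDegree k : ℝ))| ≤ ε)) ∧
      (∀ k₁ k₂ : ℕ → ℕ, (∀ᶠ n in atTop, 1 ≤ k₁ n ∧ k₁ n ≤ k₂ n ∧ k₂ n ≤ κ n) →
        Tendsto (fun n => (k₁ n : ℝ) * Real.log ((k₂ n : ℝ) / (k₁ n : ℝ))) atTop atTop →
        (fun n : ℕ => expect (fun ω : Gluing n =>
            ∑ l ∈ Finset.Icc (k₁ n) (k₂ n), (ω.numEdgesOfDegree l : ℝ)))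
          ~[atTop] (fun n : ℕ => 1 / 2 * Real.log ((k₂ n : ℝ) / (k₁ n : ℝ))))) ∧
    -- pairs of short edges in a common tetrahedron
    (∀ K L : ℕ → ℕ,
      (fun n => (K n : ℝ)) =o[atTop] (fun n : ℕ => (n : ℝ) ^ (1 / 3 : ℝ)) →
      (fun n => (L n : ℝ)) =o[atTop] (fun n : ℕ => (n : ℝ) ^ (1 / 3 : ℝ)) →
      Tendsto (fun n : ℕ => expect (fun ω : Gluing n => (ω.numAdjacentPairs (K n) (L n) : ℝ)))
        atTop (𝓝 0)) := by
  refine ⟨?_, ?_, ?_, fun κ hκ => ⟨?_, ?_⟩, ?_⟩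
  · refine IsBigO.of_bound (7 * 10 ^ 6) ?_
    filter_upwards [eventually_ge_atTop (10 ^ 6)] with n hn
    rw [Real.norm_eq_abs, norm_one, mul_one, abs_le]
    constructor
    · linarith [Gluing.le_expect_numEdges hn]
    · linarith [Gluing.expect_numEdges_le hn]
  · intro κ hκ ε hε
    filter_upwards [Gluing.eventually_expect_bounds hκ hε] with n hn k h1 h2
    obtain ⟨h3, h4⟩ := hn k h1 h2
    have h5 := Gluing.expect_numSimpleEdgesOfDegree_le (n := n) k
    rw [abs_le]
    constructor <;> linarith
  · intro κ hκ
    refine ⟨6 * 10 ^ 6, ?_⟩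
    filter_upwards [Gluing.eventually_le_mul_of_isLittleO (fun n => Nat.cast_nonneg n) hκ
      (show (0 : ℝ) < 1 / 10 ^ 6 by positivity)] with n hn
    rw [one_div_mul_eq_div, le_div_iff₀ (by positivity), mul_comm] at hn
    have hn : 10 ^ 6 * κ n ≤ n := by exact_mod_cast hn
    refine ⟨fun k h1 h2 => Gluing.expect_numEdgesOfDegree_le h1 (by omega), fun k₁ k₂ h1 h2 h3 => ?_⟩
    linarith [Gluing.expect_sum_numEdgesOfDegree_le (n := n) h1 h2 (by omega)]
  · intro ε hε
    filter_upwards [Gluing.eventually_expect_bounds hκ hε,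
      Gluing.eventually_abs_expect_sum_sub_le hκ hε] with n hn hs
    refine ⟨fun k h1 h2 => ?_, hs, fun k h1 h2 => ?_⟩
    · obtain ⟨h3, h4⟩ := hn k h1 h2
      have h5 := Gluing.expect_numSimpleEdgesOfDegree_le (n := n) k
      rw [abs_le]
      constructor <;> linarith
    · obtain ⟨h3, h4⟩ := hn k h1 h2
      have h5 := Gluing.expect_numSimpleEdgesOfDegree_le (n := n) k
      -- The two expectations lie within `ε / (2 k)` of `1 / (2 k)` on opposite sides, so they
      -- differ by at most `ε / k ≤ ε`.
      have h6 : 1 / (2 * (k : ℝ)) * ε ≤ 1 / 2 * ε := by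
        have : (1 : ℝ) ≤ k := by exact_mod_cast h1
        gcongr
        linarith
      rw [Gluing.expect_sub, abs_le]
      constructor <;> linarith
  · exact fun _ _ hk hlog => Gluing.expect_sum_isEquivalent_log hκ hk hlog
  · exact fun _ _ hK hL => Gluing.tendsto_expect_numAdjacentPairs hK hL
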